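/- **Setting.** Fix $\varepsilon>0$ and $\gamma>0$. For a real matrix $P$ with reduced singular value decomposition $P=U\operatorname{diag}(\sigma_1,\dots,\sigma_s)V^\top$ put $\operatorname{Orth}_\varepsilon(P)=U\operatorname{diag}\big(\sigma_i/\sqrt{\sigma_i^2+\varepsilon^2}\big)_{i\le s}V^\top$. Let $\Theta=\prod_{b=1}^B\mathbb R^{m_b\times n_b}$ carry the inner product $\langle\theta,\vartheta\rangle=\sum_b\operatorname{tr}\big((\theta^{(b)})^\top\vartheta^{(b)}\big)$, and let $O=\operatorname{Orth}_\varepsilon^\Theta$ be the map $\Theta\to\Theta$ that applies $\operatorname{Orth}_\varepsilon$ to every block. Let $\mathcal H$ be a real Hilbert space, and let $F:\Theta\to\mathcal H$ and $\mathcal R:\mathcal H\to\mathbb R$ be Fréchet differentiable. For $m\in\mathcal H$ put $a(m,\theta)=DF(\theta)^*\nabla\mathcal R(m)\in\Theta$. *Global hypotheses:* $F$, $DF$ and $\nabla\mathcal R$ are globally Lipschitz, and $DF$ and $\nabla\mathcal R$ are bounded. *Localized hypotheses:* $F,DF,\nabla\mathcal R$ are bounded and Lipschitz on every ball. *Scalar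 single-matrix case:* $\Theta=\mathbb R^{p\times q}$, $\mathcal H=\mathbb R$, $a(s,W)=\mathcal R'(s)\nabla F(W)$. Here the global hypotheses are: $F\in C^1$ with $\nabla F$ bounded and globally Lipschitz, and $\mathcal R$ differentiable with $\mathcal R'$ bounded and globally Lipschitz. **Theorem.** The following holds in the scalar single-matrix case and in the general case. **(1) Finite-particle ODE limit.** Assume the global or the localized hypotheses. Let $N\ge1$ and $(\theta_{i,0},P_{i,0})_{i\le N}\in(\Theta\times\Theta)^N$. The system $$\dot\theta_i=-O(P_i),\qquad \dot P_i=\gamma\Big(a\Big(\tfrac1N\sum_{j=1}^NF(\theta_j),\theta_i\Big)-P_i\Big),\qquad i=1,\dots,N,$$ with these initial data has a solution on $[0,\infty)$, and it is the only solution on every interval $[0,T]$. Let $h\mapsto r_h$ satisfy $r_h/h\to0$ as $h\downarrow0$, and put $\eta=h$, $\beta=1-\gamma h+r_h$. Let $(\theta^h,P^h)$ be the piecewise-linear interpolation, at the times $kh$, of the iterates of the regularized Muon scheme $$P_{i,k+1}=\beta P_{i,k}+(1-\beta)\,a\Big(\tfrac1N\sum_{j=1}^NF(\theta_{j,k}),\theta_{i,k}\Big),\qquad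 \theta_{i,k+1}=\theta_{i,k}-\eta\,O(P_{i,k+1}).$$ Then for every $T>0$, with $\|U\|_{\rm avg}^2=\frac1N\sum_i\|U_i\|^2$, $$\sup_{0\le t\le T}\big(\|\theta^h(t)-\theta(t)\|_{\rm avg}+\|P^h(t)-P(t)\|_{\rm avg}\big)\to0\quad(h\downarrow0),$$ and this supremum is $O(h)$ if $r_h=O(h^2)$. **(2) Mean-field equation, global form.** Assume the global hypotheses. Let $\mathcal Z=\Theta\times\Theta$, and let $\mathcal P_1(\mathcal Z)$ be the space of probability measures with finite first moment, with the $1$-Wasserstein topology. For every $\mu_0\in\mathcal P_1(\mathcal Z)$ there is $\mu\in C([0,\infty);\mathcal P_1(\mathcal Z))$ with initial value $\mu_0$ that solves $$\partial_t\mu_t+\nabla_\theta\cdot\big(-O(p)\mu_t\big)+\nabla_p\cdot\big(\gamma(a(m_t,\theta)-p)\mu_t\big)=0,\qquad m_t=\int F(\theta)\,d\mu_t(\theta,p),$$ weakly, that is, for all $\zeta\in C_c^\infty(\mathcal Z)$ and all $t$, $$\frac{d}{dt}\int\zeta\,d\mu_t=\int\big[\langle\nabla_\theta\zeta,-O(p)\rangle+\langle\nabla_p\zeta,\gamma(a(m_t,\theta)-p)\rangle\big]\,d\mu_t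 .$$ For every $T$, it is the only weak solution in $C([0,T];\mathcal P_1(\mathcal Z))$ with initial value $\mu_0$. It is the law of the nonlinear characteristics: for every random variable $(\Theta_0,P_0)\sim\mu_0$ on a probability space, the system $\dot\Theta_t=-O(P_t)$, $\dot P_t=\gamma\big(a(\mathbb E F(\Theta_t),\Theta_t)-P_t\big)$ started at $(\Theta_0,P_0)$ has an almost surely unique solution, and $\operatorname{Law}(\Theta_t,P_t)=\mu_t$ for all $t\ge0$. **(3) Mean-field equation, localized form.** Assume the localized hypotheses, let $\mu_0$ be a compactly supported probability measure on $\mathcal Z$, and let $T>0$. Then there is a weak solution $\mu\in C([0,T];\mathcal P_1(\mathcal Z))$ with initial value $\mu_0$ for which all $\mu_t$, $t\in[0,T]$, are supported in one bounded set. It is the only weak solution with this property, and on $[0,T]$ it is the law of the nonlinear characteristics, in the sense of (2). -/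

import Mathlib

open scoped Matrix
open MeasureTheory Filter Topology Set
open scoped ContDiff

universe u v w

namespace Muon

noncomputable section

/-- A reduced (compact) singular value decomposition `P = U diag(σ) Vᵀ` of a real matrix: `U` and
`V` have orthonormal columns and all listed singular values are positive. -/
structure ReducedSVD {m n : ℕ} (P : Matrix (Fin m) (Fin n) ℝ) where
  rank : ℕ
  U : Matrix (Fin m) (Fin rank) ℝ
  σ : Fin rank → ℝ
  V : Matrix (Fin n) (Fin rank) ℝ
  orthoU : Uᵀ * U = 1
  orthoV : Vᵀ * V = 1
  pos : ∀ i, 0 < σ i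
  eq : P = U * Matrix.diagonal σ * Vᵀ

/-- `U diag(σᵢ / √(σᵢ² + ε²)) Vᵀ`. -/
def ReducedSVD.saturate {m n : ℕ} {P : Matrix (Fin m) (Fin n) ℝ}
    (D : ReducedSVD P) (ε : ℝ) : Matrix (Fin m) (Fin n) ℝ :=
  D.U * Matrix.diagonal (fun i => D.σ i / √(D.σ i ^ 2 + ε ^ 2)) * D.Vᵀ

/-- Every real matrix has a reduced singular value decomposition. -/
theorem ReducedSVD.nonempty {m n : ℕ} (P : Matrix (Fin m) (Fin n) ℝ) :
    Nonempty (ReducedSVD P) := by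
  classical
  have hA : (Pᵀ * P).IsHermitian := by
    simpa [Matrix.conjTranspose_eq_transpose_of_trivial]
      using Matrix.isHermitian_conjTranspose_mul_self P
  have hpsd : (Pᵀ * P).PosSemidef := by
    simpa [Matrix.conjTranspose_eq_transpose_of_trivial]
      using Matrix.posSemidef_conjTranspose_mul_self P
  set lam : Fin n → ℝ := hA.eigenvalues with hlam
  have hlam0 : ∀ j, 0 ≤ lam j := hpsd.eigenvalues_nonneg
  let Q : Matrix (Fin n) (Fin n) ℝ := Matrix.of fun i j => hA.eigenvectorBasis j i
  have hQQ : Qᵀ * Q = 1 := by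
    ext i j
    have h := orthonormal_iff_ite.1 hA.eigenvectorBasis.orthonormal i j
    simp only [PiLp.inner_apply, RCLike.inner_apply, conj_trivial] at h
    rw [Matrix.mul_apply, Matrix.one_apply, ← h]
    simp [Q, mul_comm]
  have hQQ' : Q * Qᵀ = 1 := mul_eq_one_comm.mp hQQ
  have hAQ : Pᵀ * P * Q = Q * Matrix.diagonal lam := by
    ext i j
    have h := congrFun (hA.mulVec_eigenvectorBasis j) i
    simp only [Matrix.mulVec, dotProduct, Pi.smul_apply, smul_eq_mul] at h
    rw [Matrix.mul_apply, Matrix.mul_diagonal]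
    simpa [Q, mul_comm] using h
  have hgram : (P * Q)ᵀ * (P * Q) = Matrix.diagonal lam := by
    rw [Matrix.transpose_mul, Matrix.mul_assoc, ← Matrix.mul_assoc Pᵀ, hAQ, ← Matrix.mul_assoc,
      hQQ, Matrix.one_mul]
  let e : Fin (Fintype.card {j // lam j ≠ 0}) ≃ {j // lam j ≠ 0} :=
    (Fintype.equivFin {j // lam j ≠ 0}).symm
  let f : Fin (Fintype.card {j // lam j ≠ 0}) → Fin n := fun k => (e k : Fin n)
  have hf : Function.Injective f := Subtype.val_injective.comp e.injective
  have hpos : ∀ k, 0 < lam (f k) := fun k => lt_of_le_of_ne (hlam0 _) (e k).2.symm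
  have hgr : ∀ i j, ∑ x, (P * Q) x i * (P * Q) x j = Matrix.diagonal lam i j := by
    intro i j
    rw [← hgram, Matrix.mul_apply]; rfl
  refine ⟨⟨Fintype.card {j // lam j ≠ 0},
    Matrix.of fun i k => (√(lam (f k)))⁻¹ * (P * Q) i (f k), fun k => √(lam (f k)),
    Matrix.of fun i k => Q i (f k), ?_, ?_, fun k => Real.sqrt_pos.2 (hpos k), ?_⟩⟩
  · ext k l
    have h : ∑ x, ((√(lam (f k)))⁻¹ * (P * Q) x (f k)) * ((√(lam (f l)))⁻¹ * (P * Q) x (f l))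
        = (√(lam (f k)))⁻¹ * (√(lam (f l)))⁻¹ * ∑ x, (P * Q) x (f k) * (P * Q) x (f l) := by
      rw [Finset.mul_sum]
      exact Finset.sum_congr rfl fun x _ => by ring
    rw [Matrix.mul_apply]
    simp only [Matrix.transpose_apply, Matrix.of_apply]
    rw [h, hgr]
    by_cases hkl : k = l
    · subst hkl
      have := Real.mul_self_sqrt (hpos k).le
      have h0 := (Real.sqrt_pos.2 (hpos k)).ne'
      simp only [Matrix.diagonal_apply_eq, Matrix.one_apply_eq]
      field_simp
      nlinarith
    · rw [Matrix.diagonal_apply_ne _ (fun h => hkl (hf h)), Matrix.one_apply_ne hkl, mul_zero]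
  · ext k l
    have h : (Qᵀ * Q) (f k) (f l) = (1 : Matrix (Fin n) (Fin n) ℝ) (f k) (f l) := by rw [hQQ]
    rw [Matrix.mul_apply] at h ⊢
    simp only [Matrix.transpose_apply, Matrix.of_apply] at h ⊢
    rw [h]
    simp only [Matrix.one_apply, hf.eq_iff]
  · have hz : ∀ i j, lam j = 0 → (P * Q) i j = 0 := by
      intro i j hj
      have h := hgr j j
      rw [Matrix.diagonal_apply_eq, hj] at h
      have := (Finset.sum_eq_zero_iff_of_nonneg (fun x _ => mul_self_nonneg ((P * Q) x j))).1 h i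
        (Finset.mem_univ i)
      exact mul_self_eq_zero.1 this
    have hP : P = (P * Q) * Qᵀ := by rw [Matrix.mul_assoc, hQQ', Matrix.mul_one]
    ext i j
    conv_lhs => rw [hP]
    rw [Matrix.mul_apply, Matrix.mul_apply]
    simp only [Matrix.mul_diagonal, Matrix.transpose_apply, Matrix.of_apply]
    have h1 : ∀ k, (√(lam (f k)))⁻¹ * (P * Q) i (f k) * √(lam (f k)) * Q j (f k)
        = (P * Q) i (f k) * Q j (f k) := by
      intro k
      have h0 := (Real.sqrt_pos.2 (hpos k)).ne'
      field_simp
    rw [Finset.sum_congr rfl fun k _ => h1 k,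
      ← Equiv.sum_comp e.symm (fun k => (P * Q) i (f k) * Q j (f k))]
    simp only [f, Equiv.apply_symm_apply]
    have h2 : ∑ x ∈ Finset.univ.filter (fun x => lam x ≠ 0), (P * Q) i x * Q j x
        = ∑ x, (P * Q) i x * Q j x := by
      refine Finset.sum_filter_of_ne fun x _ hx hl => hx ?_
      rw [hz i x hl, zero_mul]
    rw [← h2]
    exact Finset.sum_subtype _ (fun x => by simp) (fun x => (P * Q) i x * Q j x)

/-- The saturated matrix does not depend on the decomposition. -/
theorem ReducedSVD.saturate_eq {m n : ℕ} {P : Matrix (Fin m) (Fin n) ℝ}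
    (D D' : ReducedSVD P) (ε : ℝ) : D.saturate ε = D'.saturate ε := by
  classical
  let s : Finset ℝ := Finset.univ.image (fun i => D.σ i ^ 2) ∪ Finset.univ.image (fun i => D'.σ i ^ 2)
  let p : Polynomial ℝ := Lagrange.interpolate s id (fun x => 1 / √(x + ε ^ 2))
  have hp : ∀ x ∈ s, p.eval x = 1 / √(x + ε ^ 2) := fun x hx =>
    Lagrange.eval_interpolate_at_node (v := id) _ Function.injective_id.injOn hx
  have key : ∀ E : ReducedSVD P, (∀ i, E.σ i ^ 2 ∈ s) →
      E.saturate ε = P * Polynomial.aeval (Pᵀ * P) p := by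
    intro E hE
    have hA : Pᵀ * P = E.V * Matrix.diagonal (fun i => E.σ i ^ 2) * E.Vᵀ := by
      conv_lhs => rw [E.eq]
      simp only [Matrix.transpose_mul, Matrix.transpose_transpose, Matrix.diagonal_transpose,
        Matrix.mul_assoc]
      rw [← Matrix.mul_assoc E.Uᵀ, E.orthoU, Matrix.one_mul,
        ← Matrix.mul_assoc (Matrix.diagonal E.σ), Matrix.diagonal_mul_diagonal]
      simp only [pow_two]
    have hVA : E.Vᵀ * (Pᵀ * P) = Matrix.diagonal (fun i => E.σ i ^ 2) * E.Vᵀ := by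
      rw [hA, ← Matrix.mul_assoc, ← Matrix.mul_assoc, E.orthoV, Matrix.one_mul]
    have hpoly : ∀ r : Polynomial ℝ, E.Vᵀ * Polynomial.aeval (Pᵀ * P) r =
        Matrix.diagonal (fun i => r.eval (E.σ i ^ 2)) * E.Vᵀ := by
      intro r
      induction r using Polynomial.induction_on' with
      | add a b ha hb =>
        simp only [map_add, Matrix.mul_add, ha, hb, Polynomial.eval_add, ← Matrix.add_mul,
          Matrix.diagonal_add]
      | monomial k c =>
        induction k with
        | zero =>
          ext i j
          simp [Matrix.diagonal_mul, Algebra.algebraMap_eq_smul_one]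
        | succ k ih =>
          have : Polynomial.monomial (k + 1) c = Polynomial.monomial k c * Polynomial.X := by
            rw [Polynomial.monomial_mul_X]
          rw [this, map_mul, Polynomial.aeval_X, ← Matrix.mul_assoc, ih, Matrix.mul_assoc, hVA,
            ← Matrix.mul_assoc, Matrix.diagonal_mul_diagonal]
          simp only [Polynomial.eval_mul, Polynomial.eval_X]
    have hPE : P * Polynomial.aeval (Pᵀ * P) p
        = E.U * Matrix.diagonal E.σ * (E.Vᵀ * Polynomial.aeval (Pᵀ * P) p) := by
      rw [← Matrix.mul_assoc, ← E.eq]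
    rw [hPE, hpoly, ReducedSVD.saturate, ← Matrix.mul_assoc (E.U * Matrix.diagonal E.σ),
      Matrix.mul_assoc E.U (Matrix.diagonal E.σ), Matrix.diagonal_mul_diagonal]
    congr 3
    funext i
    rw [hp _ (hE i)]
    ring
  rw [key D fun i => Finset.mem_union_left _ (Finset.mem_image_of_mem _ (Finset.mem_univ i)),
    key D' fun i => Finset.mem_union_right _ (Finset.mem_image_of_mem _ (Finset.mem_univ i))]

/-- `Orth_ε(P) = U diag(σᵢ / √(σᵢ² + ε²)) Vᵀ` for a reduced singular value decomposition of `P`;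
by `ReducedSVD.saturate_eq` the choice of the decomposition is irrelevant. -/
def orthMatrix {m n : ℕ} (ε : ℝ) (P : Matrix (Fin m) (Fin n) ℝ) : Matrix (Fin m) (Fin n) ℝ :=
  (Classical.choice (ReducedSVD.nonempty P)).saturate ε

theorem orthMatrix_eq {m n : ℕ} (ε : ℝ) {P : Matrix (Fin m) (Fin n) ℝ} (D : ReducedSVD P) :
    orthMatrix ε P = D.U * Matrix.diagonal (fun i => D.σ i / √(D.σ i ^ 2 + ε ^ 2)) * D.Vᵀ :=
  ReducedSVD.saturate_eq _ D ε

/-- The space of real `m × n` matrices with the Frobenius inner product `∑ᵢⱼ Aᵢⱼ Bᵢⱼ`. -/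
abbrev MatrixSpace (m n : ℕ) : Type := EuclideanSpace ℝ (Fin m × Fin n)

def MatrixSpace.toMatrix {m n : ℕ} (A : MatrixSpace m n) : Matrix (Fin m) (Fin n) ℝ :=
  Matrix.of fun i j => A (i, j)

def MatrixSpace.ofMatrix {m n : ℕ} (A : Matrix (Fin m) (Fin n) ℝ) : MatrixSpace m n :=
  WithLp.toLp 2 fun ij => A ij.1 ij.2

/-- `Orth_ε` on the matrix space with the Frobenius inner product. -/
def orth {m n : ℕ} (ε : ℝ) (P : MatrixSpace m n) : MatrixSpace m n :=
  MatrixSpace.ofMatrix (orthMatrix ε P.toMatrix)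

/-- The finite product `Θ = ∏_b ℝ^{m_b × n_b}` of matrix blocks, with the Hilbert inner product
`∑_b ⟨θ_b, ϑ_b⟩_F`. -/
abbrev ProductSpace {B : ℕ} (m n : Fin B → ℕ) : Type :=
  PiLp 2 fun b => MatrixSpace (m b) (n b)

/-- The blockwise map `Orth_ε^Θ`. -/
def orthProduct {B : ℕ} {m n : Fin B → ℕ} (ε : ℝ) (P : ProductSpace m n) : ProductSpace m n :=
  WithLp.toLp 2 fun b => orth ε (P b)

section Assumptions

variable {E : Type v} [NormedAddCommGroup E] [InnerProductSpace ℝ E] [CompleteSpace E]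
variable {H : Type u} [NormedAddCommGroup H] [InnerProductSpace ℝ H] [CompleteSpace H]

/-- Assumption on scalar data: `F` is `C¹` with bounded, globally Lipschitz gradient, and `R` has a
bounded, globally Lipschitz derivative. -/
structure BasicSmoothness (F : E → ℝ) (R : ℝ → ℝ) : Prop where
  contDiff : ContDiff ℝ 1 F
  lipschitz_grad : ∃ L : ℝ, ∀ x y, ‖gradient F x - gradient F y‖ ≤ L * ‖x - y‖
  bounded_grad : ∃ M : ℝ, ∀ x, ‖gradient F x‖ ≤ M
  differentiable : Differentiable ℝ R
  lipschitz_deriv : ∃ L : ℝ, ∀ s t, |deriv R s - deriv R t| ≤ L * |s - t|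
  bounded_deriv : ∃ M : ℝ, ∀ s, |deriv R s| ≤ M

/-- Global smoothness of a Hilbert-valued feature map `F` and of a functional `R`. -/
structure GlobalSmoothness (F : E → H) (R : H → ℝ) : Prop where
  differentiable_F : Differentiable ℝ F
  lipschitz_F : ∃ L : ℝ, ∀ x y, ‖F x - F y‖ ≤ L * ‖x - y‖
  bounded_DF : ∃ M : ℝ, ∀ x, ‖fderiv ℝ F x‖ ≤ M
  lipschitz_DF : ∃ L : ℝ, ∀ x y, ‖fderiv ℝ F x - fderiv ℝ F y‖ ≤ L * ‖x - y‖
  differentiable_R : Differentiable ℝ R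
  bounded_grad_R : ∃ M : ℝ, ∀ z, ‖gradient R z‖ ≤ M
  lipschitz_grad_R : ∃ L : ℝ, ∀ z z', ‖gradient R z - gradient R z'‖ ≤ L * ‖z - z'‖

/-- Localized smoothness: the constants are finite on every ball, and may depend on its radius. -/
structure LocalizedSmoothness (F : E → H) (R : H → ℝ) : Prop where
  differentiable_F : Differentiable ℝ F
  bounded_F : ∀ r : ℝ, ∃ M : ℝ, ∀ x, ‖x‖ ≤ r → ‖F x‖ ≤ M
  lipschitz_F : ∀ r : ℝ, ∃ L : ℝ, ∀ x y, ‖x‖ ≤ r → ‖y‖ ≤ r → ‖F x - F y‖ ≤ L * ‖x - y‖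
  bounded_DF : ∀ r : ℝ, ∃ M : ℝ, ∀ x, ‖x‖ ≤ r → ‖fderiv ℝ F x‖ ≤ M
  lipschitz_DF : ∀ r : ℝ, ∃ L : ℝ, ∀ x y, ‖x‖ ≤ r → ‖y‖ ≤ r →
    ‖fderiv ℝ F x - fderiv ℝ F y‖ ≤ L * ‖x - y‖
  differentiable_R : Differentiable ℝ R
  bounded_grad_R : ∀ r : ℝ, ∃ M : ℝ, ∀ z, ‖z‖ ≤ r → ‖gradient R z‖ ≤ M
  lipschitz_grad_R : ∀ r : ℝ, ∃ L : ℝ, ∀ z z', ‖z‖ ≤ r → ‖z'‖ ≤ r →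
    ‖gradient R z - gradient R z'‖ ≤ L * ‖z - z'‖

/-- The force `R'(s) ∇F(W)` for scalar data. -/
def scalarForce (F : E → ℝ) (R : ℝ → ℝ) (s : ℝ) (W : E) : E :=
  deriv R s • gradient F W

/-- The force `DF(θ)* ∇R(m)` for Hilbert-valued data. -/
def hilbertForce (F : E → H) (R : H → ℝ) (m : H) (θ : E) : E :=
  ContinuousLinearMap.adjoint (fderiv ℝ F θ) (gradient R m)

end Assumptions

/-! In the next two sections `O : E → E` stands for the regularized orthogonalization, `F : E → H`
for the feature map, and `a m θ` for the force at the parameter `θ` when the feature mean is `m`. -/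

section Particles

variable {E : Type v} [NormedAddCommGroup E] [InnerProductSpace ℝ E]
variable {H : Type u} [NormedAddCommGroup H] [InnerProductSpace ℝ H]

/-- The empirical feature mean `(1/N) ∑ⱼ F(θⱼ)`. -/
def empiricalMean {N : ℕ} (F : E → H) (θ : Fin N → E) : H :=
  (N : ℝ)⁻¹ • ∑ j, F (θ j)

/-- The mean-field norm `(N⁻¹ ∑ᵢ ‖Uᵢ‖²)^{1/2}`. -/
def avgNorm {N : ℕ} (U : Fin N → E) : ℝ :=
  √((N : ℝ)⁻¹ * ∑ i, ‖U i‖ ^ 2)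

/-- One step `(θ, P) ↦ (θ⁺, P⁺)` of the regularized Muon scheme with momentum parameter `β` and
step size `η`: `P⁺ᵢ = β Pᵢ + (1 - β) a(m_N(θ), θᵢ)`, `θ⁺ᵢ = θᵢ - η O(P⁺ᵢ)`. -/
def muonStep {N : ℕ} (O : E → E) (F : E → H) (a : H → E → E) (β η : ℝ)
    (x : (Fin N → E) × (Fin N → E)) : (Fin N → E) × (Fin N → E) :=
  (fun i => x.1 i - η • O (β • x.2 i + (1 - β) • a (empiricalMean F x.1) (x.1 i)),
    fun i => β • x.2 i + (1 - β) • a (empiricalMean F x.1) (x.1 i))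

/-- The `k`-th iterate of the scheme started at `x₀`. -/
def muonIterate {N : ℕ} (O : E → E) (F : E → H) (a : H → E → E) (β η : ℝ)
    (x₀ : (Fin N → E) × (Fin N → E)) (k : ℕ) : (Fin N → E) × (Fin N → E) :=
  (muonStep O F a β η)^[k] x₀

/-- For `t ≥ 0`, the continuous piecewise-linear interpolation at time `t` of a sequence whose
`k`-th term is placed at time `k h`. -/
def linearInterpolation {V : Type*} [AddCommGroup V] [Module ℝ V] (x : ℕ → V) (h t : ℝ) : V :=
  x ⌊t / h⌋₊ + (t / h - ⌊t / h⌋₊) • (x (⌊t / h⌋₊ + 1) - x ⌊t / h⌋₊)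

/-- `(θ, P)` solves on the time set `S` the particle system `θᵢ' = -O(Pᵢ)`,
`Pᵢ' = γ (a(m_N(θ), θᵢ) - Pᵢ)` with initial value `x₀` at time `0` (one-sided derivatives at end
points of `S`). -/
structure IsParticleSolution {N : ℕ} (O : E → E) (F : E → H) (a : H → E → E) (γ : ℝ)
    (x₀ : (Fin N → E) × (Fin N → E)) (S : Set ℝ) (θ P : ℝ → Fin N → E) : Prop where
  init_θ : θ 0 = x₀.1
  init_P : P 0 = x₀.2
  deriv_θ : ∀ t ∈ S, ∀ i, HasDerivWithinAt (fun s => θ s i) (-O (P t i)) S t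
  deriv_P : ∀ t ∈ S, ∀ i, HasDerivWithinAt (fun s => P s i)
    (γ • (a (empiricalMean F (θ t)) (θ t i) - P t i)) S t

/-- The finite-particle ODE limit: the particle system has a global solution, which is the unique
solution on every `[0, T]`; and, for the scaling `η = h`, `β = 1 - γ h + r_h` with `r_h = o(h)`, the
interpolated scheme converges to it uniformly on every `[0, T]` as `h ↓ 0`, with error `O(h)` if
`r_h = O(h²)`. -/
def FiniteParticleLimit (O : E → E) (F : E → H) (a : H → E → E) (γ : ℝ) : Prop :=
  ∀ N : ℕ, 0 < N → ∀ x₀ : (Fin N → E) × (Fin N → E),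
    ∃ θ P : ℝ → Fin N → E,
      IsParticleSolution O F a γ x₀ (Ici 0) θ P ∧
      (∀ (T : ℝ) (θ' P' : ℝ → Fin N → E), IsParticleSolution O F a γ x₀ (Icc 0 T) θ' P' →
        ∀ t ∈ Icc 0 T, θ' t = θ t ∧ P' t = P t) ∧
      ∀ r : ℝ → ℝ, Tendsto (fun h => r h / h) (𝓝[>] 0) (𝓝 0) →
        let z : ℝ → ℝ → (Fin N → E) × (Fin N → E) := fun h t =>
          linearInterpolation (muonIterate O F a (1 - γ * h + r h) h x₀) h t
        let err : ℝ → ℝ → ℝ := fun h t => avgNorm ((z h t).1 - θ t) + avgNorm ((z h t).2 - P t)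
        ∀ T : ℝ, 0 < T →
          (∀ δ > 0, ∀ᶠ h in 𝓝[>] (0 : ℝ), ∀ t ∈ Icc 0 T, err h t ≤ δ) ∧
          (r =O[𝓝[>] (0 : ℝ)] (fun h => h ^ 2) →
            ∃ C : ℝ, ∀ᶠ h in 𝓝[>] (0 : ℝ), ∀ t ∈ Icc 0 T, err h t ≤ C * h)

end Particles

section MeanField

variable {E : Type v} [NormedAddCommGroup E] [InnerProductSpace ℝ E] [MeasurableSpace E]
variable {H : Type u} [NormedAddCommGroup H] [InnerProductSpace ℝ H]

/-- The 1-Wasserstein distance: the infimum of the transport cost over all couplings. -/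
def W1 {Z : Type*} [PseudoEMetricSpace Z] [MeasurableSpace Z] (μ ν : Measure Z) : ENNReal :=
  ⨅ (π : Measure (Z × Z)) (_ : π.map Prod.fst = μ ∧ π.map Prod.snd = ν),
    ∫⁻ z, edist z.1 z.2 ∂π

/-- The curve `t ↦ μ t`, `t ∈ S`, is a continuous curve in `𝒫₁` for the 1-Wasserstein distance. -/
structure IsContinuousCurve {Z : Type*} [NormedAddCommGroup Z] [MeasurableSpace Z]
    (S : Set ℝ) (μ : ℝ → Measure Z) : Prop where
  isProbabilityMeasure : ∀ t ∈ S, IsProbabilityMeasure (μ t)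
  finite_moment : ∀ t ∈ S, Integrable (fun z => ‖z‖) (μ t)
  continuous : ∀ t ∈ S, Tendsto (fun s => W1 (μ s) (μ t)) (𝓝[S] t) (𝓝 0)

/-- The drift `b(θ, p) = (-O(p), γ (a(m, θ) - p))` on phase space `E × E`, when the feature mean
is `m`. -/
def drift (O : E → E) (a : H → E → E) (γ : ℝ) (m : H) (z : E × E) : E × E :=
  (-O z.2, γ • (a m z.1 - z.2))

/-- `μ` is a continuous curve in `𝒫₁(E × E)` on the time set `S`, starting at `μ₀`, that solves
`∂ₜμₜ + ∇_θ · (-O(p) μₜ) + ∇_p · (γ (a(mₜ, θ) - p) μₜ) = 0`, with `mₜ = ∫ F(θ) dμₜ(θ, p)`, weakly: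
for every test function `ζ ∈ C_c^∞(E × E)` and every `t ∈ S`, the derivative of `∫ ζ dμₜ` is
`∫ Dζ(θ, p)[-O(p), γ (a(mₜ, θ) - p)] dμₜ(θ, p)`. -/
structure IsWeakSolution (O : E → E) (F : E → H) (a : H → E → E) (γ : ℝ)
    (μ₀ : Measure (E × E)) (S : Set ℝ) (μ : ℝ → Measure (E × E)) : Prop where
  curve : IsContinuousCurve S μ
  init : μ 0 = μ₀
  weak : ∀ ζ : E × E → ℝ, ContDiff ℝ ∞ ζ → HasCompactSupport ζ → ∀ t ∈ S,
    HasDerivWithinAt (fun s => ∫ z, ζ z ∂(μ s))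
      (∫ z, fderiv ℝ ζ z (drift O a γ (∫ y, F y.1 ∂(μ t)) z) ∂(μ t)) S t

/-- The process `Y = (Θ, P)` solves on the time set `S` the nonlinear characteristic system
`Θ' = -O(P)`, `P' = γ (a(𝔼 F(Θₜ), Θ) - P)` with initial value `Y₀`. -/
structure IsCharacteristic (O : E → E) (F : E → H) (a : H → E → E) (γ : ℝ)
    {Ω : Type w} [MeasurableSpace Ω] (Pr : Measure Ω) (Y₀ : Ω → E × E) (S : Set ℝ)
    (Y : ℝ → Ω → E × E) : Prop where
  aemeasurable : ∀ t ∈ S, AEMeasurable (Y t) Pr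
  init : ∀ᵐ x ∂Pr, Y 0 x = Y₀ x
  deriv : ∀ᵐ x ∂Pr, ∀ t ∈ S, HasDerivWithinAt (fun s => Y s x)
    (drift O a γ (∫ y, F (Y t y).1 ∂Pr) (Y t x)) S t

/-- `μ` is, on the time set `S`, the law of the nonlinear characteristics: whenever `Y₀` is a random
variable with law `μ₀`, on any probability space, the characteristic system started at `Y₀` has an
almost surely unique solution `Y`, and `μ t` is the law of `Y t`. -/
def IsLawOfCharacteristics (O : E → E) (F : E → H) (a : H → E → E) (γ : ℝ)
    (μ₀ : Measure (E × E)) (S : Set ℝ) (μ : ℝ → Measure (E × E)) : Prop :=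
  ∀ (Ω : Type w) [MeasurableSpace Ω] (Pr : Measure Ω) [IsProbabilityMeasure Pr]
    (Y₀ : Ω → E × E), Measurable Y₀ → Pr.map Y₀ = μ₀ →
    ∃ Y : ℝ → Ω → E × E, IsCharacteristic O F a γ Pr Y₀ S Y ∧
      (∀ Y' : ℝ → Ω → E × E, IsCharacteristic O F a γ Pr Y₀ S Y' →
        ∀ᵐ x ∂Pr, ∀ t ∈ S, Y' t x = Y t x) ∧
      ∀ t ∈ S, Pr.map (Y t) = μ t

/-- Well-posedness of the mean-field equation: for every `μ₀ ∈ 𝒫₁` there is a weak solution in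
`C([0, ∞); 𝒫₁)`, it is the only weak solution in `C([0, T]; 𝒫₁)` for every `T`, and it is the law of
the nonlinear characteristics. -/
def MeanFieldWellPosed (O : E → E) (F : E → H) (a : H → E → E) (γ : ℝ) : Prop :=
  ∀ μ₀ : Measure (E × E), IsProbabilityMeasure μ₀ → Integrable (fun z => ‖z‖) μ₀ →
    ∃ μ : ℝ → Measure (E × E),
      IsWeakSolution O F a γ μ₀ (Ici 0) μ ∧
      (∀ (T : ℝ) (ν : ℝ → Measure (E × E)), IsWeakSolution O F a γ μ₀ (Icc 0 T) ν →
        ∀ t ∈ Icc 0 T, ν t = μ t) ∧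
      IsLawOfCharacteristics.{u, v, w} O F a γ μ₀ (Ici 0) μ

/-- The curve stays on the time set `S` in one bounded region of phase space. -/
def StaysBounded {Z : Type*} [Norm Z] [MeasurableSpace Z] (S : Set ℝ) (μ : ℝ → Measure Z) : Prop :=
  ∃ r : ℝ, ∀ t ∈ S, ∀ᵐ z ∂(μ t), ‖z‖ ≤ r

/-- Localized well-posedness of the mean-field equation: for every compactly supported `μ₀` and
every `T` there is a weak solution in `C([0, T]; 𝒫₁)` that stays in a bounded region, it is the only
weak solution in `C([0, T]; 𝒫₁)` that stays in a bounded region, and it is the law of the nonlinear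
characteristics. -/
def MeanFieldLocallyWellPosed (O : E → E) (F : E → H) (a : H → E → E) (γ : ℝ) : Prop :=
  ∀ μ₀ : Measure (E × E), IsProbabilityMeasure μ₀ → (∃ r : ℝ, ∀ᵐ z ∂μ₀, ‖z‖ ≤ r) →
    ∀ T : ℝ, 0 < T → ∃ μ : ℝ → Measure (E × E),
      IsWeakSolution O F a γ μ₀ (Icc 0 T) μ ∧ StaysBounded (Icc 0 T) μ ∧
      (∀ ν : ℝ → Measure (E × E), IsWeakSolution O F a γ μ₀ (Icc 0 T) ν →
        StaysBounded (Icc 0 T) ν → ∀ t ∈ Icc 0 T, ν t = μ t) ∧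
      IsLawOfCharacteristics.{u, v, w} O F a γ μ₀ (Icc 0 T) μ

end MeanField

end

end Muon

/-!
The proof has three independent ingredients, and a reduction to them.

*The map `Orth_ε` is bounded and Lipschitz.* The eigenvalues of the symmetric dilation `[[0, P],
[Pᵀ, 0]]` are the numbers `±σᵢ(P)` and zeros, and `Orth_ε P` is the upper right block of `x ↦ x /
√(x² + ε²)` applied to it. A scalar Lipschitz function of symmetric matrices is Lipschitz in the
Frobenius norm: in the eigenbases of two matrices, the entries of the difference are `(g (lᵢ) - g
(l'ⱼ)) Wᵢⱼ` (`frobeniusSq_sub_le_of_spectral`, `frobeniusSq_orthMatrix`).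

*The mean-field flow.* If `O`, `F` and the force are globally Lipschitz, the characteristics of all
initial points `z` are found at once. A flow map is written as `z + (1 + ‖z‖) u(z)` with `u`
bounded and continuous, and the self-consistent system becomes an autonomous equation with
Lipschitz right-hand side in the Banach space of the functions `u` (`lipschitzWith_meanField`,
`exists_forall_hasDerivAt_of_lipschitzWith`). The image of `μ₀` under this flow is the weak
solution, and the flow itself provides the nonlinear characteristics. For uniqueness, the feature
mean of a given weak solution is frozen. The solution then solves a linear continuity equation, and
so does the image of `μ₀` under the corresponding linear flow. Linear uniqueness
(`IsLinearSolution.eq`) identifies them, so that the linear flow is self-consistent, and it is the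
mean-field flow (`IsWeakSolution.eq_map_displace`); the argument for characteristics is the same.
The velocity in the linear equation is only Lipschitz, so that test functions cannot be transported
along its flow without loss of smoothness; they are transported by Euler steps of mollified
velocities instead.

*The scheme.* A step of the regularized Muon scheme is an Euler step of the particle system up to
`O(h (h + |r_h| / h))`, so that the scheme converges as a one-step method
(`exists_forall_norm_linearInterpolation_sub_le`, `LipschitzData.norm_muonStep_sub_le`).

*Localization.* Since `O` is bounded, parameters move with bounded speed, in the scheme as well as
in the limit equations. Up to a given time they remain in a ball, and there the data may be
replaced by their precompositions with radial retractions, which are globally Lipschitz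
(`LocalLipschitzData.exists_truncation`). The momenta need no such bound, because the drift is
affine in them up to the globally Lipschitz map `O`. Competing weak solutions are bounded by
hypothesis, and a truncation at a larger radius covers them.

The scalar single-matrix case is the Hilbert-valued case with values in `ℝ`
(`scalarForce_eq_hilbertForce`, `BasicSmoothness.globalSmoothness`).
-/

namespace Muon

/-! ### Globally Lipschitz differential equations -/

section ODE
open scoped NNReal BoundedContinuousFunction

theorem abs_integral_exp_mul_abs_le {l : ℝ} (hl : 0 < l) (t : ℝ) :
    |∫ s in (0 : ℝ)..t, Real.exp (l * |s|)| ≤ Real.exp (l * |t|) / l := by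
  have key : ∀ t : ℝ, 0 ≤ t →
      |∫ s in (0 : ℝ)..t, Real.exp (l * |s|)| ≤ Real.exp (l * |t|) / l := by
    intro t ht
    have h1 : ∫ s in (0 : ℝ)..t, Real.exp (l * |s|) = ∫ s in (0 : ℝ)..t, Real.exp (l * s) := by
      refine intervalIntegral.integral_congr fun s hs => ?_
      rw [uIcc_of_le ht] at hs
      simp only [abs_of_nonneg hs.1]
    have h2 : ∫ s in (0 : ℝ)..t, Real.exp (l * s) = (Real.exp (l * t) - 1) / l := by
      rw [intervalIntegral.integral_comp_mul_left (fun s => Real.exp s) hl.ne', integral_exp]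
      simp only [mul_zero, Real.exp_zero, smul_eq_mul]
      ring
    have h3 : 1 ≤ Real.exp (l * t) := Real.one_le_exp (by positivity)
    rw [h1, h2, abs_of_nonneg ht, abs_of_nonneg (div_nonneg (by linarith) hl.le)]
    gcongr
    linarith
  rcases le_total 0 t with ht | ht
  · exact key t ht
  · have h := key (-t) (by linarith)
    have h1 : ∫ s in (0 : ℝ)..(-t), Real.exp (l * |s|)
        = -∫ s in (0 : ℝ)..t, Real.exp (l * |s|) := by
      have := intervalIntegral.integral_comp_neg (a := 0) (b := t)
        (fun s => Real.exp (l * |s|))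
      simp only [abs_neg, neg_zero] at this
      rw [this, ← intervalIntegral.integral_symm]
    rwa [h1, abs_neg, abs_neg] at h

/-- **Global Cauchy–Lipschitz theorem.** A vector field that is Lipschitz in space, uniformly in
time, and bounded along the origin has a solution on the whole real line. The Picard map is a
contraction of the curves `t ↦ exp (l |t|) • y t` with `y` bounded, once `l` is large enough. -/
theorem exists_forall_hasDerivAt_of_lipschitzWith {X : Type*} [NormedAddCommGroup X]
    [NormedSpace ℝ X] [CompleteSpace X] {v : ℝ → X → X} {K : ℝ≥0} (hK : ∀ t, LipschitzWith K (v t))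
    (hc : ∀ x, Continuous fun t => v t x) {C : ℝ} (hC : ∀ t, ‖v t 0‖ ≤ C) (x₀ : X) :
    ∃ x : ℝ → X, x 0 = x₀ ∧ ∀ t, HasDerivAt x (v t (x t)) t := by
  have hC0 : 0 ≤ C := (norm_nonneg _).trans (hC 0)
  have hv : Continuous fun p : ℝ × X => v p.1 p.2 :=
    continuous_prod_of_continuous_lipschitzWith' _ K hK hc
  -- the Picard map will contract by `K / l ≤ 1 / 2`
  set l : ℝ := 2 * K + 1 with hl
  have hl0 : 0 < l := by positivity
  have hl1 : 1 ≤ l := by rw [hl]; linarith [K.2]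
  have hlip : ∀ t x y, ‖v t x - v t y‖ ≤ K * ‖x - y‖ := fun t x y => by
    simpa [dist_eq_norm] using (hK t).dist_le_mul x y
  let e : ℝ → ℝ := fun t => Real.exp (l * |t|)
  have he : Continuous e := by fun_prop
  have he0 : ∀ t, 0 < e t := fun t => Real.exp_pos _
  have he1 : ∀ t, 1 ≤ e t := fun t => Real.one_le_exp (by positivity)
  have hint : ∀ (y : ℝ →ᵇ X), Continuous fun s => v s (e s • y s) := fun y =>
    hv.comp (continuous_id.prodMk (he.smul y.continuous))
  -- integration gains a factor `1 / l` in the weighted norm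
  have bound : ∀ (g : ℝ → X) (M : ℝ), Continuous g → 0 ≤ M → (∀ s, ‖g s‖ ≤ M * e s) → ∀ t,
      ‖(e t)⁻¹ • ∫ s in (0 : ℝ)..t, g s‖ ≤ M / l := by
    intro g M hg hM hgM t
    have h1 : ‖∫ s in (0 : ℝ)..t, g s‖ ≤ |∫ s in (0 : ℝ)..t, M * e s| :=
      intervalIntegral.norm_integral_le_abs_of_norm_le (Eventually.of_forall fun s => hgM s)
        ((continuous_const.mul he).intervalIntegrable _ _)
    rw [intervalIntegral.integral_const_mul, abs_mul, abs_of_nonneg hM] at h1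
    have h2 := abs_integral_exp_mul_abs_le hl0 t
    rw [norm_smul, norm_inv, Real.norm_of_nonneg (he0 t).le, inv_mul_le_iff₀ (he0 t)]
    calc _ ≤ M * (e t / l) := h1.trans (by gcongr)
      _ = _ := by ring
  have hcont : ∀ y : ℝ →ᵇ X, Continuous fun t =>
      (e t)⁻¹ • (x₀ + ∫ s in (0 : ℝ)..t, v s (e s • y s)) := fun y =>
    (he.inv₀ fun t => (he0 t).ne').smul (continuous_const.add
      (intervalIntegral.continuous_primitive (fun a b => (hint y).intervalIntegrable a b) 0))
  -- the Picard map in terms of `y = e⁻¹ x`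
  let G : (ℝ →ᵇ X) → (ℝ →ᵇ X) := fun y => BoundedContinuousFunction.ofNormedAddCommGroup
    (fun t => (e t)⁻¹ • (x₀ + ∫ s in (0 : ℝ)..t, v s (e s • y s))) (hcont y)
    (‖x₀‖ + (C + K * ‖y‖) / l) (by
      intro t
      rw [smul_add]
      refine (norm_add_le _ _).trans (add_le_add ?_ (bound _ _ (hint y) (by positivity) ?_ t))
      · rw [norm_smul, norm_inv, Real.norm_of_nonneg (he0 t).le]
        exact mul_le_of_le_one_left (norm_nonneg _) (inv_le_one_of_one_le₀ (he1 t))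
      · intro s
        have h1 := hlip s (e s • y s) 0
        have h2 : ‖v s (e s • y s)‖ ≤ ‖v s (e s • y s) - v s 0‖ + ‖v s 0‖ := by
          simpa using norm_add_le (v s (e s • y s) - v s 0) (v s 0)
        rw [sub_zero, norm_smul, Real.norm_of_nonneg (he0 s).le] at h1
        have h3 := y.norm_coe_le_norm s
        have h4 := hC s
        have h5 : C ≤ C * e s := le_mul_of_one_le_right hC0 (he1 s)
        have h6 : K * (e s * ‖y s‖) ≤ K * (e s * ‖y‖) :=
          mul_le_mul_of_nonneg_left (mul_le_mul_of_nonneg_left h3 (he0 s).le) K.2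
        linarith)
  have hG : ContractingWith (1 / 2) G := by
    refine ⟨by norm_num, LipschitzWith.of_dist_le_mul fun y z => ?_⟩
    refine (BoundedContinuousFunction.dist_le (by positivity)).2 fun t => ?_
    have h1 : G y t - G z t
        = (e t)⁻¹ • ∫ s in (0 : ℝ)..t, (v s (e s • y s) - v s (e s • z s)) := by
      rw [intervalIntegral.integral_sub ((hint y).intervalIntegrable _ _)
        ((hint z).intervalIntegrable _ _)]
      simp only [G, BoundedContinuousFunction.coe_ofNormedAddCommGroup]
      rw [← smul_sub, add_sub_add_left_eq_sub]
    rw [dist_eq_norm, h1]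
    refine (bound _ (K * dist y z) ((hint y).sub (hint z)) (by positivity) (fun s => ?_) t).trans ?_
    · refine (hlip s _ _).trans ?_
      rw [← smul_sub, norm_smul, Real.norm_of_nonneg (he0 s).le, ← dist_eq_norm]
      have h3 := BoundedContinuousFunction.dist_coe_le_dist (f := y) (g := z) s
      have := mul_le_mul_of_nonneg_left (mul_le_mul_of_nonneg_left h3 (he0 s).le) K.2
      calc _ ≤ K * (e s * dist y z) := this
        _ = _ := by ring
    · rw [div_le_iff₀ hl0]
      have : 0 ≤ dist y z := dist_nonneg
      push_cast
      rw [hl]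
      nlinarith
  have hfix : G (ContractingWith.fixedPoint G hG) = ContractingWith.fixedPoint G hG :=
    ContractingWith.fixedPoint_isFixedPt hG
  set y := ContractingWith.fixedPoint G hG with hy
  have hx : ∀ t, e t • y t = x₀ + ∫ s in (0 : ℝ)..t, v s (e s • y s) := by
    intro t
    conv_lhs => rw [← hfix]
    exact smul_inv_smul₀ (he0 t).ne' _
  refine ⟨fun t => e t • y t, by simp [hx 0], fun t => ?_⟩
  have hd := ((hint y).integral_hasStrictDerivAt 0 t).hasDerivAt.const_add x₀
  exact hd.congr_of_eventuallyEq (Eventually.of_forall hx)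

end ODE

/-! ### The regularized orthogonalization is bounded and Lipschitz -/

section Orth
variable {ι κ : Type*} [Fintype ι] [Fintype κ]

/-- The square of the Frobenius norm of a real matrix. -/
noncomputable def frobeniusSq (M : Matrix ι κ ℝ) : ℝ := (Mᵀ * M).trace

theorem frobeniusSq_eq_sum (M : Matrix ι κ ℝ) : frobeniusSq M = ∑ i, ∑ j, M i j ^ 2 := by
  rw [frobeniusSq, Matrix.trace, Finset.sum_comm]
  refine Finset.sum_congr rfl fun j _ => ?_
  simp [Matrix.mul_apply, pow_two]

variable [DecidableEq ι] [DecidableEq κ]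

theorem frobeniusSq_orthogonal_conj {U : Matrix ι ι ℝ} {V : Matrix κ κ ℝ} (hU : U * Uᵀ = 1)
    (hV : V * Vᵀ = 1) (M : Matrix ι κ ℝ) : frobeniusSq (Uᵀ * M * V) = frobeniusSq M := by
  have h : (Uᵀ * M * V)ᵀ * (Uᵀ * M * V) = Vᵀ * (Mᵀ * (U * Uᵀ) * M) * V := by
    simp only [Matrix.transpose_mul, Matrix.transpose_transpose, Matrix.mul_assoc]
  rw [frobeniusSq, h, hU, Matrix.mul_one, Matrix.trace_mul_comm, ← Matrix.mul_assoc, hV,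
    Matrix.one_mul, frobeniusSq]

/-- Functions of symmetric matrices inherit, in the Frobenius norm, the Lipschitz constant which the
function has between the two spectra: in the eigenbases of the two matrices, the entries of the
difference are `(g (lᵢ) - g' (l'ⱼ)) Wᵢⱼ` with the same matrix `W`. -/
theorem frobeniusSq_sub_le_of_spectral {U V : Matrix ι ι ℝ} {l l' g g' : ι → ℝ} {K : ℝ}
    (hU : Uᵀ * U = 1) (hV : Vᵀ * V = 1) (h : ∀ i j, |g i - g' j| ≤ K * |l i - l' j|) :
    frobeniusSq (U * Matrix.diagonal g * Uᵀ - V * Matrix.diagonal g' * Vᵀ)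
      ≤ K ^ 2 * frobeniusSq (U * Matrix.diagonal l * Uᵀ - V * Matrix.diagonal l' * Vᵀ) := by
  have hU' : U * Uᵀ = 1 := mul_eq_one_comm.mp hU
  have hV' : V * Vᵀ = 1 := mul_eq_one_comm.mp hV
  have key : ∀ a b : ι → ℝ, Uᵀ * (U * Matrix.diagonal a * Uᵀ - V * Matrix.diagonal b * Vᵀ) * V
      = Matrix.diagonal a * (Uᵀ * V) - Uᵀ * V * Matrix.diagonal b := by
    intro a b
    rw [Matrix.mul_sub, Matrix.sub_mul]
    congr 1
    · rw [← Matrix.mul_assoc, ← Matrix.mul_assoc, hU, Matrix.one_mul, Matrix.mul_assoc]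
    · simp only [Matrix.mul_assoc, hV, Matrix.mul_one]
  rw [← frobeniusSq_orthogonal_conj hU' hV' (U * Matrix.diagonal g * Uᵀ - _), key,
    ← frobeniusSq_orthogonal_conj hU' hV' (U * Matrix.diagonal l * Uᵀ - _), key,
    frobeniusSq_eq_sum, frobeniusSq_eq_sum, Finset.mul_sum]
  refine Finset.sum_le_sum fun i _ => ?_
  rw [Finset.mul_sum]
  refine Finset.sum_le_sum fun j _ => ?_
  simp only [Matrix.sub_apply, Matrix.diagonal_mul, Matrix.mul_diagonal]
  have h1 : (g i - g' j) ^ 2 ≤ K ^ 2 * (l i - l' j) ^ 2 := by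
    rw [← sq_abs (g i - g' j), ← sq_abs (l i - l' j), ← mul_pow]
    exact pow_le_pow_left₀ (abs_nonneg _) (h i j) 2
  have h2 := mul_le_mul_of_nonneg_right h1 (sq_nonneg ((Uᵀ * V) i j))
  calc _ = (g i - g' j) ^ 2 * (Uᵀ * V) i j ^ 2 := by ring
    _ ≤ _ := h2
    _ = _ := by ring

theorem exists_orthogonal_diagonalization {A : Matrix ι ι ℝ} (hA : Aᵀ = A) :
    ∃ (Q : Matrix ι ι ℝ) (l : ι → ℝ), Qᵀ * Q = 1 ∧ A = Q * Matrix.diagonal l * Qᵀ := by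
  have hA' : A.IsHermitian := by
    rw [Matrix.IsHermitian, Matrix.conjTranspose_eq_transpose_of_trivial, hA]
  let Q : Matrix ι ι ℝ := Matrix.of fun i j => hA'.eigenvectorBasis j i
  have hQQ : Qᵀ * Q = 1 := by
    ext i j
    have h := orthonormal_iff_ite.1 hA'.eigenvectorBasis.orthonormal i j
    simp only [PiLp.inner_apply, RCLike.inner_apply, conj_trivial] at h
    rw [Matrix.mul_apply, Matrix.one_apply, ← h]
    simp [Q, mul_comm]
  have hAQ : A * Q = Q * Matrix.diagonal hA'.eigenvalues := by
    ext i j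
    have h := congrFun (hA'.mulVec_eigenvectorBasis j) i
    simp only [Matrix.mulVec, dotProduct, Pi.smul_apply, smul_eq_mul] at h
    rw [Matrix.mul_apply, Matrix.mul_diagonal]
    simpa [Q, mul_comm] using h
  refine ⟨Q, hA'.eigenvalues, hQQ, ?_⟩
  rw [← hAQ, Matrix.mul_assoc, mul_eq_one_comm.mp hQQ, Matrix.mul_one]

theorem aeval_orthogonal_diagonalization {Q : Matrix ι ι ℝ} {l : ι → ℝ} (hQ : Qᵀ * Q = 1)
    (r : Polynomial ℝ) : Polynomial.aeval (Q * Matrix.diagonal l * Qᵀ) r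
      = Q * Matrix.diagonal (fun i => r.eval (l i)) * Qᵀ := by
  have hQ' : Q * Qᵀ = 1 := mul_eq_one_comm.mp hQ
  induction r using Polynomial.induction_on' with
  | add a b ha hb =>
    simp only [map_add, ha, hb, Polynomial.eval_add, ← Matrix.add_mul, ← Matrix.mul_add,
      Matrix.diagonal_add]
  | monomial k c =>
    induction k with
    | zero =>
      have h : Matrix.diagonal (fun _ : ι => c) = c • (1 : Matrix ι ι ℝ) := by
        rw [← Matrix.diagonal_one, ← Matrix.diagonal_smul]
        congr 1
        funext i
        simp
      simp [Algebra.algebraMap_eq_smul_one, h, hQ']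
    | succ k ih =>
      rw [← Polynomial.monomial_mul_X, map_mul, Polynomial.aeval_X, ih]
      have h : ∀ D D' : Matrix ι ι ℝ, Q * D * Qᵀ * (Q * D' * Qᵀ) = Q * (D * D') * Qᵀ := by
        intro D D'
        rw [Matrix.mul_assoc (Q * D), ← Matrix.mul_assoc Qᵀ, ← Matrix.mul_assoc Qᵀ, hQ,
          Matrix.one_mul]
        simp only [Matrix.mul_assoc]
      rw [h, Matrix.diagonal_mul_diagonal]
      simp only [Polynomial.eval_mul, Polynomial.eval_X]

variable {m n : ℕ}

/-- The symmetric dilation `[[0, P], [Pᵀ, 0]]`, whose eigenvalues are `±σᵢ(P)` and zeros. -/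
def dilation (P : Matrix (Fin m) (Fin n) ℝ) : Matrix (Fin m ⊕ Fin n) (Fin m ⊕ Fin n) ℝ :=
  Matrix.fromBlocks 0 P Pᵀ 0

theorem dilation_transpose (P : Matrix (Fin m) (Fin n) ℝ) : (dilation P)ᵀ = dilation P := by
  simp [dilation, Matrix.fromBlocks_transpose]

theorem frobeniusSq_dilation_sub (P Q : Matrix (Fin m) (Fin n) ℝ) :
    frobeniusSq (dilation P - dilation Q) = 2 * frobeniusSq (P - Q) := by
  simp only [frobeniusSq_eq_sum, Fintype.sum_sum_type, Matrix.sub_apply, dilation,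
    Matrix.fromBlocks_apply₁₁, Matrix.fromBlocks_apply₁₂, Matrix.fromBlocks_apply₂₁,
    Matrix.fromBlocks_apply₂₂, Matrix.zero_apply, Matrix.transpose_apply]
  have h : ∑ j : Fin n, ∑ i : Fin m, (P i j - Q i j) ^ 2 = ∑ i, ∑ j, (P i j - Q i j) ^ 2 :=
    Finset.sum_comm
  simp [h]
  ring

theorem aeval_fromBlocks_diagonal (A : Matrix (Fin m) (Fin m) ℝ) (B : Matrix (Fin n) (Fin n) ℝ)
    (r : Polynomial ℝ) : Polynomial.aeval (Matrix.fromBlocks A 0 0 B) r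
      = Matrix.fromBlocks (Polynomial.aeval A r) 0 0 (Polynomial.aeval B r) := by
  induction r using Polynomial.induction_on' with
  | add a b ha hb => simp [ha, hb, Matrix.fromBlocks_add]
  | monomial k c =>
    induction k with
    | zero =>
      simp only [Polynomial.monomial_zero_left, Polynomial.aeval_C,
        Algebra.algebraMap_eq_smul_one]
      rw [← Matrix.fromBlocks_one, Matrix.fromBlocks_smul, smul_zero, smul_zero]
    | succ k ih =>
      rw [← Polynomial.monomial_mul_X]
      simp only [map_mul, Polynomial.aeval_X, ih, Matrix.fromBlocks_multiply]
      simp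

theorem aeval_dilation (P : Matrix (Fin m) (Fin n) ℝ) (p : Polynomial ℝ) :
    (Polynomial.aeval (dilation P) (Polynomial.X * p.comp (Polynomial.X ^ 2))).toBlocks₁₂
      = P * Polynomial.aeval (Pᵀ * P) p := by
  have h : dilation P ^ 2 = Matrix.fromBlocks (P * Pᵀ) 0 0 (Pᵀ * P) := by
    rw [pow_two, dilation, Matrix.fromBlocks_multiply]
    simp
  rw [map_mul, Polynomial.aeval_X, Polynomial.aeval_comp, map_pow, Polynomial.aeval_X, h,
    aeval_fromBlocks_diagonal, dilation, Matrix.fromBlocks_multiply, Matrix.toBlocks_fromBlocks₁₂]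
  simp

/-- `Orth_ε(P) = P p(Pᵀ P)` for every polynomial `p` that agrees with `x ↦ 1 / √(x + ε²)` at the
squares of the singular values. -/
theorem orthMatrix_eq_mul_aeval (ε : ℝ) {P : Matrix (Fin m) (Fin n) ℝ} (E : ReducedSVD P)
    {p : Polynomial ℝ} (hp : ∀ i, p.eval (E.σ i ^ 2) = 1 / √(E.σ i ^ 2 + ε ^ 2)) :
    orthMatrix ε P = P * Polynomial.aeval (Pᵀ * P) p := by
  have hA : Pᵀ * P = E.V * Matrix.diagonal (fun i => E.σ i ^ 2) * E.Vᵀ := by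
    conv_lhs => rw [E.eq]
    simp only [Matrix.transpose_mul, Matrix.transpose_transpose, Matrix.diagonal_transpose,
      Matrix.mul_assoc]
    rw [← Matrix.mul_assoc E.Uᵀ, E.orthoU, Matrix.one_mul,
      ← Matrix.mul_assoc (Matrix.diagonal E.σ), Matrix.diagonal_mul_diagonal]
    simp only [pow_two]
  have hVA : E.Vᵀ * (Pᵀ * P) = Matrix.diagonal (fun i => E.σ i ^ 2) * E.Vᵀ := by
    rw [hA, ← Matrix.mul_assoc, ← Matrix.mul_assoc, E.orthoV, Matrix.one_mul]
  have hpoly : ∀ r : Polynomial ℝ, E.Vᵀ * Polynomial.aeval (Pᵀ * P) r =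
      Matrix.diagonal (fun i => r.eval (E.σ i ^ 2)) * E.Vᵀ := by
    intro r
    induction r using Polynomial.induction_on' with
    | add a b ha hb =>
      simp only [map_add, Matrix.mul_add, ha, hb, Polynomial.eval_add, ← Matrix.add_mul,
        Matrix.diagonal_add]
    | monomial k c =>
      induction k with
      | zero =>
        ext i j
        simp [Matrix.diagonal_mul, Algebra.algebraMap_eq_smul_one]
      | succ k ih =>
        rw [← Polynomial.monomial_mul_X, map_mul, Polynomial.aeval_X, ← Matrix.mul_assoc, ih,
          Matrix.mul_assoc, hVA, ← Matrix.mul_assoc, Matrix.diagonal_mul_diagonal]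
        simp only [Polynomial.eval_mul, Polynomial.eval_X]
  have hPE : P * Polynomial.aeval (Pᵀ * P) p
      = E.U * Matrix.diagonal E.σ * (E.Vᵀ * Polynomial.aeval (Pᵀ * P) p) := by
    rw [← Matrix.mul_assoc, ← E.eq]
  rw [hPE, hpoly, orthMatrix_eq ε E, ← Matrix.mul_assoc (E.U * Matrix.diagonal E.σ),
    Matrix.mul_assoc E.U (Matrix.diagonal E.σ), Matrix.diagonal_mul_diagonal]
  congr 3
  funext i
  rw [hp i]
  ring

theorem abs_div_sqrt_sub_le {ε : ℝ} (hε : 0 < ε) (x y : ℝ) :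
    |x / √(x ^ 2 + ε ^ 2) - y / √(y ^ 2 + ε ^ 2)| ≤ 2 / ε * |x - y| := by
  set a := √(x ^ 2 + ε ^ 2) with ha
  set b := √(y ^ 2 + ε ^ 2) with hb
  have haε : ε ≤ a := Real.le_sqrt_of_sq_le (by nlinarith [sq_nonneg x])
  have hxa : |x| ≤ a := Real.abs_le_sqrt (by nlinarith [sq_nonneg ε])
  have hyb : |y| ≤ b := Real.abs_le_sqrt (by nlinarith [sq_nonneg ε])
  have ha0 : 0 < a := hε.trans_le haε
  have hb0 : 0 < b := Real.sqrt_pos.2 (by positivity)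
  have ha2 : a ^ 2 = x ^ 2 + ε ^ 2 := Real.sq_sqrt (by positivity)
  have hb2 : b ^ 2 = y ^ 2 + ε ^ 2 := Real.sq_sqrt (by positivity)
  have hab : |b - a| ≤ |x - y| := by
    have h1 : |b - a| * (a + b) = |x - y| * |x + y| := by
      have h0 : (b - a) * (a + b) = (y - x) * (x + y) := by nlinarith
      rw [← abs_of_pos (add_pos ha0 hb0), ← abs_mul, h0, abs_mul, abs_sub_comm]
    have h2 : |x + y| ≤ a + b := (abs_add_le x y).trans (add_le_add hxa hyb)
    by_contra! hlt
    nlinarith [abs_nonneg (x - y)]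
  have h1 : x / a - y / b = (x - y) / a + y / b * ((b - a) / a) := by
    field_simp
    ring
  have h2 : |y / b| ≤ 1 := by
    rw [abs_div, abs_of_pos hb0]
    exact (div_le_one hb0).2 hyb
  calc |x / a - y / b| ≤ |x - y| / a + |y / b| * (|b - a| / a) := by
        rw [h1]
        refine (abs_add_le _ _).trans ?_
        rw [abs_mul, abs_div, abs_div (b - a), abs_of_pos ha0]
    _ ≤ |x - y| / a + 1 * (|x - y| / a) := by gcongr
    _ = 2 * |x - y| / a := by ring
    _ ≤ 2 * |x - y| / ε := by gcongr
    _ = _ := by ring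

/-- Two matrices are treated by one polynomial: `Orth_ε` of either is the upper right block of `q`
applied to its dilation, where `q (x) = x / √(x² + ε²)` at all eigenvalues that occur. -/
theorem frobeniusSq_orthMatrix (ε : ℝ) (hε : 0 < ε) (P Q : Matrix (Fin m) (Fin n) ℝ) :
    frobeniusSq (orthMatrix ε P - orthMatrix ε Q) ≤ (2 / ε) ^ 2 * (2 * frobeniusSq (P - Q)) ∧
      frobeniusSq (orthMatrix ε P) ≤ m + n := by
  obtain ⟨D⟩ := ReducedSVD.nonempty P
  obtain ⟨D'⟩ := ReducedSVD.nonempty Q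
  obtain ⟨U, l, hU, hl⟩ := exists_orthogonal_diagonalization (dilation_transpose P)
  obtain ⟨V, l', hV, hl'⟩ := exists_orthogonal_diagonalization (dilation_transpose Q)
  -- the singular values are needed for `Orth_ε` itself, the eigenvalues of the dilations for `q`
  let s : Finset ℝ := (Finset.univ.image (fun i => D.σ i ^ 2) ∪
    Finset.univ.image (fun i => D'.σ i ^ 2)) ∪ (Finset.univ.image (fun i => l i ^ 2) ∪
    Finset.univ.image (fun i => l' i ^ 2))
  let p : Polynomial ℝ := Lagrange.interpolate s id (fun x => 1 / √(x + ε ^ 2))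
  have hp : ∀ x ∈ s, p.eval x = 1 / √(x + ε ^ 2) := fun x hx =>
    Lagrange.eval_interpolate_at_node (v := id) _ Function.injective_id.injOn hx
  set q : Polynomial ℝ := Polynomial.X * p.comp (Polynomial.X ^ 2) with hq
  have hqe : ∀ x, x ^ 2 ∈ s → q.eval x = x / √(x ^ 2 + ε ^ 2) := fun x hx => by
    simp only [hq, Polynomial.eval_mul, Polynomial.eval_X, Polynomial.eval_comp,
      Polynomial.eval_pow, hp _ hx]
    ring
  have hP : orthMatrix ε P = (Polynomial.aeval (dilation P) q).toBlocks₁₂ := by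
    rw [aeval_dilation, orthMatrix_eq_mul_aeval ε D fun i => hp _ (by simp [s])]
  have hQ : orthMatrix ε Q = (Polynomial.aeval (dilation Q) q).toBlocks₁₂ := by
    rw [aeval_dilation, orthMatrix_eq_mul_aeval ε D' fun i => hp _ (by simp [s])]
  have hblock : ∀ M : Matrix (Fin m ⊕ Fin n) (Fin m ⊕ Fin n) ℝ,
      frobeniusSq M.toBlocks₁₂ ≤ frobeniusSq M := by
    intro M
    simp only [frobeniusSq_eq_sum, Fintype.sum_sum_type, Matrix.toBlocks₁₂, Matrix.of_apply,
      Finset.sum_add_distrib]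
    have h1 : 0 ≤ ∑ x, ∑ y, M (Sum.inl x) (Sum.inl y) ^ 2 := by positivity
    have h2 : 0 ≤ ∑ x, ∑ y, M (Sum.inr x) (Sum.inl y) ^ 2 := by positivity
    have h3 : 0 ≤ ∑ x, ∑ y, M (Sum.inr x) (Sum.inr y) ^ 2 := by positivity
    linarith
  have hsl : ∀ i, l i ^ 2 ∈ s := fun i => by simp [s]
  have hsl' : ∀ i, l' i ^ 2 ∈ s := fun i => by simp [s]
  constructor
  · have h1 : orthMatrix ε P - orthMatrix ε Q
        = (Polynomial.aeval (dilation P) q - Polynomial.aeval (dilation Q) q).toBlocks₁₂ := by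
      rw [hP, hQ]; rfl
    rw [h1, ← frobeniusSq_dilation_sub]
    refine (hblock _).trans ?_
    rw [hl, hl', aeval_orthogonal_diagonalization hU, aeval_orthogonal_diagonalization hV]
    refine frobeniusSq_sub_le_of_spectral hU hV fun i j => ?_
    rw [hqe _ (hsl i), hqe _ (hsl' j)]
    exact abs_div_sqrt_sub_le hε _ _
  · rw [hP]
    refine (hblock _).trans ?_
    rw [hl, aeval_orthogonal_diagonalization hU]
    have h1 := frobeniusSq_orthogonal_conj (U := Uᵀ) (V := Uᵀ) (by simpa using hU)
      (by simpa using hU) (Matrix.diagonal fun i => q.eval (l i))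
    rw [Matrix.transpose_transpose] at h1
    rw [h1, frobeniusSq, Matrix.diagonal_transpose, Matrix.diagonal_mul_diagonal,
      Matrix.trace_diagonal]
    have h2 : ∀ i, q.eval (l i) * q.eval (l i) ≤ 1 := fun i => by
      rw [hqe _ (hsl i), ← pow_two, div_pow, Real.sq_sqrt (by positivity)]
      exact (div_le_one (by positivity)).2 (by nlinarith)
    refine (Finset.sum_le_sum fun i _ => h2 i).trans ?_
    simp

theorem norm_sq_ofMatrix (A : Matrix (Fin m) (Fin n) ℝ) :
    ‖MatrixSpace.ofMatrix A‖ ^ 2 = frobeniusSq A := by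
  rw [EuclideanSpace.norm_sq_eq, Fintype.sum_prod_type, frobeniusSq_eq_sum]
  simp [MatrixSpace.ofMatrix]

theorem norm_orth_sub_le {ε : ℝ} (hε : 0 < ε) (P Q : MatrixSpace m n) :
    ‖orth ε P - orth ε Q‖ ≤ 2 * (2 / ε) * ‖P - Q‖ := by
  have h1 : orth ε P - orth ε Q
      = MatrixSpace.ofMatrix (orthMatrix ε P.toMatrix - orthMatrix ε Q.toMatrix) := by
    ext ⟨i, j⟩
    simp [orth, MatrixSpace.ofMatrix]
  have h2 : P - Q = MatrixSpace.ofMatrix (P.toMatrix - Q.toMatrix) := by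
    ext ⟨i, j⟩
    simp [MatrixSpace.ofMatrix, MatrixSpace.toMatrix]
  refine le_of_sq_le_sq ?_ (by positivity)
  -- the passage to the dilation costs a factor `√2`, which is bounded by `2`
  have h3 := (frobeniusSq_orthMatrix ε hε P.toMatrix Q.toMatrix).1
  rw [mul_pow, h1, h2, norm_sq_ofMatrix, norm_sq_ofMatrix]
  have h4 : 0 ≤ (2 / ε) ^ 2 * frobeniusSq (P.toMatrix - Q.toMatrix) := by
    rw [← norm_sq_ofMatrix]; positivity
  nlinarith

theorem norm_orth_le {ε : ℝ} (hε : 0 < ε) (P : MatrixSpace m n) :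
    ‖orth ε P‖ ≤ √(m + n) := by
  refine Real.le_sqrt_of_sq_le ?_
  rw [orth, norm_sq_ofMatrix]
  exact (frobeniusSq_orthMatrix ε hε P.toMatrix 0).2

theorem norm_orthProduct_sub_le {B : ℕ} {m n : Fin B → ℕ} {ε : ℝ} (hε : 0 < ε)
    (P Q : ProductSpace m n) :
    ‖orthProduct ε P - orthProduct ε Q‖ ≤ 2 * (2 / ε) * ‖P - Q‖ := by
  refine le_of_sq_le_sq ?_ (by positivity)
  rw [mul_pow, PiLp.norm_sq_eq_of_L2, PiLp.norm_sq_eq_of_L2, Finset.mul_sum]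
  refine Finset.sum_le_sum fun b _ => ?_
  rw [← mul_pow]
  exact pow_le_pow_left₀ (norm_nonneg _) (norm_orth_sub_le hε (P b) (Q b)) 2

theorem norm_orthProduct_le {B : ℕ} {m n : Fin B → ℕ} {ε : ℝ} (hε : 0 < ε)
    (P : ProductSpace m n) :
    ‖orthProduct ε P‖ ≤ √(∑ b, √(m b + n b) ^ 2) := by
  refine Real.le_sqrt_of_sq_le ?_
  rw [PiLp.norm_sq_eq_of_L2]
  exact Finset.sum_le_sum fun b _ => pow_le_pow_left₀ (norm_nonneg _) (norm_orth_le hε (P b)) 2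

end Orth

/-! ### The flow on the space of displacements -/

section Flow
open scoped NNReal BoundedContinuousFunction

variable {Z : Type*} [NormedAddCommGroup Z] {H : Type*} [NormedAddCommGroup H]

theorem lipschitzWith_of_norm_sub_le {V W : Type*} [SeminormedAddCommGroup V]
    [SeminormedAddCommGroup W] {g : V → W} {C : ℝ} (hg : ∀ x y, ‖g x - g y‖ ≤ C * ‖x - y‖) :
    LipschitzWith (Real.toNNReal C) g :=
  LipschitzWith.of_dist_le' fun x y => by simpa only [dist_eq_norm] using hg x y

/-- Lipschitz functions of integrable random variables are integrable. -/
theorem integrable_comp_of_lipschitz {Ω : Type*} [MeasurableSpace Ω] {Pr : Measure Ω}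
    [IsFiniteMeasure Pr] {V W : Type*} [NormedAddCommGroup V]
    [NormedAddCommGroup W] {g : V → W} {L : ℝ}
    (hg : ∀ z z', ‖g z - g z'‖ ≤ L * ‖z - z'‖) {Y : Ω → V} (hY : Integrable Y Pr) :
    Integrable (fun x => g (Y x)) Pr := by
  have hc : Continuous g := (lipschitzWith_of_norm_sub_le hg).continuous
  refine Integrable.mono' (g := fun x => L * ‖Y x‖ + ‖g 0‖)
    ((hY.norm.const_mul L).add (integrable_const _))
    (hc.comp_aestronglyMeasurable hY.aestronglyMeasurable) (Eventually.of_forall fun x => ?_)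
  have h1 := hg (Y x) 0
  rw [sub_zero] at h1
  calc ‖g (Y x)‖ = ‖(g (Y x) - g 0) + g 0‖ := by simp
    _ ≤ _ := (norm_add_le _ _).trans (by linarith)

/-- A velocity field `b m z` on `Z`, depending on a parameter `m`, and a feature map `f : Z → H`
whose mean is to be substituted for `m`; both are `K`-Lipschitz. -/
structure LipschitzInteraction (b : H → Z → Z) (f : Z → H) (K : ℝ) : Prop where
  nonneg : 0 ≤ K
  velocity : ∀ m m' z z', ‖b m z - b m' z'‖ ≤ K * (‖m - m'‖ + ‖z - z'‖)
  feature : ∀ z z', ‖f z - f z'‖ ≤ K * ‖z - z'‖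

variable {b : H → Z → Z} {f : Z → H} {K : ℝ}

theorem LipschitzInteraction.continuous_velocity (h : LipschitzInteraction b f K) (m : H) :
    Continuous (b m) :=
  (lipschitzWith_of_norm_sub_le fun z z' => by simpa using h.velocity m m z z').continuous

theorem LipschitzInteraction.continuous_feature (h : LipschitzInteraction b f K) :
    Continuous f :=
  (lipschitzWith_of_norm_sub_le h.feature).continuous

theorem LipschitzInteraction.norm_velocity_le (h : LipschitzInteraction b f K) (m : H) (z : Z) :
    ‖b m z‖ ≤ ‖b 0 0‖ + K * (‖m‖ + ‖z‖) := by
  have := h.velocity m 0 z 0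
  simp only [sub_zero] at this
  calc ‖b m z‖ = ‖b m z - b 0 0 + b 0 0‖ := by simp
    _ ≤ _ := (norm_add_le _ _).trans (by linarith)

variable [NormedSpace ℝ Z]

/-- The map `z ↦ z + (1 + ‖z‖) u(z)`. Maps of linear growth which are at finite weighted distance
from the identity are represented in this way by elements `u` of a Banach space. -/
def displace (u : Z →ᵇ Z) (z : Z) : Z := z + (1 + ‖z‖) • u z

theorem continuous_displace (u : Z →ᵇ Z) : Continuous (displace u) :=
  continuous_id.add ((continuous_const.add continuous_norm).smul u.continuous)

@[simp] theorem displace_zero (z : Z) : displace 0 z = z := by simp [displace]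

theorem norm_displace_sub_le (u u' : Z →ᵇ Z) (z : Z) :
    ‖displace u z - displace u' z‖ ≤ (1 + ‖z‖) * ‖u - u'‖ := by
  have h : displace u z - displace u' z = (1 + ‖z‖) • (u - u') z := by
    simp [displace, smul_sub]
  rw [h, norm_smul, Real.norm_of_nonneg (by positivity)]
  gcongr
  exact (u - u').norm_coe_le_norm z

theorem norm_displace_sub_self_le (u : Z →ᵇ Z) (z : Z) :
    ‖displace u z - z‖ ≤ (1 + ‖z‖) * ‖u‖ := by
  simpa using norm_displace_sub_le u 0 z

/-- The velocity `(1 + ‖z‖)⁻¹ b(m, z + (1 + ‖z‖) u(z))` of the displacement `u`. -/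
noncomputable def displacementVelocity (h : LipschitzInteraction b f K) (m : H) (u : Z →ᵇ Z) :
    Z →ᵇ Z :=
  BoundedContinuousFunction.ofNormedAddCommGroup
    (fun z => (1 + ‖z‖)⁻¹ • b m (displace u z))
    (((continuous_const.add continuous_norm).inv₀ fun z => (by positivity : 1 + ‖z‖ ≠ 0)).smul
      ((h.continuous_velocity m).comp (continuous_displace u)))
    (‖b 0 0‖ + K * (‖m‖ + (1 + ‖u‖))) (by
      intro z
      have hK := h.nonneg
      rw [norm_smul, norm_inv, Real.norm_of_nonneg (by positivity),
        inv_mul_le_iff₀ (by positivity)]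
      have h1 := h.norm_velocity_le m (displace u z)
      have h2 : ‖displace u z‖ ≤ ‖z‖ + (1 + ‖z‖) * ‖u‖ := by
        calc ‖displace u z‖ = ‖z + (displace u z - z)‖ := by simp
          _ ≤ _ := (norm_add_le _ _).trans (by gcongr; exact norm_displace_sub_self_le u z)
      have h3 := mul_le_mul_of_nonneg_left h2 hK
      have h4 := mul_nonneg (norm_nonneg z) (norm_nonneg (b 0 0))
      have h5 := mul_nonneg (norm_nonneg z) (mul_nonneg hK (norm_nonneg m))
      nlinarith)

theorem displacementVelocity_apply (h : LipschitzInteraction b f K) (m : H) (u : Z →ᵇ Z) (z : Z) :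
    displacementVelocity h m u z = (1 + ‖z‖)⁻¹ • b m (displace u z) := rfl

theorem norm_displacementVelocity_sub_le (h : LipschitzInteraction b f K) (m m' : H)
    (u u' : Z →ᵇ Z) : ‖displacementVelocity h m u - displacementVelocity h m' u'‖
      ≤ K * (‖m - m'‖ + ‖u - u'‖) := by
  have hK := h.nonneg
  refine (BoundedContinuousFunction.norm_le (by positivity)).2 fun z => ?_
  rw [BoundedContinuousFunction.coe_sub, Pi.sub_apply, displacementVelocity_apply,
    displacementVelocity_apply, ← smul_sub, norm_smul, norm_inv,
    Real.norm_of_nonneg (by positivity), inv_mul_le_iff₀ (by positivity)]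
  refine (h.velocity _ _ _ _).trans ?_
  have h1 := mul_le_mul_of_nonneg_left (norm_displace_sub_le u u' z) hK
  have h2 := mul_nonneg (norm_nonneg z) (mul_nonneg hK (norm_nonneg (m - m')))
  nlinarith

/-- A curve of displacements moves with `displacementVelocity` exactly when each of its
trajectories moves with the velocity field `b`. -/
theorem hasDerivAt_displace {h : LipschitzInteraction b f K} {m : H} {u : ℝ → Z →ᵇ Z} {t : ℝ}
    (hu : HasDerivAt u (displacementVelocity h m (u t)) t) (z : Z) :
    HasDerivAt (fun s => displace (u s) z) (b m (displace (u t) z)) t := by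
  have h1 : HasDerivAt (fun s => u s z) (displacementVelocity h m (u t) z) t :=
    (BoundedContinuousFunction.evalCLM ℝ z : (Z →ᵇ Z) →L[ℝ] Z).hasFDerivAt.comp_hasDerivAt t hu
  have h2 := (h1.const_smul (1 + ‖z‖)).const_add z
  rwa [displacementVelocity_apply, smul_inv_smul₀ (by positivity)] at h2

/-- The linear flow problem: a prescribed bounded continuous parameter curve has a flow. -/
theorem LipschitzInteraction.exists_flow [CompleteSpace Z] (h : LipschitzInteraction b f K)
    {m : ℝ → H} (hm : Continuous m) {M : ℝ} (hM : ∀ t, ‖m t‖ ≤ M) :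
    ∃ u : ℝ → Z →ᵇ Z, u 0 = 0 ∧ ∀ t, HasDerivAt u (displacementVelocity h (m t) (u t)) t := by
  have hlip : ∀ t, LipschitzWith K.toNNReal (displacementVelocity h (m t)) := fun t =>
    lipschitzWith_of_norm_sub_le fun u u' => by
      simpa using norm_displacementVelocity_sub_le h (m t) (m t) u u'
  have hpar : ∀ u : Z →ᵇ Z, LipschitzWith K.toNNReal fun k => displacementVelocity h k u :=
    fun u => lipschitzWith_of_norm_sub_le fun k k' => by
      simpa using norm_displacementVelocity_sub_le h k k' u u
  refine exists_forall_hasDerivAt_of_lipschitzWith hlip (fun x => (hpar x).continuous.comp hm)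
    (C := K * M + ‖displacementVelocity h 0 0‖) (fun t => ?_) 0
  have h1 := norm_displacementVelocity_sub_le h (m t) 0 0 0
  have h2 := norm_add_le (displacementVelocity h (m t) 0 - displacementVelocity h 0 0)
    (displacementVelocity h 0 0)
  simp only [sub_zero, norm_zero, add_zero, sub_add_cancel] at h1 h2
  have h3 := mul_le_mul_of_nonneg_left (hM t) h.nonneg
  linarith

variable [MeasurableSpace Z] [BorelSpace Z] [SecondCountableTopology Z] [NormedSpace ℝ H]

/-- The mean of the feature `f` under the image of `μ₀` by `displace u`. -/
noncomputable def displacedMean (f : Z → H) (μ₀ : Measure Z) (u : Z →ᵇ Z) : H :=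
  ∫ z, f (displace u z) ∂μ₀

variable {μ₀ : Measure Z} [IsProbabilityMeasure μ₀]

theorem integrable_displace (hμ : Integrable (fun z => ‖z‖) μ₀) (u : Z →ᵇ Z) :
    Integrable (displace u) μ₀ := by
  refine Integrable.mono' (g := fun z => ‖z‖ + (1 + ‖z‖) * ‖u‖)
    (hμ.add (((integrable_const 1).add hμ).mul_const _))
    (continuous_displace u).aestronglyMeasurable (Eventually.of_forall fun z => ?_)
  calc ‖displace u z‖ = ‖z + (displace u z - z)‖ := by simp
    _ ≤ _ := (norm_add_le _ _).trans (by gcongr; exact norm_displace_sub_self_le u z)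

theorem norm_displacedMean_sub_le (h : LipschitzInteraction b f K)
    (hμ : Integrable (fun z => ‖z‖) μ₀) (u u' : Z →ᵇ Z) :
    ‖displacedMean f μ₀ u - displacedMean f μ₀ u'‖
      ≤ K * (∫ z, (1 + ‖z‖) ∂μ₀) * ‖u - u'‖ := by
  rw [displacedMean, displacedMean, ← integral_sub
    (integrable_comp_of_lipschitz h.feature (integrable_displace hμ u))
    (integrable_comp_of_lipschitz h.feature (integrable_displace hμ u')), mul_assoc,
    ← integral_mul_const, ← integral_const_mul]
  refine norm_integral_le_of_norm_le
    ((((integrable_const 1).add hμ).mul_const _).const_mul _) (Eventually.of_forall fun z => ?_)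
  exact (h.feature _ _).trans (mul_le_mul_of_nonneg_left (norm_displace_sub_le u u' z) h.nonneg)

/-- The self-consistent velocity on displacements is globally Lipschitz: this is the whole
nonlinear flow problem, written as an autonomous equation in a Banach space. -/
theorem lipschitzWith_meanField (h : LipschitzInteraction b f K)
    (hμ : Integrable (fun z => ‖z‖) μ₀) :
    ∃ C : ℝ≥0, LipschitzWith C fun u => displacementVelocity h (displacedMean f μ₀ u) u := by
  refine ⟨_, lipschitzWith_of_norm_sub_le (C := K * (K * (∫ z, (1 + ‖z‖) ∂μ₀) + 1))
    fun u u' => ?_⟩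
  refine (norm_displacementVelocity_sub_le h _ _ u u').trans ?_
  have := mul_le_mul_of_nonneg_left (norm_displacedMean_sub_le h hμ u u') h.nonneg
  nlinarith

theorem LipschitzInteraction.exists_meanField_flow [CompleteSpace Z]
    (h : LipschitzInteraction b f K) (hμ : Integrable (fun z => ‖z‖) μ₀) :
    ∃ u : ℝ → Z →ᵇ Z, u 0 = 0 ∧
      ∀ t, HasDerivAt u (displacementVelocity h (displacedMean f μ₀ (u t)) (u t)) t := by
  obtain ⟨C, hC⟩ := lipschitzWith_meanField h hμ
  exact exists_forall_hasDerivAt_of_lipschitzWith (fun _ => hC) (fun _ => continuous_const)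
    (fun _ => le_rfl) 0

/-- A flow along a parameter curve `m` that happens to equal the feature mean of the transported
measure is the mean-field flow. -/
theorem LipschitzInteraction.flow_eq_meanField_flow (h : LipschitzInteraction b f K)
    (hμ : Integrable (fun z => ‖z‖) μ₀) {T : ℝ} {m : ℝ → H} {u u' : ℝ → Z →ᵇ Z}
    (hu0 : u 0 = 0)
    (hu : ∀ t, HasDerivAt u (displacementVelocity h (displacedMean f μ₀ (u t)) (u t)) t)
    (hu0' : u' 0 = 0)
    (hu' : ∀ t ∈ Icc 0 T, HasDerivAt u' (displacementVelocity h (m t) (u' t)) t)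
    (hm : ∀ t ∈ Icc 0 T, m t = displacedMean f μ₀ (u' t)) : ∀ t ∈ Icc 0 T, u' t = u t := by
  obtain ⟨C, hC⟩ := lipschitzWith_meanField h hμ
  have hu'' : ∀ t ∈ Icc 0 T,
      HasDerivAt u' (displacementVelocity h (displacedMean f μ₀ (u' t)) (u' t)) t := by
    intro t ht
    rw [← hm t ht]
    exact hu' t ht
  exact ODE_solution_unique_of_mem_Icc_right (s := fun _ => univ)
    (v := fun _ u => displacementVelocity h (displacedMean f μ₀ u) u)
    (fun t _ => hC.lipschitzOnWith)
    (fun t ht => (hu'' t ht).continuousAt.continuousWithinAt)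
    (fun t ht => (hu'' t (Ico_subset_Icc_self ht)).hasDerivWithinAt) (fun _ _ => mem_univ _)
    (fun t _ => (hu t).continuousAt.continuousWithinAt)
    (fun t _ => (hu t).hasDerivWithinAt) (fun _ _ => mem_univ _) (hu0'.trans hu0.symm)

end Flow

/-! ### Mollification, and smooth test functions determine a measure -/

section Mollify
open scoped Convolution NNReal
open ContinuousLinearMap (lsmul)

variable {Z : Type*} [NormedAddCommGroup Z] [NormedSpace ℝ Z] [FiniteDimensional ℝ Z]
  [MeasurableSpace Z] [BorelSpace Z]
variable {W : Type*} [NormedAddCommGroup W] [NormedSpace ℝ W]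

/-- A Lipschitz function convolved with a compactly supported kernel is Lipschitz; the constant is
multiplied by the mass of the kernel. -/
theorem norm_convolution_sub_le {V V' : Type*} [NormedAddCommGroup V] [NormedSpace ℝ V]
    [NormedAddCommGroup V'] [NormedSpace ℝ V'] {μ : Measure Z} [μ.IsAddHaarMeasure] {k : Z → V}
    (hk : Continuous k) (hkc : HasCompactSupport k) {A : V →L[ℝ] W →L[ℝ] V'}
    (hA : ∀ v w, ‖A v w‖ ≤ ‖v‖ * ‖w‖) {g : Z → W} {L : ℝ}
    (hg : ∀ x y, ‖g x - g y‖ ≤ L * ‖x - y‖) (z z' : Z) :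
    ‖(k ⋆[A, μ] g) z - (k ⋆[A, μ] g) z'‖ ≤ (∫ t, ‖k t‖ ∂μ) * L * ‖z - z'‖ := by
  have hgc : Continuous g := (lipschitzWith_of_norm_sub_le hg).continuous
  have hex := hkc.convolutionExists_left A hk (μ := μ) hgc.locallyIntegrable
  have hki : Integrable (fun t => ‖k t‖) μ := (hk.integrable_of_hasCompactSupport hkc).norm
  rw [convolution_def, convolution_def, ← integral_sub (hex z) (hex z'), mul_assoc,
    ← integral_mul_const]
  refine norm_integral_le_of_norm_le (hki.mul_const _)
    (Eventually.of_forall fun t => ?_)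
  rw [← map_sub]
  refine (hA _ _).trans ?_
  have h := hg (z - t) (z' - t)
  rw [sub_sub_sub_cancel_right] at h
  gcongr

/-- Lipschitz maps are uniformly close to smooth maps with the same Lipschitz constant, whose
derivatives are Lipschitz with a constant that depends only on the accuracy. -/
theorem exists_smooth_approximation [CompleteSpace W] {L δ : ℝ} (hL : 0 ≤ L) (hδ : 0 < δ) :
    ∃ M : ℝ, 0 ≤ M ∧ ∀ g : Z → W, (∀ x y, ‖g x - g y‖ ≤ L * ‖x - y‖) →
      ∃ V : Z → W, ContDiff ℝ ∞ V ∧ (∀ z, ‖V z - g z‖ ≤ δ) ∧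
        (∀ z z', ‖V z - V z'‖ ≤ L * ‖z - z'‖) ∧
        ∀ z z', ‖fderiv ℝ V z - fderiv ℝ V z'‖ ≤ M * ‖z - z'‖ := by
  let μ : Measure Z := Measure.addHaar
  let r : ℝ := δ / (L + 1)
  have hr : 0 < r := by positivity
  let φ : ContDiffBump (0 : Z) := ⟨r / 2, r, by positivity, by linarith⟩
  have hφ : ContDiff ℝ ∞ (φ.normed μ) := φ.contDiff_normed
  have hφc : HasCompactSupport (φ.normed μ) := φ.hasCompactSupport_normed
  refine ⟨(∫ t, ‖fderiv ℝ (φ.normed μ) t‖ ∂μ) * L,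
    mul_nonneg (integral_nonneg fun _ => norm_nonneg _) hL,
    fun g hg => ?_⟩
  have hgc : Continuous g := (lipschitzWith_of_norm_sub_le hg).continuous
  refine ⟨φ.normed μ ⋆[lsmul ℝ ℝ, μ] g,
    hφc.contDiff_convolution_left _ hφ hgc.locallyIntegrable, fun z => ?_, fun z z' => ?_,
    fun z z' => ?_⟩
  · rw [← dist_eq_norm]
    refine φ.dist_normed_convolution_le hgc.aestronglyMeasurable fun x hx => ?_
    rw [dist_eq_norm]
    refine (hg x z).trans ?_
    have h1 : ‖x - z‖ < r := by simpa [dist_eq_norm, φ] using hx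
    calc L * ‖x - z‖ ≤ (L + 1) * r := by gcongr; linarith
      _ = δ := by simp only [r]; field_simp
  · refine (norm_convolution_sub_le hφ.continuous hφc
      (fun v w => (norm_smul v w).le) hg z z').trans ?_
    have h1 : ∫ t, ‖φ.normed μ t‖ ∂μ = 1 := by
      rw [← φ.integral_normed (μ := μ)]
      exact integral_congr_ae (Eventually.of_forall fun t =>
        Real.norm_of_nonneg (φ.nonneg_normed t))
    rw [h1, one_mul]
  · have h1 : ∀ z, fderiv ℝ (φ.normed μ ⋆[lsmul ℝ ℝ, μ] g) z
        = (fderiv ℝ (φ.normed μ) ⋆[(lsmul ℝ ℝ).precompL Z, μ] g) z := fun z =>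
      (hφc.hasFDerivAt_convolution_left _ (hφ.of_le (by simp)) hgc.locallyIntegrable z).fderiv
    rw [h1, h1]
    refine norm_convolution_sub_le (hφ.continuous_fderiv (by simp)) (hφc.fderiv ℝ)
      (fun v w => ContinuousLinearMap.opNorm_le_bound _ (by positivity) fun y => ?_) hg z z'
    rw [ContinuousLinearMap.precompL_apply, ContinuousLinearMap.lsmul_apply, norm_smul]
    calc ‖v y‖ * ‖w‖ ≤ ‖v‖ * ‖y‖ * ‖w‖ := by gcongr; exact v.le_opNorm y
      _ = _ := by ring

/-- Finite measures are determined by the integrals of smooth compactly supported functions. -/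
theorem measure_ext_of_forall_integral_contDiff {μ ν : Measure Z} [IsFiniteMeasure μ]
    [IsFiniteMeasure ν] (h : ∀ ζ : Z → ℝ, ContDiff ℝ ∞ ζ → HasCompactSupport ζ →
      ∫ z, ζ z ∂μ = ∫ z, ζ z ∂ν) : μ = ν := by
  refine Measure.ext_of_integral_eq_on_compactlySupported fun f => ?_
  have hf : Continuous f := f.continuous
  have hfc : HasCompactSupport f := f.hasCompactSupport
  have huc := hfc.uniformContinuous_of_continuous hf
  have hfi : ∀ (κ : Measure Z) [IsFiniteMeasure κ], Integrable f κ := fun κ _ =>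
    hf.integrable_of_hasCompactSupport hfc
  by_contra hne
  set c : ℝ := μ.real univ + ν.real univ + 1 with hc
  have hc0 : 0 < c := by positivity
  obtain ⟨r, hr, hrf⟩ := Metric.uniformContinuous_iff.1 huc
    (|∫ z, f z ∂μ - ∫ z, f z ∂ν| / (2 * c))
    (div_pos (abs_pos.2 (sub_ne_zero.2 hne)) (by positivity))
  set e := |∫ z, f z ∂μ - ∫ z, f z ∂ν| / (2 * c) with he
  let φ : ContDiffBump (0 : Z) := ⟨r / 2, r, by positivity, by linarith⟩
  let ζ : Z → ℝ := φ.normed Measure.addHaar ⋆[lsmul ℝ ℝ, Measure.addHaar] f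
  have hζ : ContDiff ℝ ∞ ζ := φ.hasCompactSupport_normed.contDiff_convolution_left _
    φ.contDiff_normed hf.locallyIntegrable
  have hζc : HasCompactSupport ζ := φ.hasCompactSupport_normed.convolution _ hfc
  have hclose : ∀ z, ‖f z - ζ z‖ ≤ e := fun z => by
    rw [← dist_eq_norm, dist_comm]
    exact φ.dist_normed_convolution_le hf.aestronglyMeasurable fun x hx => (hrf hx).le
  have hb : ∀ (κ : Measure Z) [IsFiniteMeasure κ],
      |∫ z, f z ∂κ - ∫ z, ζ z ∂κ| ≤ e * κ.real univ := fun κ _ => by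
    rw [← integral_sub (hfi κ) (hζ.continuous.integrable_of_hasCompactSupport hζc)]
    exact norm_integral_le_of_norm_le_const (Eventually.of_forall hclose)
  have h1 := hb μ
  have h2 := hb ν
  rw [h ζ hζ hζc] at h1
  have h3 : |∫ z, f z ∂μ - ∫ z, f z ∂ν| = e * (2 * c) := by rw [he]; field_simp
  have h4 : 0 < e := by
    rw [he]
    exact div_pos (abs_pos.2 (sub_ne_zero.2 hne)) (by positivity)
  have h5 := abs_sub_le (∫ z, f z ∂μ) (∫ z, ζ z ∂ν) (∫ z, f z ∂ν)
  rw [abs_sub_comm (∫ z, ζ z ∂ν)] at h5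
  have h6 : 0 ≤ μ.real univ := measureReal_nonneg
  have h7 : 0 ≤ ν.real univ := measureReal_nonneg
  nlinarith

end Mollify

/-! ### Uniqueness for linear continuity equations with Lipschitz velocity -/

section LinearUniqueness

theorem hasCompactSupport_of_eq_zero {Z : Type*} [NormedAddCommGroup Z] [ProperSpace Z]
    {W : Type*} [Zero W] {k : Z → W} {R : ℝ} (h : ∀ z, R < 1 + ‖z‖ → k z = 0) :
    HasCompactSupport k :=
  HasCompactSupport.intro (isCompact_closedBall 0 R) fun z hz => h z (by
    simp only [Metric.mem_closedBall, dist_zero_right, not_le] at hz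
    linarith)

variable {Z : Type*} [NormedAddCommGroup Z] [NormedSpace ℝ Z]

/-- Quantitative test functions: smooth, with derivative bounded by `A` and `B`-Lipschitz, and
vanishing where `R < 1 + ‖z‖`. -/
structure TestBound (ζ : Z → ℝ) (A B R : ℝ) : Prop where
  contDiff : ContDiff ℝ ∞ ζ
  norm_fderiv_le : ∀ z, ‖fderiv ℝ ζ z‖ ≤ A
  norm_fderiv_sub_le : ∀ z z', ‖fderiv ℝ ζ z - fderiv ℝ ζ z'‖ ≤ B * ‖z - z'‖
  eq_zero : ∀ z, R < 1 + ‖z‖ → ζ z = 0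

variable {ζ : Z → ℝ} {A B R : ℝ}

theorem TestBound.mono (h : TestBound ζ A B R) {A' B' R' : ℝ} (hA : A ≤ A') (hB : B ≤ B')
    (hR : R ≤ R') : TestBound ζ A' B' R' :=
  ⟨h.contDiff, fun z => (h.norm_fderiv_le z).trans hA,
    fun z z' => (h.norm_fderiv_sub_le z z').trans (by gcongr),
    fun z hz => h.eq_zero z (hR.trans_lt hz)⟩

theorem TestBound.fderiv_eq_zero (h : TestBound ζ A B R) {z : Z} (hz : R < 1 + ‖z‖) :
    fderiv ℝ ζ z = 0 := by
  have h1 : ζ =ᶠ[𝓝 z] fun _ => 0 := by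
    filter_upwards [(isOpen_lt continuous_const (continuous_const.add continuous_norm)).mem_nhds hz]
      with y hy using h.eq_zero y hy
  rw [h1.fderiv_eq]
  simp

theorem exists_testBound [ProperSpace Z] (hζ : ContDiff ℝ ∞ ζ) (hc : HasCompactSupport ζ) :
    ∃ A B R : ℝ, 0 ≤ A ∧ 0 ≤ B ∧ 0 ≤ R ∧ TestBound ζ A B R := by
  obtain ⟨A, hA⟩ := hζ.lipschitzWith_of_hasCompactSupport hc (by simp)
  obtain ⟨B, hB⟩ := (hζ.fderiv_right (m := ∞) (by simp)).lipschitzWith_of_hasCompactSupport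
    (hc.fderiv ℝ) (by simp)
  obtain ⟨R, hR⟩ := hc.isCompact.isBounded.exists_norm_le
  refine ⟨A, B, 1 + max R 0, A.2, B.2, by positivity, hζ,
    fun z => norm_fderiv_le_of_lipschitz ℝ hA, fun z z' => ?_, fun z hz => ?_⟩
  · simpa [dist_eq_norm] using hB.dist_le_mul z z'
  · by_contra hne
    have h1 := hR z (subset_tsupport _ hne)
    have h2 := le_max_left R 0
    linarith

theorem norm_fderiv_le_of_norm_sub_le {W : Type*} [NormedAddCommGroup W] [NormedSpace ℝ W]
    {V : Z → W} {L : ℝ} (hL : 0 ≤ L) (hV : ∀ z z', ‖V z - V z'‖ ≤ L * ‖z - z'‖) (z : Z) :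
    ‖fderiv ℝ V z‖ ≤ L := by
  have := norm_fderiv_le_of_lipschitz ℝ (lipschitzWith_of_norm_sub_le hV) (x₀ := z)
  rwa [Real.coe_toNNReal _ hL] at this

/-- Composition of a test function with an Euler step of a smooth velocity field `V`. -/
theorem TestBound.comp_eulerStep (hζ : TestBound ζ A B R) (hA : 0 ≤ A) (hB : 0 ≤ B) (hR : 0 ≤ R)
    {V : Z → Z} {L M C h : ℝ} (hL : 0 ≤ L) (hV : ContDiff ℝ ∞ V)
    (hVL : ∀ z z', ‖V z - V z'‖ ≤ L * ‖z - z'‖)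
    (hVM : ∀ z z', ‖fderiv ℝ V z - fderiv ℝ V z'‖ ≤ M * ‖z - z'‖)
    (hVC : ∀ z, ‖V z‖ ≤ C * (1 + ‖z‖)) (hC : 0 ≤ C) (hh : 0 ≤ h) (hhC : h * C ≤ 1 / 2) :
    TestBound (fun z => ζ (z + h • V z)) (A * (1 + h * L)) (B * (1 + h * L) ^ 2 + A * (h * M))
      (R * (1 + 2 * (h * C))) := by
  have hS : ContDiff ℝ ∞ fun z => z + h • V z := contDiff_id.add (contDiff_const.smul hV)
  have hVd : ∀ z, HasFDerivAt V (fderiv ℝ V z) z := fun z =>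
    (hV.differentiable (by simp) z).hasFDerivAt
  have hSd : ∀ z, HasFDerivAt (fun z => z + h • V z)
      (ContinuousLinearMap.id ℝ Z + h • fderiv ℝ V z) z := fun z =>
    (hasFDerivAt_id z).add ((hVd z).const_smul h)
  have hSn : ∀ z, ‖ContinuousLinearMap.id ℝ Z + h • fderiv ℝ V z‖ ≤ 1 + h * L := fun z => by
    refine (norm_add_le _ _).trans (add_le_add ContinuousLinearMap.norm_id_le ?_)
    rw [norm_smul, Real.norm_of_nonneg hh]
    gcongr
    exact norm_fderiv_le_of_norm_sub_le hL hVL z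
  have hd : ∀ z, fderiv ℝ (fun z => ζ (z + h • V z)) z
      = (fderiv ℝ ζ (z + h • V z)).comp (ContinuousLinearMap.id ℝ Z + h • fderiv ℝ V z) :=
    fun z => ((hζ.contDiff.differentiable (by simp) _).hasFDerivAt.comp z (hSd z)).fderiv
  refine ⟨hζ.contDiff.comp hS, fun z => ?_, fun z z' => ?_, fun z hz => hζ.eq_zero _ ?_⟩
  · rw [hd]
    exact (ContinuousLinearMap.opNorm_comp_le _ _).trans
      (mul_le_mul (hζ.norm_fderiv_le _) (hSn z) (norm_nonneg _) hA)
  · rw [hd, hd]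
    set D := fderiv ℝ ζ (z + h • V z)
    set D' := fderiv ℝ ζ (z' + h • V z')
    set J := ContinuousLinearMap.id ℝ Z + h • fderiv ℝ V z
    set J' := ContinuousLinearMap.id ℝ Z + h • fderiv ℝ V z'
    have h1 : D.comp J - D'.comp J' = (D - D').comp J + D'.comp (J - J') := by
      ext y
      simp
    have h2 : ‖(z + h • V z) - (z' + h • V z')‖ ≤ (1 + h * L) * ‖z - z'‖ := by
      have : (z + h • V z) - (z' + h • V z') = (z - z') + h • (V z - V z') := by
        rw [smul_sub]; abel
      rw [this]
      refine (norm_add_le _ _).trans ?_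
      rw [norm_smul, Real.norm_of_nonneg hh]
      have := mul_le_mul_of_nonneg_left (hVL z z') hh
      linarith
    have h3 : ‖J - J'‖ ≤ h * (M * ‖z - z'‖) := by
      have : J - J' = h • (fderiv ℝ V z - fderiv ℝ V z') := by simp [J, J', smul_sub]
      rw [this, norm_smul, Real.norm_of_nonneg hh]
      gcongr
      exact hVM z z'
    have h4 : ‖D - D'‖ ≤ B * ((1 + h * L) * ‖z - z'‖) :=
      (hζ.norm_fderiv_sub_le _ _).trans (by gcongr)
    rw [h1]
    calc _ ≤ ‖D - D'‖ * ‖J‖ + ‖D'‖ * ‖J - J'‖ := (norm_add_le _ _).trans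
          (add_le_add (ContinuousLinearMap.opNorm_comp_le _ _)
            (ContinuousLinearMap.opNorm_comp_le _ _))
      _ ≤ B * ((1 + h * L) * ‖z - z'‖) * (1 + h * L) + A * (h * (M * ‖z - z'‖)) := by
          gcongr
          · exact hSn z
          · exact hζ.norm_fderiv_le _
      _ = _ := by ring
  · have h1 : ‖z‖ ≤ ‖z + h • V z‖ + h * (C * (1 + ‖z‖)) := by
      calc ‖z‖ = ‖(z + h • V z) - h • V z‖ := by simp
        _ ≤ ‖z + h • V z‖ + ‖h • V z‖ := norm_sub_le _ _
        _ ≤ _ := by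
          rw [norm_smul, Real.norm_of_nonneg hh]
          gcongr
          exact hVC z
    have h2 : 0 ≤ h * C := mul_nonneg hh hC
    have h3 : (1 - h * C) * (1 + ‖z‖) ≤ 1 + ‖z + h • V z‖ := by linarith
    have h4 : 1 ≤ (1 - h * C) * (1 + 2 * (h * C)) := by nlinarith
    have h5 : (1 - h * C) * (R * (1 + 2 * (h * C))) < (1 - h * C) * (1 + ‖z‖) :=
      mul_lt_mul_of_pos_left hz (by linarith)
    nlinarith

/-- The bounds which hold after Euler steps of total length `s` are propagated by another step. Only
the second of them involves the Lipschitz constant `M` of the derivative of the velocity. -/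
theorem TestBound.comp_eulerStep_exp {s : ℝ} {V : Z → Z} {L M C h c : ℝ}
    (hζ : TestBound ζ (A * Real.exp (c * s)) (Real.exp (c * s) * (B + A * M * s))
      (R * Real.exp (c * s))) (hs : 0 ≤ s) (hA : 0 ≤ A) (hB : 0 ≤ B) (hR : 0 ≤ R) (hM : 0 ≤ M)
    (hL : 0 ≤ L) (hc : c = 2 * L + 2 * C) (hV : ContDiff ℝ ∞ V)
    (hVL : ∀ z z', ‖V z - V z'‖ ≤ L * ‖z - z'‖)
    (hVM : ∀ z z', ‖fderiv ℝ V z - fderiv ℝ V z'‖ ≤ M * ‖z - z'‖)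
    (hVC : ∀ z, ‖V z‖ ≤ C * (1 + ‖z‖)) (hC : 0 ≤ C) (hh : 0 ≤ h) (hhC : h * C ≤ 1 / 2) :
    TestBound (fun z => ζ (z + h • V z)) (A * Real.exp (c * (s + h)))
      (Real.exp (c * (s + h)) * (B + A * M * (s + h))) (R * Real.exp (c * (s + h))) := by
  have he : Real.exp (c * (s + h)) = Real.exp (c * s) * Real.exp (c * h) := by
    rw [← Real.exp_add]; ring_nf
  have hhL : 0 ≤ h * L := mul_nonneg hh hL
  have hhC0 : 0 ≤ h * C := mul_nonneg hh hC
  have h2 : (1 + h * L) ^ 2 ≤ Real.exp (c * h) := by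
    have h3 : 1 + h * L ≤ Real.exp (h * L) := by linarith [Real.add_one_le_exp (h * L)]
    calc (1 + h * L) ^ 2 ≤ Real.exp (h * L) ^ 2 := by gcongr
      _ = Real.exp (2 * (h * L)) := by rw [← Real.exp_nat_mul]; norm_num
      _ ≤ _ := Real.exp_le_exp.2 (by rw [hc]; nlinarith)
  have h1 : 1 + h * L ≤ Real.exp (c * h) := by nlinarith
  have h3 : 1 + 2 * (h * C) ≤ Real.exp (c * h) := by
    refine le_trans ?_ (Real.add_one_le_exp _)
    rw [hc]
    nlinarith
  have h4 : 1 ≤ Real.exp (c * h) := by linarith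
  refine (hζ.comp_eulerStep (by positivity) (by positivity) (by positivity) hL hV hVL hVM hVC hC hh
    hhC).mono ?_ ?_ ?_
  · rw [he, mul_assoc]
    gcongr
  · rw [he]
    calc _ ≤ Real.exp (c * s) * (B + A * M * s) * Real.exp (c * h)
          + A * Real.exp (c * s) * (h * M) * Real.exp (c * h) :=
          add_le_add (by gcongr) (le_mul_of_one_le_right (by positivity) h4)
      _ = _ := by ring
  · rw [he, mul_assoc]
    gcongr

theorem abs_taylor_le {B : ℝ} (hζ : Differentiable ℝ ζ) (hB : 0 ≤ B)
    (hζB : ∀ z z', ‖fderiv ℝ ζ z - fderiv ℝ ζ z'‖ ≤ B * ‖z - z'‖) (z y : Z) :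
    |ζ (z + y) - ζ z - fderiv ℝ ζ z y| ≤ B * ‖y‖ ^ 2 := by
  have h := (convex_closedBall z ‖y‖).norm_image_sub_le_of_norm_fderiv_le' (𝕜 := ℝ) (f := ζ)
    (φ := fderiv ℝ ζ z) (C := B * ‖y‖) (x := z) (y := z + y) (fun x _ => hζ x)
    (fun x hx => (hζB x z).trans (by
      rw [Metric.mem_closedBall, dist_eq_norm] at hx
      gcongr)) (Metric.mem_closedBall_self (norm_nonneg _))
    (by simp)
  rw [add_sub_cancel_left] at h
  calc _ ≤ B * ‖y‖ * ‖y‖ := h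
    _ = _ := by ring

variable [MeasurableSpace Z]

/-- A curve of probability measures on `[0, T]` which is uniformly continuous in the dual Lipschitz
sense and solves the linear continuity equation `∂ₜν + ∇ · (bₜ ν) = 0` weakly. -/
structure IsLinearSolution (b : ℝ → Z → Z) (T : ℝ) (ν : ℝ → Measure Z) : Prop where
  isProbabilityMeasure : ∀ t ∈ Icc 0 T, IsProbabilityMeasure (ν t)
  continuity : ∀ δ > 0, ∃ η > 0, ∀ s ∈ Icc 0 T, ∀ t ∈ Icc 0 T, |s - t| < η →
    ∀ (k : Z → ℝ) (L : ℝ), 0 ≤ L → HasCompactSupport k → (∀ z z', ‖k z - k z'‖ ≤ L * ‖z - z'‖) →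
      |∫ z, k z ∂(ν s) - ∫ z, k z ∂(ν t)| ≤ L * δ
  weak : ∀ ζ : Z → ℝ, ContDiff ℝ ∞ ζ → HasCompactSupport ζ → ∀ t ∈ Icc 0 T,
    HasDerivWithinAt (fun s => ∫ z, ζ z ∂(ν s)) (∫ z, fderiv ℝ ζ z (b t z) ∂(ν t)) (Icc 0 T) t

variable [BorelSpace Z] [FiniteDimensional ℝ Z] {b : ℝ → Z → Z} {T : ℝ} {ν : ℝ → Measure Z}

/-- One Euler step of a nearby smooth velocity field `V`, against a test function, compared with the
solution of the continuity equation. -/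
theorem IsLinearSolution.abs_eulerStep_le (hν : IsLinearSolution b T ν) {L : ℝ}
    (hb : ∀ t ∈ Icc 0 T, ∀ z z', ‖b t z - b t z'‖ ≤ L * ‖z - z'‖)
    (hζ : TestBound ζ A B R) (hA : 0 ≤ A) (hB : 0 ≤ B) {V : Z → Z} {t h δ₁ δ₂ G : ℝ}
    (hL : 0 ≤ L) (ht : t ∈ Icc 0 T) (hh : 0 ≤ h) (hth : t + h ∈ Icc 0 T) (hG : 0 ≤ G)
    (hVc : Continuous V) (hS : ∀ z, R < 1 + ‖z‖ → ζ (z + h • V z) = 0)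
    (hVG : ∀ z, 1 + ‖z‖ ≤ R → ‖V z‖ ≤ G) (hbG : ∀ z, 1 + ‖z‖ ≤ R → ‖b t z‖ ≤ G)
    (hδ₁ : 0 ≤ δ₁) (hVb : ∀ z, ‖V z - b t z‖ ≤ δ₁)
    (hbt : ∀ s ∈ Icc t (t + h), ∀ z, ‖b s z - b t z‖ ≤ δ₂)
    (hνt : ∀ s ∈ Icc t (t + h), ∀ (k : Z → ℝ) (L : ℝ), 0 ≤ L → HasCompactSupport k →
      (∀ z z', ‖k z - k z'‖ ≤ L * ‖z - z'‖) →
      |∫ z, k z ∂(ν s) - ∫ z, k z ∂(ν t)| ≤ L * δ₂) :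
    |∫ z, ζ z ∂(ν (t + h)) - ∫ z, ζ (z + h • V z) ∂(ν t)|
      ≤ h * (A * δ₁ + B * h * G ^ 2 + (A + (B * G + A * L)) * δ₂) := by
  have hsub : Icc t (t + h) ⊆ Icc 0 T := Icc_subset_Icc ht.1 hth.2
  have hζd : Differentiable ℝ ζ := hζ.contDiff.differentiable (by simp)
  have hζc : HasCompactSupport ζ := hasCompactSupport_of_eq_zero hζ.eq_zero
  have hbc : ∀ s ∈ Icc 0 T, Continuous (b s) := fun s hs =>
    (lipschitzWith_of_norm_sub_le (hb s hs)).continuous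
  have hDc : Continuous (fderiv ℝ ζ) := hζ.contDiff.continuous_fderiv (by simp)
  let k : ℝ → Z → ℝ := fun s z => fderiv ℝ ζ z (b s z)
  have hkc : ∀ s ∈ Icc 0 T, Continuous (k s) := fun s hs => hDc.clm_apply (hbc s hs)
  have hk0 : ∀ s z, R < 1 + ‖z‖ → k s z = 0 := fun s z hz => by
    simp [k, hζ.fderiv_eq_zero hz]
  have hksupp : ∀ s, HasCompactSupport (k s) := fun s => hasCompactSupport_of_eq_zero (hk0 s)
  have hδ₂ : 0 ≤ δ₂ := (norm_nonneg _).trans (hbt t (left_mem_Icc.2 (by linarith)) 0)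
  -- `b t` is bounded by `G` only where `ζ` lives; if neither point lies there, both values vanish
  have hkL : ∀ z z', ‖k t z - k t z'‖ ≤ (B * G + A * L) * ‖z - z'‖ := by
    have key : ∀ z z', 1 + ‖z‖ ≤ R → ‖k t z - k t z'‖ ≤ (B * G + A * L) * ‖z - z'‖ := by
      intro z z' hz
      have h1 : k t z - k t z' = (fderiv ℝ ζ z - fderiv ℝ ζ z') (b t z)
          + fderiv ℝ ζ z' (b t z - b t z') := by simp [k]
      rw [h1]
      calc _ ≤ ‖fderiv ℝ ζ z - fderiv ℝ ζ z'‖ * ‖b t z‖ + ‖fderiv ℝ ζ z'‖ * ‖b t z - b t z'‖ :=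
            (norm_add_le _ _).trans (add_le_add (ContinuousLinearMap.le_opNorm _ _)
              (ContinuousLinearMap.le_opNorm _ _))
        _ ≤ B * ‖z - z'‖ * G + A * (L * ‖z - z'‖) := by
            gcongr
            · exact hζ.norm_fderiv_sub_le z z'
            · exact hbG z hz
            · exact hζ.norm_fderiv_le z'
            · exact hb t ht z z'
        _ = _ := by ring
    intro z z'
    by_cases hz : 1 + ‖z‖ ≤ R
    · exact key z z' hz
    · by_cases hz' : 1 + ‖z'‖ ≤ R
      · rw [norm_sub_rev, norm_sub_rev z]
        exact key z' z hz'
      · rw [hk0 t z (not_le.1 hz), hk0 t z' (not_le.1 hz'), sub_zero, norm_zero]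
        positivity
  have hder : ∀ s ∈ Icc t (t + h),
      ‖∫ z, k s z ∂(ν s) - ∫ z, k t z ∂(ν t)‖ ≤ (A + (B * G + A * L)) * δ₂ := by
    intro s hs
    have := hν.isProbabilityMeasure s (hsub hs)
    have h1 : ‖∫ z, k s z ∂(ν s) - ∫ z, k t z ∂(ν s)‖ ≤ A * δ₂ := by
      rw [← integral_sub ((hkc s (hsub hs)).integrable_of_hasCompactSupport (hksupp s))
        ((hkc t ht).integrable_of_hasCompactSupport (hksupp t))]
      refine (norm_integral_le_of_norm_le_const (C := A * δ₂)
        (Eventually.of_forall fun z => ?_)).trans (by simp)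
      rw [← map_sub]
      exact ((fderiv ℝ ζ z).le_opNorm _).trans (mul_le_mul (hζ.norm_fderiv_le z) (hbt s hs z)
        (norm_nonneg _) hA)
    have h2 := hνt s hs (k t) _ (by positivity) (hksupp t) hkL
    calc _ = ‖(∫ z, k s z ∂(ν s) - ∫ z, k t z ∂(ν s))
          + (∫ z, k t z ∂(ν s) - ∫ z, k t z ∂(ν t))‖ := by rw [sub_add_sub_cancel]
      _ ≤ A * δ₂ + (B * G + A * L) * δ₂ := (norm_add_le _ _).trans (add_le_add h1 h2)
      _ = _ := by ring
  -- the solution itself against its linearization at time `t`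
  have hI := (convex_Icc t (t + h)).norm_image_sub_le_of_norm_hasDerivWithin_le
    (f := fun s => ∫ z, ζ z ∂(ν s) - s * ∫ z, k t z ∂(ν t))
    (f' := fun s => ∫ z, k s z ∂(ν s) - ∫ z, k t z ∂(ν t)) (x := t) (y := t + h)
    (fun s hs => ((hν.weak ζ hζ.contDiff hζc s (hsub hs)).mono hsub).sub (by
      simpa using (hasDerivWithinAt_id s _).mul_const (∫ z, k t z ∂(ν t)))) hder
    (left_mem_Icc.2 (by linarith)) (right_mem_Icc.2 (by linarith))
  rw [add_sub_cancel_left, Real.norm_of_nonneg hh] at hI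
  have := hν.isProbabilityMeasure t ht
  -- the Euler step against the same linearization
  have hJ : ‖∫ z, ζ (z + h • V z) ∂(ν t) - ∫ z, ζ z ∂(ν t) - ∫ z, h * k t z ∂(ν t)‖
      ≤ h * (A * δ₁ + B * h * G ^ 2) := by
    have hi1 : Integrable (fun z => ζ (z + h • V z)) (ν t) :=
      (hζ.contDiff.continuous.comp
        (continuous_id.add (hVc.const_smul h))).integrable_of_hasCompactSupport
        (hasCompactSupport_of_eq_zero hS)
    have hi2 : Integrable ζ (ν t) := hζ.contDiff.continuous.integrable_of_hasCompactSupport hζc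
    have hi3 : Integrable (fun z => h * k t z) (ν t) :=
      ((hkc t ht).integrable_of_hasCompactSupport (hksupp t)).const_mul h
    have hi4 : Integrable (fun z => ζ (z + h • V z) - ζ z) (ν t) := hi1.sub hi2
    rw [← integral_sub hi1 hi2, ← integral_sub hi4 hi3]
    refine (norm_integral_le_of_norm_le_const (C := h * (A * δ₁ + B * h * G ^ 2))
      (Eventually.of_forall fun z => ?_)).trans (by simp)
    by_cases hz : 1 + ‖z‖ ≤ R
    · have h1 : ζ (z + h • V z) - ζ z - h * k t z
          = (ζ (z + h • V z) - ζ z - fderiv ℝ ζ z (h • V z))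
            + h * fderiv ℝ ζ z (V z - b t z) := by
        simp only [k, map_sub, map_smul, smul_eq_mul]
        ring
      have h2 := abs_taylor_le hζd hB hζ.norm_fderiv_sub_le z (h • V z)
      have h3 : ‖h * fderiv ℝ ζ z (V z - b t z)‖ ≤ h * (A * δ₁) := by
        rw [norm_mul, Real.norm_of_nonneg hh]
        gcongr
        exact ((fderiv ℝ ζ z).le_opNorm _).trans (mul_le_mul (hζ.norm_fderiv_le z) (hVb z)
          (norm_nonneg _) hA)
      have h4 : B * ‖h • V z‖ ^ 2 ≤ B * (h * G) ^ 2 := by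
        rw [norm_smul, Real.norm_of_nonneg hh]
        gcongr
        exact hVG z hz
      rw [h1]
      calc _ ≤ B * (h * G) ^ 2 + h * (A * δ₁) :=
            (norm_add_le _ _).trans (add_le_add (h2.trans h4) h3)
        _ = _ := by ring
    · rw [hS z (not_le.1 hz), hζ.eq_zero z (not_le.1 hz), hk0 t z (not_le.1 hz)]
      simp only [sub_zero, mul_zero, norm_zero]
      positivity
  rw [integral_const_mul] at hJ
  rw [Real.norm_eq_abs, abs_le] at hI hJ
  rw [abs_le]
  constructor <;> linarith [hI.1, hI.2, hJ.1, hJ.2]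

set_option maxHeartbeats 400000 in
/-- **Uniqueness for the linear continuity equation** with a Lipschitz velocity field. The velocity
is only Lipschitz, so that test functions transported by its flow are not smooth; they are
transported instead by the Euler steps of smooth approximations of the velocity, along which the
first derivatives stay bounded independently of the approximation. -/
theorem IsLinearSolution.eq {μ : ℝ → Measure Z} (hν : IsLinearSolution b T ν)
    (hμ : IsLinearSolution b T μ) (h0 : ν 0 = μ 0) {L C : ℝ} (hL : 0 ≤ L) (hC : 0 ≤ C)
    (hb : ∀ t ∈ Icc 0 T, ∀ z z', ‖b t z - b t z'‖ ≤ L * ‖z - z'‖)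
    (hbC : ∀ t ∈ Icc 0 T, ∀ z, ‖b t z‖ ≤ C * (1 + ‖z‖))
    (hbt : ∀ δ > 0, ∃ η > 0, ∀ s ∈ Icc 0 T, ∀ t ∈ Icc 0 T, |s - t| < η →
      ∀ z, ‖b s z - b t z‖ ≤ δ) : ∀ t ∈ Icc 0 T, ν t = μ t := by
  intro t ht
  have := hν.isProbabilityMeasure t ht
  have := hμ.isProbabilityMeasure t ht
  refine measure_ext_of_forall_integral_contDiff fun ζ hζ hζc => ?_
  obtain ⟨A, B, R, hA, hB, hR, hζb⟩ := exists_testBound hζ hζc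
  have hT : 0 ≤ T := ht.1.trans ht.2
  refine eq_of_abs_sub_le_all fun e he => ?_
  obtain ⟨c, hc⟩ : ∃ x : ℝ, x = 2 * L + 2 * (C + 1) := ⟨_, rfl⟩
  have hc0 : 0 ≤ c := by rw [hc]; positivity
  -- `A'`, `B'`, `R'` bound the derivative, its Lipschitz constant and the support of all
  -- transported test functions. The accuracy `δ₁` of the smooth velocity depends on `A'`, and `B'` depends on
  -- `δ₁` through `M`; this is not circular, because `A'` does not involve `M`.
  obtain ⟨A', hA'⟩ : ∃ x : ℝ, x = A * Real.exp (c * T) := ⟨_, rfl⟩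
  obtain ⟨R', hR'⟩ : ∃ x : ℝ, x = R * Real.exp (c * T) := ⟨_, rfl⟩
  obtain ⟨e', he'⟩ : ∃ x : ℝ, x = e / (6 * (T + 1)) := ⟨_, rfl⟩
  have he0 : 0 < e' := by rw [he']; positivity
  have hA0 : 0 ≤ A' := by rw [hA']; positivity
  obtain ⟨δ₁, hδ₁⟩ : ∃ x : ℝ, x = min 1 (e' / (A' + 1)) := ⟨_, rfl⟩
  have hδ₁0 : 0 < δ₁ := hδ₁ ▸ lt_min one_pos (by positivity)
  have hAδ : A' * δ₁ ≤ e' := by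
    calc A' * δ₁ ≤ (A' + 1) * (e' / (A' + 1)) :=
          mul_le_mul (by linarith) (hδ₁ ▸ min_le_right _ _) hδ₁0.le (by linarith)
      _ = e' := by field_simp
  obtain ⟨M, hM, hmoll⟩ := exists_smooth_approximation (Z := Z) (W := Z) hL hδ₁0
  obtain ⟨B', hB'⟩ : ∃ x : ℝ, x = Real.exp (c * T) * (B + A * M * T) := ⟨_, rfl⟩
  have hB0 : 0 ≤ B' := by rw [hB']; positivity
  obtain ⟨G, hG⟩ : ∃ x : ℝ, x = (C + 1) * R' := ⟨_, rfl⟩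
  have hR0 : 0 ≤ R' := by rw [hR']; positivity
  have hG0 : 0 ≤ G := by rw [hG]; positivity
  obtain ⟨Q, hQ⟩ : ∃ x : ℝ, x = A' + (B' * G + A' * L) := ⟨_, rfl⟩
  have hQ0 : 0 ≤ Q := by rw [hQ]; positivity
  obtain ⟨δ₂, hδ₂⟩ : ∃ x : ℝ, x = e' / (Q + 1) := ⟨_, rfl⟩
  have hδ₂0 : 0 < δ₂ := by rw [hδ₂]; positivity
  have hQδ : Q * δ₂ ≤ e' := by
    calc Q * δ₂ ≤ (Q + 1) * δ₂ := mul_le_mul_of_nonneg_right (by linarith) hδ₂0.le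
      _ = e' := by rw [hδ₂]; field_simp
  obtain ⟨η₁, hη₁, hbη⟩ := hbt δ₂ hδ₂0
  obtain ⟨η₂, hη₂, hνη⟩ := hν.continuity δ₂ hδ₂0
  obtain ⟨η₃, hη₃, hμη⟩ := hμ.continuity δ₂ hδ₂0
  -- the step size is chosen last
  obtain ⟨h₀, hh₀⟩ : ∃ x : ℝ, x = min (min η₁ (min η₂ η₃))
    (min (1 / (2 * (C + 1))) (e' / (B' * G ^ 2 + 1))) := ⟨_, rfl⟩
  have hh₀0 : 0 < h₀ := by
    rw [hh₀]
    refine lt_min (lt_min hη₁ (lt_min hη₂ hη₃)) (lt_min (by positivity) (by positivity))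
  obtain ⟨n, hn⟩ := exists_nat_gt (t / h₀)
  have hn0 : (0 : ℝ) < n := (div_nonneg ht.1 hh₀0.le).trans_lt hn
  obtain ⟨h, hh⟩ : ∃ x : ℝ, x = t / n := ⟨_, rfl⟩
  have hh0 : 0 ≤ h := hh ▸ div_nonneg ht.1 hn0.le
  have hhlt : h < h₀ := by
    rw [hh, div_lt_iff₀ hn0, mul_comm]
    exact (div_lt_iff₀ hh₀0).1 hn
  have hhη₁ : h < η₁ := (hh₀ ▸ hhlt).trans_le ((min_le_left _ _).trans (min_le_left _ _))
  have hhη₂ : h < η₂ := (hh₀ ▸ hhlt).trans_le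
    ((min_le_left _ _).trans ((min_le_right _ _).trans (min_le_left _ _)))
  have hhη₃ : h < η₃ := (hh₀ ▸ hhlt).trans_le
    ((min_le_left _ _).trans ((min_le_right _ _).trans (min_le_right _ _)))
  have hhC : h * (C + 1) ≤ 1 / 2 := by
    have h1 : h ≤ 1 / (2 * (C + 1)) :=
      (hh₀ ▸ hhlt).le.trans ((min_le_right _ _).trans (min_le_left _ _))
    calc h * (C + 1) ≤ 1 / (2 * (C + 1)) * (C + 1) := by gcongr
      _ = 1 / 2 := by field_simp
  have hhB : B' * h * G ^ 2 ≤ e' := by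
    have h1 : h ≤ e' / (B' * G ^ 2 + 1) :=
      (hh₀ ▸ hhlt).le.trans ((min_le_right _ _).trans (min_le_right _ _))
    calc B' * h * G ^ 2 = h * (B' * G ^ 2) := by ring
      _ ≤ e' / (B' * G ^ 2 + 1) * (B' * G ^ 2 + 1) := by gcongr; linarith
      _ = e' := by field_simp
  have hnh : n * h = t := by rw [hh]; field_simp
  -- `w` is a test function that has been transported backwards over a time `s`
  have step : ∀ k : ℕ, ∀ s : ℝ, 0 ≤ s → s + k * h ≤ t → ∀ w : Z → ℝ,
      TestBound w (A * Real.exp (c * s)) (Real.exp (c * s) * (B + A * M * s))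
        (R * Real.exp (c * s)) →
      |∫ z, w z ∂(ν (k * h)) - ∫ z, w z ∂(μ (k * h))| ≤ k * (2 * (h * (3 * e'))) := by
    intro k
    induction k with
    | zero => intro s _ _ w _; simp [h0]
    | succ k ih =>
      intro s hs hsk w hw
      push_cast at hsk ⊢
      have hkh : 0 ≤ k * h := by positivity
      have hr : k * h ∈ Icc 0 T := ⟨hkh, by linarith [ht.2]⟩
      have hrh : k * h + h ∈ Icc 0 T := ⟨by positivity, by linarith [ht.2]⟩
      obtain ⟨V, hV, hVb, hVL, hVM⟩ := hmoll (b (k * h)) (hb _ hr)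
      have hVC : ∀ z, ‖V z‖ ≤ (C + 1) * (1 + ‖z‖) := fun z => by
        calc ‖V z‖ = ‖(V z - b (k * h) z) + b (k * h) z‖ := by simp
          _ ≤ δ₁ + C * (1 + ‖z‖) := (norm_add_le _ _).trans (add_le_add (hVb z) (hbC _ hr z))
          _ ≤ 1 + C * (1 + ‖z‖) := by gcongr; rw [hδ₁]; exact min_le_left _ _
          _ ≤ _ := by linarith [norm_nonneg z]
      have hw' := hw.comp_eulerStep_exp hs hA hB hR hM hL hc hV hVL hVM hVC (by positivity) hh0 hhC
      have hshT : s + h ≤ T := by linarith [ht.2]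
      have mono : ∀ r, 0 ≤ r → r ≤ T → ∀ w : Z → ℝ,
          TestBound w (A * Real.exp (c * r)) (Real.exp (c * r) * (B + A * M * r))
            (R * Real.exp (c * r)) → TestBound w A' B' R' := fun r hr hrT w hw => by
        have he : Real.exp (c * r) ≤ Real.exp (c * T) :=
          Real.exp_le_exp.2 (mul_le_mul_of_nonneg_left hrT hc0)
        exact hw.mono (by rw [hA']; gcongr) (by rw [hB']; gcongr) (by rw [hR']; gcongr)
      have hwT := mono s hs (by linarith) w hw
      have hwT' := mono (s + h) (by positivity) hshT _ hw'
      have one : ∀ κ : ℝ → Measure Z, IsLinearSolution b T κ → (∀ s ∈ Icc 0 T, ∀ t ∈ Icc 0 T,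
          |s - t| ≤ h → ∀ (k : Z → ℝ) (L : ℝ), 0 ≤ L → HasCompactSupport k →
          (∀ z z', ‖k z - k z'‖ ≤ L * ‖z - z'‖) →
          |∫ z, k z ∂(κ s) - ∫ z, k z ∂(κ t)| ≤ L * δ₂) →
          |∫ z, w z ∂(κ (k * h + h)) - ∫ z, w (z + h • V z) ∂(κ (k * h))| ≤ h * (3 * e') := by
        intro κ hκ hκη
        have hclose : ∀ r ∈ Icc (k * h) (k * h + h), r ∈ Icc 0 T ∧ |r - k * h| ≤ h := fun r hr' =>
          ⟨⟨hr.1.trans hr'.1, hr'.2.trans hrh.2⟩, by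
            rw [abs_of_nonneg (by linarith [hr'.1])]; linarith [hr'.2]⟩
        refine (hκ.abs_eulerStep_le hb hwT hA0 hB0 hL hr hh0 hrh hG0 hV.continuous
          hwT'.eq_zero (fun z hz => (hVC z).trans (by rw [hG]; gcongr))
          (fun z hz => (hbC _ hr z).trans (by rw [hG]; gcongr; linarith)) hδ₁0.le hVb
          (fun r hr' z => hbη r (hclose r hr').1 _ hr ((hclose r hr').2.trans_lt hhη₁) z)
          (fun r hr' => hκη r (hclose r hr').1 _ hr (hclose r hr').2)).trans ?_
        refine mul_le_mul_of_nonneg_left ?_ hh0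
        rw [← hQ]
        linarith
      have h1 := one ν hν fun s hs t ht hst => hνη s hs t ht (hst.trans_lt hhη₂)
      have h2 := one μ hμ fun s hs t ht hst => hμη s hs t ht (hst.trans_lt hhη₃)
      have h3 := ih (s + h) (by positivity) (by linarith) _ hw'
      have hkk : ((k : ℝ) + 1) * h = k * h + h := by ring
      rw [hkk]
      rw [abs_le] at h1 h2 h3 ⊢
      constructor <;> linarith [h1.1, h1.2, h2.1, h2.2, h3.1, h3.2]
  have hfin := step n 0 le_rfl (by rw [zero_add, hnh]) ζ (by simpa using hζb)
  rw [hnh] at hfin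
  refine hfin.trans ?_
  calc (n : ℝ) * (2 * (h * (3 * e'))) = n * h * (6 * e') := by ring
    _ = t * (6 * e') := by rw [hnh]
    _ ≤ (T + 1) * (6 * e') := by gcongr; linarith [ht.2]
    _ = e := by rw [he']; field_simp

end LinearUniqueness

/-! ### Wasserstein curves and transport of the initial measure -/

section Transport
open scoped NNReal BoundedContinuousFunction

variable {Z : Type*} [NormedAddCommGroup Z] [MeasurableSpace Z] [BorelSpace Z]
  [SecondCountableTopology Z]
variable {W : Type*} [NormedAddCommGroup W] [NormedSpace ℝ W]

/-- The easy half of Kantorovich duality. -/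
theorem norm_integral_sub_le_of_W1_lt {μ ν : Measure Z} {k : Z → W} {L δ : ℝ} (hL : 0 ≤ L)
    (hk : ∀ z z', ‖k z - k z'‖ ≤ L * ‖z - z'‖) (hμ : Integrable k μ) (hν : Integrable k ν)
    (hW : W1 μ ν < ENNReal.ofReal δ) : ‖∫ z, k z ∂μ - ∫ z, k z ∂ν‖ ≤ L * δ := by
  have hδ : 0 < δ := by
    by_contra! hδ
    rw [ENNReal.ofReal_of_nonpos hδ] at hW
    exact not_lt_zero hW
  have hk' : Continuous k := (lipschitzWith_of_norm_sub_le hk).continuous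
  simp only [W1, iInf_lt_iff] at hW
  obtain ⟨π, ⟨rfl, rfl⟩, hπ⟩ := hW
  have h1 : Integrable (fun z : Z × Z => k z.1) π := hμ.comp_measurable measurable_fst
  have h2 : Integrable (fun z : Z × Z => k z.2) π := hν.comp_measurable measurable_snd
  rw [integral_map measurable_fst.aemeasurable hk'.aestronglyMeasurable,
    integral_map measurable_snd.aemeasurable hk'.aestronglyMeasurable, ← integral_sub h1 h2]
  have h3 : ‖∫ z : Z × Z, (k z.1 - k z.2) ∂π‖ₑ ≤ ENNReal.ofReal (L * δ) := by
    calc _ ≤ ∫⁻ z : Z × Z, ‖k z.1 - k z.2‖ₑ ∂π := enorm_integral_le_lintegral_enorm _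
      _ ≤ ∫⁻ z : Z × Z, ENNReal.ofReal L * edist z.1 z.2 ∂π := by
          refine lintegral_mono fun z => ?_
          rw [← ofReal_norm, edist_dist, ← ENNReal.ofReal_mul hL, dist_eq_norm]
          exact ENNReal.ofReal_le_ofReal (hk _ _)
      _ = ENNReal.ofReal L * ∫⁻ z : Z × Z, edist z.1 z.2 ∂π :=
          lintegral_const_mul' _ _ ENNReal.ofReal_ne_top
      _ ≤ ENNReal.ofReal L * ENNReal.ofReal δ := by gcongr
      _ = _ := (ENNReal.ofReal_mul hL).symm
  rw [← ofReal_norm] at h3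
  exact (ENNReal.ofReal_le_ofReal_iff (by positivity)).1 h3

omit [NormedSpace ℝ W] in
theorem IsContinuousCurve.integrable {S : Set ℝ} {ν : ℝ → Measure Z} (hν : IsContinuousCurve S ν)
    {k : Z → W} {L : ℝ} (hk : ∀ z z', ‖k z - k z'‖ ≤ L * ‖z - z'‖) {t : ℝ} (ht : t ∈ S) :
    Integrable k (ν t) := by
  have := hν.isProbabilityMeasure t ht
  exact integrable_comp_of_lipschitz hk
    ((integrable_norm_iff aestronglyMeasurable_id).1 (hν.finite_moment t ht))

/-- A continuous curve for the Wasserstein distance is uniformly continuous on compact intervals,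
uniformly when tested against Lipschitz functions. -/
theorem IsContinuousCurve.exists_forall_norm_integral_sub_le {T : ℝ} {ν : ℝ → Measure Z}
    (hν : IsContinuousCurve (Icc 0 T) ν) (W : Type*) [NormedAddCommGroup W] [NormedSpace ℝ W]
    {δ : ℝ} (hδ : 0 < δ) : ∃ η > 0, ∀ s ∈ Icc 0 T, ∀ t ∈ Icc 0 T, |s - t| < η →
      ∀ (k : Z → W) (L : ℝ), 0 ≤ L → (∀ z z', ‖k z - k z'‖ ≤ L * ‖z - z'‖) →
        ‖∫ z, k z ∂(ν s) - ∫ z, k z ∂(ν t)‖ ≤ L * δ := by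
  have h1 : ∀ t : Icc (0 : ℝ) T, ∃ r > 0, ∀ s ∈ Icc 0 T, dist s t < r →
      W1 (ν s) (ν t) < ENNReal.ofReal (δ / 2) := by
    intro t
    have h := (hν.continuous t t.2).eventually_lt_const
      (ENNReal.ofReal_pos.2 (half_pos hδ))
    obtain ⟨r, hr, h⟩ := Metric.mem_nhdsWithin_iff.1 h
    exact ⟨r, hr, fun s hs hst => h ⟨hst, hs⟩⟩
  choose r hr h1 using h1
  obtain ⟨η, hη, hcov⟩ := lebesgue_number_lemma_of_metric (isCompact_Icc (a := (0 : ℝ)) (b := T))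
    (c := fun t : Icc (0 : ℝ) T => Metric.ball (t : ℝ) (r t)) (fun t => Metric.isOpen_ball)
    (fun t ht => mem_iUnion.2 ⟨⟨t, ht⟩, Metric.mem_ball_self (hr _)⟩)
  refine ⟨η, hη, fun s hs t ht hst k L hL hk => ?_⟩
  obtain ⟨τ, hτ⟩ := hcov t ht
  have h2 := norm_integral_sub_le_of_W1_lt hL hk (hν.integrable hk hs) (hν.integrable hk τ.2)
    (h1 τ s hs (hτ (by rwa [Metric.mem_ball, Real.dist_eq])))
  have h3 := norm_integral_sub_le_of_W1_lt hL hk (hν.integrable hk ht) (hν.integrable hk τ.2)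
    (h1 τ t ht (hτ (Metric.mem_ball_self hη)))
  calc _ = ‖(∫ z, k z ∂(ν s) - ∫ z, k z ∂(ν τ)) - (∫ z, k z ∂(ν t) - ∫ z, k z ∂(ν τ))‖ := by
        rw [sub_sub_sub_cancel_right]
    _ ≤ L * (δ / 2) + L * (δ / 2) := (norm_sub_le _ _).trans (add_le_add h2 h3)
    _ = _ := by ring

theorem IsContinuousCurve.continuousOn_integral {T : ℝ} {ν : ℝ → Measure Z}
    (hν : IsContinuousCurve (Icc 0 T) ν) {k : Z → W} {L : ℝ} (hL : 0 ≤ L)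
    (hk : ∀ z z', ‖k z - k z'‖ ≤ L * ‖z - z'‖) :
    ContinuousOn (fun t => ∫ z, k z ∂(ν t)) (Icc 0 T) := by
  rw [Metric.continuousOn_iff]
  intro t ht e he
  obtain ⟨η, hη, h⟩ := hν.exists_forall_norm_integral_sub_le W (δ := e / (L + 1)) (by positivity)
  refine ⟨η, hη, fun s hs hst => ?_⟩
  rw [dist_eq_norm]
  refine (h s hs t ht (by rwa [Real.dist_eq] at hst) k L hL hk).trans_lt ?_
  rw [mul_div_assoc', div_lt_iff₀ (by positivity)]
  linarith

variable [NormedSpace ℝ Z] {μ₀ : Measure Z} [IsProbabilityMeasure μ₀]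

theorem isContinuousCurve_map_displace (hμ : Integrable (fun z => ‖z‖) μ₀) {u : ℝ → Z →ᵇ Z}
    (hu : Continuous u) (S : Set ℝ) :
    IsContinuousCurve S fun t => μ₀.map (displace (u t)) := by
  have hm : ∀ t, Measurable (displace (u t)) := fun t => (continuous_displace (u t)).measurable
  refine ⟨fun t _ => Measure.isProbabilityMeasure_map (hm t).aemeasurable, fun t _ => ?_,
    fun t _ => ?_⟩
  · rw [integrable_map_measure continuous_norm.aestronglyMeasurable (hm t).aemeasurable]
    exact (integrable_displace hμ (u t)).norm
  · set c : ℝ := ∫ z, (1 + ‖z‖) ∂μ₀ with hc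
    have hci : Integrable (fun z : Z => 1 + ‖z‖) μ₀ := (integrable_const 1).add hμ
    have hle : ∀ s, W1 (μ₀.map (displace (u s))) (μ₀.map (displace (u t)))
        ≤ ENNReal.ofReal (c * ‖u s - u t‖) := by
      intro s
      have hp : Measurable fun z => (displace (u s) z, displace (u t) z) := (hm s).prodMk (hm t)
      have h1 : W1 (μ₀.map (displace (u s))) (μ₀.map (displace (u t)))
          ≤ ∫⁻ z, edist z.1 z.2 ∂(μ₀.map fun z => (displace (u s) z, displace (u t) z)) :=
        iInf₂_le _ ⟨by rw [Measure.map_map measurable_fst hp]; rfl,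
          by rw [Measure.map_map measurable_snd hp]; rfl⟩
      refine h1.trans ?_
      rw [lintegral_map (by fun_prop) hp, hc, ← integral_mul_const,
        ofReal_integral_eq_lintegral_ofReal (hci.mul_const _)
          (Eventually.of_forall fun z => by positivity)]
      refine lintegral_mono fun z => ?_
      rw [edist_dist, dist_eq_norm]
      exact ENNReal.ofReal_le_ofReal (norm_displace_sub_le _ _ z)
    refine tendsto_of_tendsto_of_tendsto_of_le_of_le tendsto_const_nhds ?_
      (fun _ => zero_le) hle
    have h2 : Tendsto (fun s => ENNReal.ofReal (c * ‖u s - u t‖)) (𝓝 t)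
        (𝓝 (ENNReal.ofReal (c * ‖u t - u t‖))) :=
      (ENNReal.continuous_ofReal.comp (by fun_prop)).tendsto t
    rw [sub_self, norm_zero, mul_zero, ENNReal.ofReal_zero] at h2
    exact h2.mono_left nhdsWithin_le_nhds

variable {H : Type*} [NormedAddCommGroup H] {b : H → Z → Z} {f : Z → H} {K : ℝ}

omit [SecondCountableTopology Z] in
/-- The image of a measure under a flow solves the linear continuity equation weakly. -/
theorem hasDerivAt_integral_map_displace [ProperSpace Z] {h : LipschitzInteraction b f K}
    {m : ℝ → H} (hm : Continuous m) {u : ℝ → Z →ᵇ Z}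
    (hu : ∀ t, HasDerivAt u (displacementVelocity h (m t) (u t)) t) {ζ : Z → ℝ}
    (hζ : ContDiff ℝ ∞ ζ) (hζc : HasCompactSupport ζ) (t : ℝ) :
    HasDerivAt (fun s => ∫ z, ζ z ∂(μ₀.map (displace (u s))))
      (∫ z, fderiv ℝ ζ z (b (m t) z) ∂(μ₀.map (displace (u t)))) t := by
  obtain ⟨A, B, R, hA, hB, hR, hb⟩ := exists_testBound hζ hζc
  have hK := h.nonneg
  have hbc : ∀ t, Continuous (b (m t)) := fun t => h.continuous_velocity (m t)
  have hDc : Continuous (fderiv ℝ ζ) := hζ.continuous_fderiv (by simp)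
  have hmeas : ∀ t, AEMeasurable (displace (u t)) μ₀ := fun t =>
    (continuous_displace (u t)).measurable.aemeasurable
  obtain ⟨M, hM⟩ := (isCompact_closedBall t 1).exists_bound_of_continuousOn hm.continuousOn
  have h1 : ∀ s, ∫ z, ζ z ∂(μ₀.map (displace (u s))) = ∫ z, ζ (displace (u s) z) ∂μ₀ :=
    fun s => integral_map (hmeas s) hζ.continuous.aestronglyMeasurable
  rw [integral_map (hmeas t) (hDc.clm_apply (hbc t)).aestronglyMeasurable]
  simp only [h1]
  have hcomp : ∀ s, Continuous fun z => ζ (displace (u s) z) := fun s =>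
    hζ.continuous.comp (continuous_displace (u s))
  obtain ⟨C, hC⟩ := hζc.exists_bound_of_continuous hζ.continuous
  refine (hasDerivAt_integral_of_dominated_loc_of_deriv_le (s := Metric.ball t 1)
    (F := fun s z => ζ (displace (u s) z))
    (F' := fun s z => fderiv ℝ ζ (displace (u s) z) (b (m s) (displace (u s) z)))
    (bound := fun _ => A * (‖b 0 0‖ + K * (M + R))) (Metric.ball_mem_nhds t one_pos)
    (Eventually.of_forall fun s => (hcomp s).aestronglyMeasurable)
    (Integrable.mono' (integrable_const C) (hcomp t).aestronglyMeasurable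
      (Eventually.of_forall fun z => hC _))
    ((hDc.clm_apply (hbc t)).comp (continuous_displace (u t))).aestronglyMeasurable
    (Eventually.of_forall fun z s hs => ?_) (integrable_const _)
    (Eventually.of_forall fun z s _ => ?_)).2
  · have hMs := hM s (Metric.ball_subset_closedBall hs)
    have hM0 : 0 ≤ M := (norm_nonneg _).trans hMs
    by_cases hz : R < 1 + ‖displace (u s) z‖
    · rw [hb.fderiv_eq_zero hz]
      simp only [zero_apply, norm_zero]
      positivity
    · refine (ContinuousLinearMap.le_opNorm _ _).trans ?_
      refine mul_le_mul (hb.norm_fderiv_le _) ((h.norm_velocity_le _ _).trans ?_) (norm_nonneg _) hA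
      gcongr
      linarith
  · exact ((hζ.differentiable (by simp) _).hasFDerivAt).comp_hasDerivAt s
      (hasDerivAt_displace (hu s) z)

end Transport

/-! ### The mean-field equation for Lipschitz data -/

section MeanFieldGlobal
open scoped NNReal BoundedContinuousFunction

variable {E : Type v} [NormedAddCommGroup E] [InnerProductSpace ℝ E] [FiniteDimensional ℝ E]
  [MeasurableSpace E] [BorelSpace E]
variable {H : Type u} [NormedAddCommGroup H] [InnerProductSpace ℝ H]
variable {O : E → E} {F : E → H} {a : H → E → E} {γ K : ℝ} {μ₀ : Measure (E × E)}

omit [FiniteDimensional ℝ E] [BorelSpace E] in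
theorem IsCharacteristic.mono {S S' : Set ℝ} {Ω : Type w} [MeasurableSpace Ω] {Pr : Measure Ω}
    {Y₀ : Ω → E × E} {Y : ℝ → Ω → E × E} (h : IsCharacteristic O F a γ Pr Y₀ S Y) (hS : S' ⊆ S) :
    IsCharacteristic O F a γ Pr Y₀ S' Y :=
  ⟨fun t ht => h.aemeasurable t (hS ht), h.init, by
    filter_upwards [h.deriv] with x hx t ht using (hx t (hS ht)).mono hS⟩

/-- The Lipschitz constants of the data of the mean-field system; `O` is also bounded by `K`. -/
structure LipschitzData (O : E → E) (F : E → H) (a : H → E → E) (K : ℝ) : Prop where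
  nonneg : 0 ≤ K
  norm_orth_le : ∀ p, ‖O p‖ ≤ K
  orth : ∀ p p', ‖O p - O p'‖ ≤ K * ‖p - p'‖
  feature : ∀ θ θ', ‖F θ - F θ'‖ ≤ K * ‖θ - θ'‖
  force : ∀ m m' θ θ', ‖a m θ - a m' θ'‖ ≤ K * (‖m - m'‖ + ‖θ - θ'‖)

omit [FiniteDimensional ℝ E] [MeasurableSpace E] [BorelSpace E] [InnerProductSpace ℝ H] in
theorem LipschitzData.lipschitzInteraction (h : LipschitzData O F a K) (hγ : 0 < γ) :
    LipschitzInteraction (drift O a γ) (fun z : E × E => F z.1) (K + γ * (K + 1)) := by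
  have hK := h.nonneg
  have hc : 0 ≤ γ * (K + 1) := by positivity
  refine ⟨by positivity, fun m m' z z' => ?_, fun z z' => (h.feature _ _).trans ?_⟩
  · have h1 : ‖z.1 - z'.1‖ ≤ ‖z - z'‖ := norm_fst_le (z - z')
    have h2 : ‖z.2 - z'.2‖ ≤ ‖z - z'‖ := norm_snd_le (z - z')
    have h0 : 0 ≤ ‖m - m'‖ := norm_nonneg _
    have h3 : 0 ≤ ‖z - z'‖ := norm_nonneg _
    have h4 := mul_nonneg hK h0
    have h5 := mul_nonneg hK h3
    refine (Prod.norm_def _).le.trans (max_le ?_ ?_)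
    · have : (drift O a γ m z - drift O a γ m' z').1 = -(O z.2 - O z'.2) := by
        simp [drift]; abel
      rw [this, norm_neg]
      calc _ ≤ K * ‖z - z'‖ := (h.orth _ _).trans (by gcongr)
        _ ≤ _ := by nlinarith
    · have : (drift O a γ m z - drift O a γ m' z').2
          = γ • ((a m z.1 - a m' z'.1) - (z.2 - z'.2)) := by
        simp only [drift, Prod.snd_sub, ← smul_sub]
        congr 1
        abel
      rw [this, norm_smul, Real.norm_of_nonneg hγ.le]
      calc _ ≤ γ * (K * (‖m - m'‖ + ‖z - z'‖) + ‖z - z'‖) := by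
            gcongr
            refine (norm_sub_le _ _).trans (add_le_add ((h.force _ _ _ _).trans ?_) h2)
            gcongr
        _ ≤ _ := by nlinarith [mul_nonneg hγ.le h0, mul_nonneg hγ.le h3]
  · gcongr
    · linarith
    · exact norm_fst_le (z - z')

variable [IsProbabilityMeasure μ₀] {u : ℝ → (E × E) →ᵇ (E × E)}
  {hI : LipschitzInteraction (drift O a γ) (fun z : E × E => F z.1) K}

omit [IsProbabilityMeasure μ₀] in
theorem integral_feature_map_displace
    (hI : LipschitzInteraction (drift O a γ) (fun z : E × E => F z.1) K)
    (u : (E × E) →ᵇ (E × E)) :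
    ∫ y, F y.1 ∂(μ₀.map (displace u)) = displacedMean (fun z : E × E => F z.1) μ₀ u :=
  integral_map (continuous_displace u).measurable.aemeasurable
    hI.continuous_feature.aestronglyMeasurable

theorem continuous_displacedMean
    (hI : LipschitzInteraction (drift O a γ) (fun z : E × E => F z.1) K)
    (hμ : Integrable (fun z => ‖z‖) μ₀) :
    Continuous (displacedMean (fun z : E × E => F z.1) μ₀) :=
  (lipschitzWith_of_norm_sub_le fun u u' => norm_displacedMean_sub_le hI hμ u u').continuous

/-- The image of the initial measure under the mean-field flow is a weak solution. -/
theorem isWeakSolution_map_displace (hμ : Integrable (fun z => ‖z‖) μ₀) (hu0 : u 0 = 0)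
    (hu : ∀ t, HasDerivAt u (displacementVelocity hI
      (displacedMean (fun z : E × E => F z.1) μ₀ (u t)) (u t)) t) (S : Set ℝ) :
    IsWeakSolution O F a γ μ₀ S fun t => μ₀.map (displace (u t)) := by
  have huc : Continuous u := continuous_iff_continuousAt.2 fun t => (hu t).continuousAt
  refine ⟨isContinuousCurve_map_displace hμ huc S, ?_, fun ζ hζ hζc t _ => ?_⟩
  · have : displace (u 0) = id := by
      funext z
      simp [hu0]
    simp [this]
  · rw [integral_feature_map_displace hI]
    exact (hasDerivAt_integral_map_displace
      ((continuous_displacedMean hI hμ).comp huc) hu hζ hζc t).hasDerivWithinAt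

omit [IsProbabilityMeasure μ₀] in
/-- A weak solution solves the linear equation in which its own feature mean is prescribed. -/
theorem IsContinuousCurve.isLinearSolution {T : ℝ} {ν : ℝ → Measure (E × E)} {b : ℝ → E × E → E × E}
    (hν : IsContinuousCurve (Icc 0 T) ν)
    (hw : ∀ ζ : E × E → ℝ, ContDiff ℝ ∞ ζ → HasCompactSupport ζ → ∀ t ∈ Icc 0 T,
      HasDerivWithinAt (fun s => ∫ z, ζ z ∂(ν s)) (∫ z, fderiv ℝ ζ z (b t z) ∂(ν t)) (Icc 0 T) t) :
    IsLinearSolution b T ν := by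
  refine ⟨hν.isProbabilityMeasure, fun δ hδ => ?_, hw⟩
  obtain ⟨η, hη, h⟩ := hν.exists_forall_norm_integral_sub_le ℝ hδ
  exact ⟨η, hη, fun s hs t ht hst k L hL _ hk => h s hs t ht hst k L hL hk⟩

/-- **Uniqueness of weak solutions.** With its feature mean frozen, a weak solution is the image of
the initial measure under the flow of a linear problem; hence that flow is self-consistent, and it
is the mean-field flow. -/
theorem IsWeakSolution.eq_map_displace (hμ : Integrable (fun z => ‖z‖) μ₀) (hu0 : u 0 = 0)
    (hu : ∀ t, HasDerivAt u (displacementVelocity hI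
      (displacedMean (fun z : E × E => F z.1) μ₀ (u t)) (u t)) t) {T : ℝ}
    {ν : ℝ → Measure (E × E)} (hν : IsWeakSolution O F a γ μ₀ (Icc 0 T) ν) :
    ∀ t ∈ Icc 0 T, ν t = μ₀.map (displace (u t)) := by
  intro t₀ ht₀
  have hT : 0 ≤ T := ht₀.1.trans ht₀.2
  have hK := hI.nonneg
  have hmc : ContinuousOn (fun t => ∫ y, F y.1 ∂(ν t)) (Icc 0 T) :=
    hν.curve.continuousOn_integral hK hI.feature
  -- the frozen feature mean, extended to all times by constants
  let m : ℝ → H := IccExtend hT fun t : Icc (0 : ℝ) T => ∫ y, F y.1 ∂(ν t)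
  have hm : Continuous m := (continuousOn_iff_continuous_domRestrict.1 hmc).Icc_extend'
  have hmeq : ∀ t ∈ Icc 0 T, m t = ∫ y, F y.1 ∂(ν t) := fun t ht => IccExtend_of_mem hT _ ht
  obtain ⟨M, hM⟩ := isCompact_Icc.exists_bound_of_continuousOn hmc
  have hmM : ∀ t, ‖m t‖ ≤ M := fun t => hM _ (projIcc 0 T hT t).2
  have hM0 : 0 ≤ M := (norm_nonneg _).trans (hmM 0)
  obtain ⟨u', hu0', hu'⟩ := hI.exists_flow hm hmM
  have huc' : Continuous u' := continuous_iff_continuousAt.2 fun t => (hu' t).continuousAt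
  have hlin : IsLinearSolution (fun t => drift O a γ (m t)) T ν :=
    hν.curve.isLinearSolution fun ζ hζ hζc t ht => by
      rw [hmeq t ht]
      exact hν.weak ζ hζ hζc t ht
  have hlin' : IsLinearSolution (fun t => drift O a γ (m t)) T
      fun t => μ₀.map (displace (u' t)) :=
    (isContinuousCurve_map_displace hμ huc' _).isLinearSolution fun ζ hζ hζc t ht =>
      (hasDerivAt_integral_map_displace hm hu' hζ hζc t).hasDerivWithinAt
  have hinit : displace (u' 0) = id := by
    funext z
    simp [hu0']
  have hmu : UniformContinuousOn m (Icc 0 T) :=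
    isCompact_Icc.uniformContinuousOn_of_continuous hm.continuousOn
  have heq := hlin.eq hlin' (by simp [hinit, hν.init]) hK
    (C := ‖drift O a γ 0 0‖ + K * M + K) (by positivity)
    (fun t _ z z' => by simpa using hI.velocity (m t) (m t) z z')
    (fun t _ z => (hI.norm_velocity_le (m t) z).trans (by
      have h1 := mul_le_mul_of_nonneg_left (hmM t) hK
      have h2 := mul_nonneg (norm_nonneg z) (norm_nonneg (drift O a γ 0 0))
      have h3 := mul_nonneg (norm_nonneg z) (mul_nonneg hK hM0)
      linarith))
    (fun δ hδ => by
      obtain ⟨η, hη, h⟩ := Metric.uniformContinuousOn_iff.1 hmu (δ / (K + 1)) (by positivity)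
      refine ⟨η, hη, fun s hs t ht hst z => ?_⟩
      have h1 := hI.velocity (m s) (m t) z z
      have h2 := h s hs t ht (by rwa [Real.dist_eq])
      rw [dist_eq_norm, lt_div_iff₀ (by positivity)] at h2
      simp only [sub_self, norm_zero, add_zero] at h1
      nlinarith [norm_nonneg (m s - m t)])
  have hself : ∀ t ∈ Icc 0 T, m t = displacedMean (fun z : E × E => F z.1) μ₀ (u' t) := by
    intro t ht
    rw [hmeq t ht, heq t ht, integral_feature_map_displace hI]
  rw [heq t₀ ht₀, hI.flow_eq_meanField_flow hμ hu0 hu hu0' (fun t _ => hu' t) hself t₀ ht₀]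

section Characteristics

variable {Ω : Type w} [MeasurableSpace Ω] {Pr : Measure Ω} [IsProbabilityMeasure Pr]
  {Y₀ : Ω → E × E}

omit [IsProbabilityMeasure Pr] in
theorem integral_feature_displace_comp
    (hI : LipschitzInteraction (drift O a γ) (fun z : E × E => F z.1) K)
    (hY₀ : Measurable Y₀) (hlaw : Pr.map Y₀ = μ₀) (u : (E × E) →ᵇ (E × E)) :
    ∫ x, F (displace u (Y₀ x)).1 ∂Pr = displacedMean (fun z : E × E => F z.1) μ₀ u := by
  subst hlaw
  exact (integral_map hY₀.aemeasurable (hI.continuous_feature.comp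
    (continuous_displace u)).aestronglyMeasurable).symm

omit [FiniteDimensional ℝ E] [BorelSpace E] [IsProbabilityMeasure Pr] in
/-- Along almost every characteristic, the first component moves with speed at most `C`. -/
theorem IsCharacteristic.norm_fst_sub_le {T C : ℝ} {Y : ℝ → Ω → E × E}
    (hY : IsCharacteristic O F a γ Pr Y₀ (Icc 0 T) Y) (hO : ∀ p, ‖O p‖ ≤ C) :
    ∀ᵐ x ∂Pr, ∀ s ∈ Icc 0 T, ∀ t ∈ Icc 0 T, ‖(Y t x).1 - (Y s x).1‖ ≤ C * |t - s| := by
  filter_upwards [hY.deriv] with x hx s hs t ht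
  refine (convex_Icc 0 T).norm_image_sub_le_of_norm_hasDerivWithin_le
    (f := fun t => (Y t x).1) (f' := fun t => -O (Y t x).2) (fun r hr => ?_)
    (fun r _ => by rw [norm_neg]; exact hO _) hs ht
  exact (hx r hr).fst

/-- The characteristics are unique: the mean of the feature along any of them is continuous, because
`O` is bounded; so they are the trajectories of the flow of a linear problem, which is
self-consistent. -/
theorem IsCharacteristic.ae_eq_displace (hμ : Integrable (fun z => ‖z‖) μ₀) (hu0 : u 0 = 0)
    (hu : ∀ t, HasDerivAt u (displacementVelocity hI
      (displacedMean (fun z : E × E => F z.1) μ₀ (u t)) (u t)) t) {C : ℝ} (hO : ∀ p, ‖O p‖ ≤ C)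
    (hY₀ : Measurable Y₀) (hlaw : Pr.map Y₀ = μ₀) {T : ℝ} {Y : ℝ → Ω → E × E}
    (hY : IsCharacteristic O F a γ Pr Y₀ (Icc 0 T) Y) :
    ∀ᵐ x ∂Pr, ∀ t ∈ Icc 0 T, Y t x = displace (u t) (Y₀ x) := by
  rcases lt_or_ge T 0 with hT | hT
  · exact Eventually.of_forall fun x t ht => absurd (ht.1.trans ht.2) (not_le.2 hT)
  have hK := hI.nonneg
  have hC : 0 ≤ C := (norm_nonneg _).trans (hO 0)
  have h0 : (0 : ℝ) ∈ Icc 0 T := left_mem_Icc.2 hT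
  have hspeed := hY.norm_fst_sub_le hO
  have hY₀i : Integrable Y₀ Pr := by
    rw [← hlaw, integrable_map_measure continuous_norm.aestronglyMeasurable hY₀.aemeasurable] at hμ
    exact (integrable_norm_iff hY₀.aestronglyMeasurable).1 hμ
  have hint1 : ∀ t ∈ Icc 0 T, Integrable (fun x => (Y t x).1) Pr := by
    intro t ht
    refine Integrable.mono' (g := fun x => ‖Y₀ x‖ + C * |t - 0|)
      (hY₀i.norm.add (integrable_const _))
      (measurable_fst.comp_aemeasurable (hY.aemeasurable t ht)).aestronglyMeasurable ?_
    filter_upwards [hspeed, hY.init] with x hx hx0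
    have h1 := hx 0 h0 t ht
    rw [hx0] at h1
    calc ‖(Y t x).1‖ = ‖(Y₀ x).1 + ((Y t x).1 - (Y₀ x).1)‖ := by simp
      _ ≤ _ := (norm_add_le _ _).trans (add_le_add (norm_fst_le _) h1)
  have hF : ∀ θ θ', ‖F θ - F θ'‖ ≤ K * ‖θ - θ'‖ := fun θ θ' => by
    simpa using hI.feature (θ, 0) (θ', 0)
  have hint : ∀ t ∈ Icc 0 T, Integrable (fun x => F (Y t x).1) Pr := fun t ht =>
    integrable_comp_of_lipschitz hF (hint1 t ht)
  have hmc : ContinuousOn (fun t => ∫ x, F (Y t x).1 ∂Pr) (Icc 0 T) := by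
    rw [Metric.continuousOn_iff]
    intro t ht e he
    refine ⟨e / (K * C + 1), by positivity, fun s hs hst => ?_⟩
    rw [dist_eq_norm, ← integral_sub (hint s hs) (hint t ht)]
    have h1 : ‖∫ x, (F (Y s x).1 - F (Y t x).1) ∂Pr‖ ≤ K * (C * |s - t|) := by
      refine (norm_integral_le_of_norm_le_const (C := K * (C * |s - t|)) ?_).trans (by simp)
      filter_upwards [hspeed] with x hx
      exact (hF _ _).trans (mul_le_mul_of_nonneg_left (hx t ht s hs) hK)
    rw [Real.dist_eq, lt_div_iff₀ (by positivity)] at hst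
    have h2 := abs_nonneg (s - t)
    have h3 : 0 ≤ K * C * |s - t| := by positivity
    rcases h2.eq_or_lt with h2 | h2
    · rw [← h2] at h1
      linarith
    · linarith
  let m : ℝ → H := IccExtend hT fun t : Icc (0 : ℝ) T => ∫ x, F (Y t x).1 ∂Pr
  have hm : Continuous m := (continuousOn_iff_continuous_domRestrict.1 hmc).Icc_extend'
  have hmeq : ∀ t ∈ Icc 0 T, m t = ∫ x, F (Y t x).1 ∂Pr := fun t ht => IccExtend_of_mem hT _ ht
  obtain ⟨M, hM⟩ := isCompact_Icc.exists_bound_of_continuousOn hmc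
  obtain ⟨u', hu0', hu'⟩ := hI.exists_flow hm fun t => hM _ (projIcc 0 T hT t).2
  have hYu' : ∀ᵐ x ∂Pr, ∀ t ∈ Icc 0 T, Y t x = displace (u' t) (Y₀ x) := by
    filter_upwards [hY.deriv, hY.init] with x hx hx0
    have hd : ∀ t ∈ Icc 0 T,
        HasDerivWithinAt (fun s => Y s x) (drift O a γ (m t) (Y t x)) (Icc 0 T) t := by
      intro t ht
      rw [hmeq t ht]
      exact hx t ht
    have hd' : ∀ t, HasDerivAt (fun s => displace (u' s) (Y₀ x))
        (drift O a γ (m t) (displace (u' t) (Y₀ x))) t := fun t => hasDerivAt_displace (hu' t) _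
    refine ODE_solution_unique_of_mem_Icc_right (s := fun _ => univ) (K := K.toNNReal)
      (v := fun t => drift O a γ (m t))
      (fun t _ => (lipschitzWith_of_norm_sub_le fun z z' => by
        simpa using hI.velocity (m t) (m t) z z').lipschitzOnWith)
      (fun t ht => (hd t ht).continuousWithinAt)
      (fun t ht => (hd t (Ico_subset_Icc_self ht)).mono_of_mem_nhdsWithin
        (Icc_mem_nhdsGE_of_mem ht))
      (fun _ _ => mem_univ _)
      (fun t _ => (hd' t).continuousAt.continuousWithinAt)
      (fun t _ => (hd' t).hasDerivWithinAt) (fun _ _ => mem_univ _) ?_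
    simp [hx0, hu0']
  have hself : ∀ t ∈ Icc 0 T, m t = displacedMean (fun z : E × E => F z.1) μ₀ (u' t) := by
    intro t ht
    have h1 : ∫ x, F (Y t x).1 ∂Pr = ∫ x, F (displace (u' t) (Y₀ x)).1 ∂Pr := by
      refine integral_congr_ae ?_
      filter_upwards [hYu'] with x hx
      rw [hx t ht]
    rw [hmeq t ht, h1, integral_feature_displace_comp hI hY₀ hlaw]
  filter_upwards [hYu'] with x hx t ht
  rw [hx t ht, hI.flow_eq_meanField_flow hμ hu0 hu hu0' (fun t _ => hu' t) hself t ht]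

omit [IsProbabilityMeasure Pr] in
theorem isCharacteristic_displace (hu0 : u 0 = 0)
    (hu : ∀ t, HasDerivAt u (displacementVelocity hI
      (displacedMean (fun z : E × E => F z.1) μ₀ (u t)) (u t)) t)
    (hY₀ : Measurable Y₀) (hlaw : Pr.map Y₀ = μ₀) (S : Set ℝ) :
    IsCharacteristic O F a γ Pr Y₀ S fun t x => displace (u t) (Y₀ x) := by
  refine ⟨fun t _ => ((continuous_displace (u t)).measurable.comp hY₀).aemeasurable,
    Eventually.of_forall fun x => by simp [hu0], Eventually.of_forall fun x t _ => ?_⟩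
  rw [integral_feature_displace_comp hI hY₀ hlaw]
  exact (hasDerivAt_displace (hu t) _).hasDerivWithinAt

end Characteristics

theorem isLawOfCharacteristics_Icc (hμ : Integrable (fun z => ‖z‖) μ₀) (hu0 : u 0 = 0)
    (hu : ∀ t, HasDerivAt u (displacementVelocity hI
      (displacedMean (fun z : E × E => F z.1) μ₀ (u t)) (u t)) t) {C : ℝ} (hO : ∀ p, ‖O p‖ ≤ C)
    (T : ℝ) : IsLawOfCharacteristics.{u, v, w} O F a γ μ₀ (Icc 0 T)
      fun t => μ₀.map (displace (u t)) := by
  intro Ω _ Pr _ Y₀ hY₀ hlaw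
  refine ⟨_, isCharacteristic_displace hu0 hu hY₀ hlaw _, fun Y' hY' =>
    hY'.ae_eq_displace hμ hu0 hu hO hY₀ hlaw, fun t _ => ?_⟩
  subst hlaw
  exact (Measure.map_map (continuous_displace (u t)).measurable hY₀).symm

theorem isLawOfCharacteristics_Ici (hμ : Integrable (fun z => ‖z‖) μ₀) (hu0 : u 0 = 0)
    (hu : ∀ t, HasDerivAt u (displacementVelocity hI
      (displacedMean (fun z : E × E => F z.1) μ₀ (u t)) (u t)) t) {C : ℝ} (hO : ∀ p, ‖O p‖ ≤ C) :
    IsLawOfCharacteristics.{u, v, w} O F a γ μ₀ (Ici 0) fun t => μ₀.map (displace (u t)) := by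
  intro Ω _ Pr _ Y₀ hY₀ hlaw
  refine ⟨_, isCharacteristic_displace hu0 hu hY₀ hlaw _, fun Y' hY' => ?_, fun t _ => ?_⟩
  · have h := ae_all_iff.2 fun n : ℕ =>
      (hY'.mono (Icc_subset_Ici_self : Icc (0 : ℝ) n ⊆ Ici 0)).ae_eq_displace hμ hu0 hu hO hY₀ hlaw
    filter_upwards [h] with x hx t ht
    obtain ⟨n, hn⟩ := exists_nat_ge t
    exact hx n t ⟨ht, hn⟩
  · subst hlaw
    exact (Measure.map_map (continuous_displace (u t)).measurable hY₀).symm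

omit [IsProbabilityMeasure μ₀] in
/-- Well-posedness of the mean-field equation for globally Lipschitz data. -/
theorem LipschitzData.meanFieldWellPosed (h : LipschitzData O F a K) (hγ : 0 < γ) :
    MeanFieldWellPosed.{u, v, w} O F a γ := by
  intro μ₀ _ hμ
  have hI := h.lipschitzInteraction hγ
  obtain ⟨u, hu0, hu⟩ := hI.exists_meanField_flow hμ
  exact ⟨_, isWeakSolution_map_displace hμ hu0 hu _, fun T ν hν => hν.eq_map_displace hμ hu0 hu,
    isLawOfCharacteristics_Ici hμ hu0 hu h.norm_orth_le⟩

end MeanFieldGlobal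

/-! ### The particle system and the scheme for Lipschitz data -/

section OneStep
variable {X : Type*} [NormedAddCommGroup X] [NormedSpace ℝ X]

/-- Convergence of one-step methods: if a step of size `h` agrees with the explicit Euler step up to
`h τ (1 + ‖x‖)`, its iterates follow the exact solution up to `O(h + τ)` on bounded time
intervals. -/
theorem exists_forall_norm_linearInterpolation_sub_le {V : X → X} {K : ℝ} (hK : 0 ≤ K)
    (hV : ∀ x y, ‖V x - V y‖ ≤ K * ‖x - y‖) {T : ℝ} (hT : 0 ≤ T) {x : ℝ → X}
    (hx : ∀ t ∈ Icc 0 (T + 1), HasDerivWithinAt x (V (x t)) (Icc 0 (T + 1)) t) :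
    ∃ C : ℝ, 0 ≤ C ∧ ∀ (step : X → X) (h τ : ℝ), 0 < h → h ≤ 1 → 0 ≤ τ → τ ≤ 1 →
      (∀ y, ‖step y - (y + h • V y)‖ ≤ h * τ * (1 + ‖y‖)) → ∀ t ∈ Icc 0 T,
        ‖linearInterpolation (fun k => step^[k] (x 0)) h t - x t‖ ≤ C * (h + τ) := by
  have hxc : ContinuousOn x (Icc 0 (T + 1)) := fun t ht => (hx t ht).continuousWithinAt
  obtain ⟨M, hM⟩ := isCompact_Icc.exists_bound_of_continuousOn hxc
  have hM0 : 0 ≤ M := (norm_nonneg _).trans (hM 0 ⟨le_rfl, by linarith⟩)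
  obtain ⟨G, hG⟩ : ∃ G : ℝ, G = ‖V 0‖ + K * M := ⟨_, rfl⟩
  have hG0 : 0 ≤ G := by rw [hG]; positivity
  have hVG : ∀ t ∈ Icc 0 (T + 1), ‖V (x t)‖ ≤ G := fun t ht => by
    have h1 := hV (x t) 0
    rw [sub_zero] at h1
    have h2 := mul_le_mul_of_nonneg_left (hM t ht) hK
    calc ‖V (x t)‖ = ‖V 0 + (V (x t) - V 0)‖ := by simp
      _ ≤ _ := (norm_add_le _ _).trans (by linarith)
  have hxL : ∀ s ∈ Icc 0 (T + 1), ∀ t ∈ Icc 0 (T + 1), ‖x t - x s‖ ≤ G * |t - s| :=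
    fun s hs t ht => (convex_Icc 0 (T + 1)).norm_image_sub_le_of_norm_hasDerivWithin_le hx hVG hs ht
  -- the local error of an Euler step along the exact solution
  have hloc : ∀ t h, 0 ≤ t → 0 ≤ h → t + h ≤ T + 1 →
      ‖x (t + h) - (x t + h • V (x t))‖ ≤ h * (K * G * h) := by
    intro t h ht hh hth
    have hsub : Icc t (t + h) ⊆ Icc 0 (T + 1) := Icc_subset_Icc ht hth
    have hI := (convex_Icc t (t + h)).norm_image_sub_le_of_norm_hasDerivWithin_le
      (f := fun s => x s - s • V (x t)) (f' := fun s => V (x s) - V (x t)) (x := t) (y := t + h)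
      (C := K * G * h)
      (fun s hs => ((hx s (hsub hs)).mono hsub).sub (by
        simpa using (hasDerivWithinAt_id s _).smul_const (V (x t))))
      (fun s hs => by
        refine (hV _ _).trans ?_
        have h1 := hxL t ⟨ht, by linarith⟩ s (hsub hs)
        rw [abs_of_nonneg (by linarith [hs.1])] at h1
        rw [mul_assoc]
        gcongr
        exact h1.trans (by gcongr; linarith [hs.2]))
      (left_mem_Icc.2 (by linarith)) (right_mem_Icc.2 (by linarith))
    rw [add_sub_cancel_left, Real.norm_of_nonneg hh] at hI
    calc _ = ‖x (t + h) - (t + h) • V (x t) - (x t - t • V (x t))‖ := by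
          congr 1
          rw [add_smul]
          abel
      _ ≤ K * G * h * h := hI
      _ = _ := by ring
  obtain ⟨Q, hQ⟩ : ∃ Q : ℝ, Q = Real.exp ((K + 1) * (T + 1)) * (T + 1) * (1 + M + K * G) :=
    ⟨_, rfl⟩
  have hQ0 : 0 ≤ Q := by rw [hQ]; positivity
  refine ⟨Q + G, by positivity, fun step h τ hh hh1 hτ hτ1 hstep => ?_⟩
  obtain ⟨q, hq⟩ : ∃ q : ℝ, q = τ * (1 + M) + K * G * h := ⟨_, rfl⟩
  have hq0 : 0 ≤ q := by rw [hq]; positivity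
  -- accumulation of the local errors; a factor `1 + h K` comes from the stability of the Euler
  -- step, the rest of `1 + h (K + 1)` from the dependence of the defect on the numerical solution
  have hrec : ∀ k : ℕ, k * h ≤ T + 1 →
      ‖step^[k] (x 0) - x (k * h)‖ ≤ k * h * q * (1 + h * (K + 1)) ^ k := by
    intro k
    induction k with
    | zero => intro _; simp
    | succ k ih =>
      intro hk
      push_cast at hk ⊢
      have hkh : 0 ≤ k * h := by positivity
      have hk' : k * h + h ≤ T + 1 := by linarith
      have ih' := ih (by linarith)
      have hkk : ((k : ℝ) + 1) * h = k * h + h := by ring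
      rw [Function.iterate_succ_apply', hkk]
      set y := step^[k] (x 0)
      set t := (k : ℝ) * h
      set e := ‖y - x t‖ with he
      have he0 : 0 ≤ e := norm_nonneg _
      have h1 : ‖step y - (y + h • V y)‖ ≤ h * τ * (1 + (M + e)) := by
        refine (hstep y).trans ?_
        gcongr
        calc ‖y‖ = ‖x t + (y - x t)‖ := by simp
          _ ≤ _ := (norm_add_le _ _).trans (by gcongr; exact hM t ⟨hkh, by linarith⟩)
      have h2 : ‖(y + h • V y) - (x t + h • V (x t))‖ ≤ (1 + h * K) * e := by
        have : (y + h • V y) - (x t + h • V (x t)) = (y - x t) + h • (V y - V (x t)) := by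
          rw [smul_sub]; abel
        rw [this]
        refine (norm_add_le _ _).trans ?_
        rw [norm_smul, Real.norm_of_nonneg hh.le]
        have := mul_le_mul_of_nonneg_left (hV y (x t)) hh.le
        linarith
      have h3 := hloc t h hkh hh.le hk'
      have h4 : ‖step y - x (t + h)‖ ≤ (1 + h * (K + 1)) * e + h * q := by
        calc _ = ‖(step y - (y + h • V y)) + ((y + h • V y) - (x t + h • V (x t)))
              - (x (t + h) - (x t + h • V (x t)))‖ := by congr 1; abel
          _ ≤ h * τ * (1 + (M + e)) + (1 + h * K) * e + h * (K * G * h) :=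
              (norm_sub_le _ _).trans (add_le_add ((norm_add_le _ _).trans (add_le_add h1 h2)) h3)
          _ ≤ _ := by
              have : h * τ * e ≤ h * 1 * e := by gcongr
              rw [hq]
              linarith
      have h5 : 1 ≤ (1 + h * (K + 1)) ^ (k + 1) := one_le_pow₀ (by
        have : 0 ≤ h * (K + 1) := by positivity
        linarith)
      calc _ ≤ (1 + h * (K + 1)) * e + h * q := h4
        _ ≤ (1 + h * (K + 1)) * (t * q * (1 + h * (K + 1)) ^ k)
            + h * q * (1 + h * (K + 1)) ^ (k + 1) :=
            add_le_add (by gcongr) (le_mul_of_one_le_right (by positivity) h5)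
        _ = _ := by ring
  have hglob : ∀ k : ℕ, k * h ≤ T + 1 → ‖step^[k] (x 0) - x (k * h)‖ ≤ Q * (h + τ) := by
    intro k hk
    have hkh : 0 ≤ k * h := by positivity
    have h1 : (1 + h * (K + 1)) ^ k ≤ Real.exp ((K + 1) * (T + 1)) := by
      calc (1 + h * (K + 1)) ^ k ≤ Real.exp (h * (K + 1)) ^ k := by
            gcongr
            linarith [Real.add_one_le_exp (h * (K + 1))]
        _ = Real.exp ((K + 1) * (k * h)) := by rw [← Real.exp_nat_mul]; ring_nf
        _ ≤ _ := Real.exp_le_exp.2 (by gcongr)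
    have h2 : q ≤ (1 + M + K * G) * (h + τ) := by
      rw [hq]
      have h3 : 0 ≤ (1 + M) * h := by positivity
      have h4 : 0 ≤ K * G * τ := by positivity
      linarith
    calc _ ≤ k * h * q * (1 + h * (K + 1)) ^ k := hrec k hk
      _ ≤ (T + 1) * ((1 + M + K * G) * (h + τ)) * Real.exp ((K + 1) * (T + 1)) := by gcongr
      _ = _ := by rw [hQ]; ring
  intro t ht
  set k := ⌊t / h⌋₊ with hk
  have hk1 : (k : ℝ) ≤ t / h := Nat.floor_le (div_nonneg ht.1 hh.le)
  have hk2 : t / h < k + 1 := Nat.lt_floor_add_one _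
  have hkt : k * h ≤ t := (le_div_iff₀ hh).1 hk1
  have hkt' : t < (k + 1) * h := (div_lt_iff₀ hh).1 hk2
  have hkT : (k + 1) * h ≤ T + 1 := by linarith [ht.2]
  have htm : t ∈ Icc 0 (T + 1) := ⟨ht.1, by linarith [ht.2]⟩
  -- the interpolated value is a mean of two iterates that belong to times within `h` of `t`
  have hnear : ∀ j : ℕ, j * h ∈ Icc 0 (T + 1) → |j * h - t| ≤ h →
      ‖step^[j] (x 0) - x t‖ ≤ (Q + G) * (h + τ) := by
    intro j hj hjt
    calc _ = ‖(step^[j] (x 0) - x (j * h)) + (x (j * h) - x t)‖ := by simp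
      _ ≤ Q * (h + τ) + G * (h + τ) := (norm_add_le _ _).trans (add_le_add (hglob j hj.2)
          ((hxL t htm _ hj).trans (by gcongr; linarith)))
      _ = _ := by ring
  have hA := hnear k ⟨by positivity, by linarith [ht.2]⟩ (by
    rw [abs_le]; constructor <;> linarith)
  have hB := hnear (k + 1) ⟨by positivity, by push_cast; exact hkT⟩ (by
    push_cast
    rw [abs_le]; constructor <;> linarith)
  have hs0 : 0 ≤ t / h - k := by linarith
  have hs1 : t / h - k ≤ 1 := by linarith
  have hconv : linearInterpolation (fun k => step^[k] (x 0)) h t - x t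
      = (1 - (t / h - k)) • (step^[k] (x 0) - x t)
        + (t / h - k) • (step^[k + 1] (x 0) - x t) := by
    simp only [linearInterpolation, ← hk]
    module
  rw [hconv]
  refine (norm_add_le _ _).trans ?_
  rw [norm_smul, norm_smul, Real.norm_of_nonneg hs0, Real.norm_of_nonneg (by linarith)]
  calc _ ≤ (1 - (t / h - k)) * ((Q + G) * (h + τ)) + (t / h - k) * ((Q + G) * (h + τ)) :=
        add_le_add (mul_le_mul_of_nonneg_left hA (by linarith)) (mul_le_mul_of_nonneg_left hB hs0)
    _ = _ := by ring

end OneStep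

section Particles
variable {E : Type v} [NormedAddCommGroup E] [InnerProductSpace ℝ E]
variable {H : Type u} [NormedAddCommGroup H] [InnerProductSpace ℝ H]
variable {O : E → E} {F : E → H} {a : H → E → E} {γ K : ℝ} {N : ℕ}

/-- The right-hand side of the particle system. -/
noncomputable def particleField (O : E → E) (F : E → H) (a : H → E → E) (γ : ℝ)
    (x : (Fin N → E) × (Fin N → E)) : (Fin N → E) × (Fin N → E) :=
  (fun i => -O (x.2 i), fun i => γ • (a (empiricalMean F x.1) (x.1 i) - x.2 i))

theorem isParticleSolution_iff {x₀ : (Fin N → E) × (Fin N → E)} {S : Set ℝ} {θ P : ℝ → Fin N → E} :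
    IsParticleSolution O F a γ x₀ S θ P ↔ (θ 0, P 0) = x₀ ∧
      ∀ t ∈ S, HasDerivWithinAt (fun t => (θ t, P t)) (particleField O F a γ (θ t, P t)) S t := by
  constructor
  · intro h
    exact ⟨Prod.ext h.init_θ h.init_P, fun t ht => (hasDerivWithinAt_pi.2 (h.deriv_θ t ht)).prodMk
      (hasDerivWithinAt_pi.2 (h.deriv_P t ht))⟩
  · rintro ⟨rfl, h⟩
    exact ⟨rfl, rfl, fun t ht => hasDerivWithinAt_pi.1 (h t ht).fst,
      fun t ht => hasDerivWithinAt_pi.1 (h t ht).snd⟩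

omit [InnerProductSpace ℝ E] in
theorem norm_empiricalMean_sub_le (hK : 0 ≤ K) (hF : ∀ θ θ', ‖F θ - F θ'‖ ≤ K * ‖θ - θ'‖)
    (θ θ' : Fin N → E) : ‖empiricalMean F θ - empiricalMean F θ'‖ ≤ K * ‖θ - θ'‖ := by
  rw [empiricalMean, empiricalMean, ← smul_sub, ← Finset.sum_sub_distrib, norm_smul, norm_inv,
    Real.norm_natCast]
  have h1 : ‖∑ j, (F (θ j) - F (θ' j))‖ ≤ N * (K * ‖θ - θ'‖) := by
    refine (norm_sum_le_of_le _ fun j _ => (hF (θ j) (θ' j)).trans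
      (mul_le_mul_of_nonneg_left (norm_le_pi_norm (θ - θ') j) hK)).trans ?_
    simp
  rcases Nat.eq_zero_or_pos N with rfl | hN
  · simp only [Nat.cast_zero, inv_zero, zero_mul]
    positivity
  · rwa [inv_mul_le_iff₀ (by positivity)]

omit [NormedAddCommGroup E] [InnerProductSpace ℝ E] in
theorem norm_empiricalMean_le {M : ℝ} (hM : 0 ≤ M) {θ : Fin N → E} (hF : ∀ j, ‖F (θ j)‖ ≤ M) :
    ‖empiricalMean F θ‖ ≤ M := by
  rw [empiricalMean, norm_smul, norm_inv, Real.norm_natCast]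
  have h1 : ‖∑ j, F (θ j)‖ ≤ N * M := by
    refine (norm_sum_le_of_le _ fun j _ => hF j).trans ?_
    simp
  rcases Nat.eq_zero_or_pos N with rfl | hN
  · simpa using hM
  · rwa [inv_mul_le_iff₀ (by positivity)]

theorem LipschitzData.norm_particleField_sub_le (h : LipschitzData O F a K) (hγ : 0 < γ)
    (x y : (Fin N → E) × (Fin N → E)) :
    ‖particleField O F a γ x - particleField O F a γ y‖
      ≤ (K + γ * (K * (K + 1) + 1)) * ‖x - y‖ := by
  have hK := h.nonneg
  have h1 : ‖x.1 - y.1‖ ≤ ‖x - y‖ := norm_fst_le (x - y)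
  have h2 : ‖x.2 - y.2‖ ≤ ‖x - y‖ := norm_snd_le (x - y)
  have h3 : 0 ≤ ‖x - y‖ := norm_nonneg _
  have h4 : 0 ≤ γ * (K * (K + 1) + 1) := by positivity
  refine (Prod.norm_def _).le.trans (max_le ?_ ?_) <;>
    refine (pi_norm_le_iff_of_nonneg (by positivity)).2 fun i => ?_
  · have hi : ‖x.2 i - y.2 i‖ ≤ ‖x - y‖ := (norm_le_pi_norm (x.2 - y.2) i).trans h2
    have : (particleField O F a γ x - particleField O F a γ y).1 i = -(O (x.2 i) - O (y.2 i)) := by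
      simp [particleField]; abel
    rw [this, norm_neg]
    calc _ ≤ K * ‖x - y‖ := (h.orth _ _).trans (by gcongr)
      _ ≤ _ := by nlinarith [mul_nonneg h4 h3]
  · have hi : ‖x.2 i - y.2 i‖ ≤ ‖x - y‖ := (norm_le_pi_norm (x.2 - y.2) i).trans h2
    have hi' : ‖x.1 i - y.1 i‖ ≤ ‖x - y‖ := (norm_le_pi_norm (x.1 - y.1) i).trans h1
    have hm := (norm_empiricalMean_sub_le hK h.feature x.1 y.1).trans
      (mul_le_mul_of_nonneg_left h1 hK)
    have : (particleField O F a γ x - particleField O F a γ y).2 i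
        = γ • ((a (empiricalMean F x.1) (x.1 i) - a (empiricalMean F y.1) (y.1 i))
          - (x.2 i - y.2 i)) := by
      simp only [particleField, Prod.snd_sub, Pi.sub_apply, ← smul_sub]
      congr 1
      abel
    rw [this, norm_smul, Real.norm_of_nonneg hγ.le]
    calc _ ≤ γ * (K * (K * ‖x - y‖ + ‖x - y‖) + ‖x - y‖) := by
          gcongr
          refine (norm_sub_le _ _).trans (add_le_add ((h.force _ _ _ _).trans ?_) hi)
          gcongr
      _ ≤ _ := by nlinarith [mul_nonneg hK h3]

omit [InnerProductSpace ℝ E] in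
theorem LipschitzData.norm_force_sub_le (h : LipschitzData O F a K)
    (x : (Fin N → E) × (Fin N → E)) (i : Fin N) :
    ‖a (empiricalMean F x.1) (x.1 i) - x.2 i‖
      ≤ (‖a 0 0‖ + K * (‖F 0‖ + K + 1) + 1) * (1 + ‖x‖) := by
  have hK := h.nonneg
  have hx0 : 0 ≤ ‖x‖ := norm_nonneg _
  have h1 : ∀ j, ‖x.1 j‖ ≤ ‖x‖ := fun j => (norm_le_pi_norm x.1 j).trans (norm_fst_le x)
  have h2 : ‖x.2 i‖ ≤ ‖x‖ := (norm_le_pi_norm x.2 i).trans (norm_snd_le x)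
  have hF : ∀ j, ‖F (x.1 j)‖ ≤ ‖F 0‖ + K * ‖x‖ := fun j => by
    have := h.feature (x.1 j) 0
    rw [sub_zero] at this
    calc ‖F (x.1 j)‖ = ‖F 0 + (F (x.1 j) - F 0)‖ := by simp
      _ ≤ _ := (norm_add_le _ _).trans (by gcongr; exact this.trans (by gcongr; exact h1 j))
  have hm := norm_empiricalMean_le (by positivity) hF
  have ha := h.force (empiricalMean F x.1) 0 (x.1 i) 0
  rw [sub_zero, sub_zero] at ha
  have ha' : ‖a (empiricalMean F x.1) (x.1 i)‖
      ≤ ‖a 0 0‖ + K * ((‖F 0‖ + K * ‖x‖) + ‖x‖) := by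
    calc _ = ‖a 0 0 + (a (empiricalMean F x.1) (x.1 i) - a 0 0)‖ := by simp
      _ ≤ _ := (norm_add_le _ _).trans (by
        gcongr
        exact ha.trans (by gcongr; exact h1 i))
  refine (norm_sub_le _ _).trans ((add_le_add ha' h2).trans ?_)
  have h3 := mul_nonneg (norm_nonneg (a 0 0)) hx0
  have h4 := mul_nonneg (mul_nonneg hK (norm_nonneg (F 0))) hx0
  nlinarith [mul_nonneg hK hK]

/-- One step of the scheme differs from an Euler step of the particle system by
`O(h (h + |r| / h))`. -/
theorem LipschitzData.norm_muonStep_sub_le (h : LipschitzData O F a K) (hγ : 0 < γ) {s r : ℝ}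
    (hs : 0 < s) (hr : |r| ≤ s) (x : (Fin N → E) × (Fin N → E)) :
    ‖muonStep O F a (1 - γ * s + r) s x - (x + s • particleField O F a γ x)‖
      ≤ s * (((1 + K * (γ + 1)) * (‖a 0 0‖ + K * (‖F 0‖ + K + 1) + 1)) * (s + |r| / s))
        * (1 + ‖x‖) := by
  have hK := h.nonneg
  obtain ⟨D, hD⟩ : ∃ D : ℝ, D = (‖a 0 0‖ + K * (‖F 0‖ + K + 1) + 1) * (1 + ‖x‖) := ⟨_, rfl⟩
  have hD0 : 0 ≤ D := by rw [hD]; positivity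
  have hd : ∀ i, ‖a (empiricalMean F x.1) (x.1 i) - x.2 i‖ ≤ D := fun i => by
    rw [hD]
    exact h.norm_force_sub_le x i
  have hgoal : s * (((1 + K * (γ + 1)) * (‖a 0 0‖ + K * (‖F 0‖ + K + 1) + 1)) * (s + |r| / s))
      * (1 + ‖x‖) = (1 + K * (γ + 1)) * D * (s * s + |r|) := by
    rw [hD]
    field_simp
  rw [hgoal]
  have hr0 : 0 ≤ |r| := abs_nonneg r
  refine (Prod.norm_def _).le.trans (max_le ?_ ?_) <;>
    refine (pi_norm_le_iff_of_nonneg (by positivity)).2 fun i => ?_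
  · set q := (1 - γ * s + r) • x.2 i + (1 - (1 - γ * s + r)) • a (empiricalMean F x.1) (x.1 i)
      with hq
    have h1 : (muonStep O F a (1 - γ * s + r) s x - (x + s • particleField O F a γ x)).1 i
        = -(s • (O q - O (x.2 i))) := by
      simp only [muonStep, particleField, Prod.fst_sub, Prod.fst_add, Prod.smul_fst, Pi.sub_apply,
        Pi.add_apply, Pi.smul_apply, smul_neg, smul_sub, ← hq]
      abel
    have h2 : q - x.2 i = (γ * s - r) • (a (empiricalMean F x.1) (x.1 i) - x.2 i) := by
      rw [hq]
      module
    rw [h1, norm_neg, norm_smul, Real.norm_of_nonneg hs.le]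
    have h3 : |γ * s - r| ≤ (γ + 1) * s := by
      refine (abs_sub _ _).trans ?_
      rw [abs_of_pos (mul_pos hγ hs)]
      linarith
    calc _ ≤ s * (K * ‖q - x.2 i‖) := by gcongr; exact h.orth _ _
      _ ≤ s * (K * ((γ + 1) * s * D)) := by
          rw [h2, norm_smul, Real.norm_eq_abs]
          gcongr
          exact hd i
      _ = K * (γ + 1) * D * (s * s) := by ring
      _ ≤ (1 + K * (γ + 1)) * D * (s * s + |r|) := by
          gcongr <;> linarith
  · have h1 : (muonStep O F a (1 - γ * s + r) s x - (x + s • particleField O F a γ x)).2 i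
        = -(r • (a (empiricalMean F x.1) (x.1 i) - x.2 i)) := by
      simp only [muonStep, particleField, Prod.snd_sub, Prod.snd_add, Prod.smul_snd, Pi.sub_apply,
        Pi.add_apply, Pi.smul_apply]
      module
    rw [h1, norm_neg, norm_smul, Real.norm_eq_abs]
    have h2 : 0 ≤ K * (γ + 1) := by positivity
    calc _ ≤ |r| * D := by gcongr; exact hd i
      _ = 1 * D * |r| := by ring
      _ ≤ _ := by gcongr <;> nlinarith

omit [InnerProductSpace ℝ E] in
theorem avgNorm_le (U : Fin N → E) : avgNorm U ≤ ‖U‖ := by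
  refine Real.sqrt_le_iff.2 ⟨norm_nonneg _, ?_⟩
  have h1 : ∑ i, ‖U i‖ ^ 2 ≤ N * ‖U‖ ^ 2 := by
    refine (Finset.sum_le_sum fun i _ => pow_le_pow_left₀ (norm_nonneg _)
      (norm_le_pi_norm U i) 2).trans ?_
    simp
  rcases Nat.eq_zero_or_pos N with rfl | hN
  · simp
  · rwa [inv_mul_le_iff₀ (by positivity)]

/-- The quantitative form of the finite-particle limit from which both convergence statements
follow: the error of the interpolated scheme is `O(h + |r_h| / h)`. -/
theorem LipschitzData.exists_eventually_norm_sub_le (h : LipschitzData O F a K) (hγ : 0 < γ)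
    {T : ℝ} (hT : 0 ≤ T) {x : ℝ → (Fin N → E) × (Fin N → E)}
    (hx : ∀ t ∈ Icc 0 (T + 1), HasDerivWithinAt x (particleField O F a γ (x t)) (Icc 0 (T + 1)) t)
    {r : ℝ → ℝ} (hr : Tendsto (fun h => r h / h) (𝓝[>] 0) (𝓝 0)) :
    ∃ C : ℝ, ∀ᶠ s in 𝓝[>] (0 : ℝ), ∀ t ∈ Icc 0 T,
      ‖linearInterpolation (muonIterate O F a (1 - γ * s + r s) s (x 0)) s t - x t‖
        ≤ C * (s + |r s| / s) := by
  have hK := h.nonneg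
  obtain ⟨C, hC0, hC⟩ := exists_forall_norm_linearInterpolation_sub_le
    (by positivity) (h.norm_particleField_sub_le hγ) hT hx
  set c := (1 + K * (γ + 1)) * (‖a 0 0‖ + K * (‖F 0‖ + K + 1) + 1) with hc
  have hc0 : 0 ≤ c := by positivity
  have hid : Tendsto (fun s : ℝ => s) (𝓝[>] 0) (𝓝 0) := tendsto_id.mono_left nhdsWithin_le_nhds
  have hlim : Tendsto (fun s => c * (s + |r s / s|)) (𝓝[>] 0) (𝓝 0) := by
    simpa using (hid.add hr.abs).const_mul c
  refine ⟨C * (1 + c), ?_⟩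
  filter_upwards [self_mem_nhdsWithin, hid.eventually_le_const one_pos,
    hr.abs.eventually_le_const (by simp : |(0 : ℝ)| < 1), hlim.eventually_le_const one_pos]
    with s hs hs1 hr1 hτ1 t ht
  have hs0 : 0 < s := hs
  have habs : |r s / s| = |r s| / s := by rw [abs_div, abs_of_pos hs0]
  rw [habs] at hr1 hτ1
  have hrs : 0 ≤ |r s| / s := by positivity
  have hrs' : |r s| ≤ s := by
    have := (div_le_iff₀ hs0).1 hr1
    linarith
  have hmain := hC (muonStep O F a (1 - γ * s + r s) s) s (c * (s + |r s| / s)) hs0 hs1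
    (by positivity) hτ1 (h.norm_muonStep_sub_le hγ hs0 hrs') t ht
  refine hmain.trans ?_
  have h2 : 0 ≤ C * (|r s| / s) := by positivity
  nlinarith

omit [InnerProductSpace ℝ E] in
/-- From the quantitative error bound to the two convergence statements. -/
theorem convergence_of_eventually_norm_sub_le {T : ℝ} {x : ℝ → (Fin N → E) × (Fin N → E)}
    {z : ℝ → ℝ → (Fin N → E) × (Fin N → E)} {r : ℝ → ℝ}
    (hr : Tendsto (fun h => r h / h) (𝓝[>] 0) (𝓝 0))
    (hz : ∃ C : ℝ, ∀ᶠ s in 𝓝[>] (0 : ℝ), ∀ t ∈ Icc 0 T,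
      ‖z s t - x t‖ ≤ C * (s + |r s| / s)) :
    (∀ δ > 0, ∀ᶠ h in 𝓝[>] (0 : ℝ), ∀ t ∈ Icc 0 T,
      avgNorm ((z h t).1 - (x t).1) + avgNorm ((z h t).2 - (x t).2) ≤ δ) ∧
    (r =O[𝓝[>] (0 : ℝ)] (fun h => h ^ 2) → ∃ C : ℝ, ∀ᶠ h in 𝓝[>] (0 : ℝ), ∀ t ∈ Icc 0 T,
      avgNorm ((z h t).1 - (x t).1) + avgNorm ((z h t).2 - (x t).2) ≤ C * h) := by
  obtain ⟨C, hC⟩ := hz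
  have hle : ∀ y : (Fin N → E) × (Fin N → E), avgNorm y.1 + avgNorm y.2 ≤ 2 * ‖y‖ := fun y => by
    have h1 := (avgNorm_le y.1).trans (norm_fst_le y)
    have h2 := (avgNorm_le y.2).trans (norm_snd_le y)
    linarith
  have hid : Tendsto (fun s : ℝ => s) (𝓝[>] 0) (𝓝 0) := tendsto_id.mono_left nhdsWithin_le_nhds
  constructor
  · intro δ hδ
    have hlim : Tendsto (fun s => 2 * (C * (s + |r s / s|))) (𝓝[>] 0) (𝓝 0) := by
      simpa using ((hid.add hr.abs).const_mul C).const_mul 2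
    filter_upwards [hC, hlim.eventually_le_const hδ, self_mem_nhdsWithin] with s hs hs' hs0 t ht
    have h1 := hle (z s t - x t)
    have h2 := hs t ht
    rw [abs_div, abs_of_pos (show 0 < s from hs0)] at hs'
    simp only [Prod.fst_sub, Prod.snd_sub] at h1
    linarith
  · intro hO
    obtain ⟨c, hc⟩ := hO.bound
    refine ⟨2 * (|C| * (1 + c)), ?_⟩
    filter_upwards [hC, hc, self_mem_nhdsWithin] with s hs hcs hs0 t ht
    have hs0' : 0 < s := hs0
    have h1 := hle (z s t - x t)
    simp only [Prod.fst_sub, Prod.snd_sub] at h1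
    have h3 : |r s| / s ≤ c * s := by
      rw [div_le_iff₀ hs0']
      rw [Real.norm_eq_abs, Real.norm_of_nonneg (by positivity)] at hcs
      linarith
    have h4 : C * (s + |r s| / s) ≤ |C| * (s + c * s) :=
      mul_le_mul (le_abs_self C) (by linarith) (by positivity) (abs_nonneg C)
    have h2 := (hs t ht).trans h4
    linarith

/-- The particle system with Lipschitz data: global existence, and uniqueness on intervals. -/
theorem LipschitzData.exists_particleSolution [CompleteSpace E] (h : LipschitzData O F a K)
    (hγ : 0 < γ) (x₀ : (Fin N → E) × (Fin N → E)) :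
    ∃ x : ℝ → (Fin N → E) × (Fin N → E), x 0 = x₀ ∧
      (∀ t, HasDerivAt x (particleField O F a γ (x t)) t) ∧
      ∀ (T : ℝ) (y : ℝ → (Fin N → E) × (Fin N → E)), y 0 = x₀ →
        (∀ t ∈ Icc 0 T, HasDerivWithinAt y (particleField O F a γ (y t)) (Icc 0 T) t) →
        ∀ t ∈ Icc 0 T, y t = x t := by
  have hL := lipschitzWith_of_norm_sub_le (h.norm_particleField_sub_le hγ (N := N))
  obtain ⟨x, hx0, hx⟩ := exists_forall_hasDerivAt_of_lipschitzWith (fun _ => hL)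
    (fun _ => continuous_const) (fun _ => le_rfl) x₀
  refine ⟨x, hx0, hx, fun T y hy0 hy => ?_⟩
  exact ODE_solution_unique_of_mem_Icc_right (s := fun _ => univ)
    (v := fun _ => particleField O F a γ) (fun t _ => hL.lipschitzOnWith)
    (fun t ht => (hy t ht).continuousWithinAt)
    (fun t ht => (hy t (Ico_subset_Icc_self ht)).mono_of_mem_nhdsWithin (Icc_mem_nhdsGE_of_mem ht))
    (fun _ _ => mem_univ _) (fun t _ => (hx t).continuousAt.continuousWithinAt)
    (fun t _ => (hx t).hasDerivWithinAt) (fun _ _ => mem_univ _) (hy0.trans hx0.symm)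

/-- The finite-particle limit for globally Lipschitz data. -/
theorem LipschitzData.finiteParticleLimit [CompleteSpace E] (h : LipschitzData O F a K)
    (hγ : 0 < γ) : FiniteParticleLimit O F a γ := by
  intro N _ x₀
  obtain ⟨x, hx0, hx, huniq⟩ := h.exists_particleSolution hγ x₀
  refine ⟨fun t => (x t).1, fun t => (x t).2, isParticleSolution_iff.2
    ⟨hx0, fun t _ => (hx t).hasDerivWithinAt⟩, fun T θ' P' h' t ht => ?_, fun r hr T hT => ?_⟩
  · obtain ⟨h0, hd⟩ := isParticleSolution_iff.1 h'
    exact Prod.mk.inj (huniq T _ h0 hd t ht)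
  · subst hx0
    exact convergence_of_eventually_norm_sub_le (x := x) hr
      (h.exists_eventually_norm_sub_le hγ hT.le (fun t _ => (hx t).hasDerivWithinAt) hr)

end Particles

/-! ### Truncation, and locally Lipschitz data -/

section Truncation

variable {E : Type v} [NormedAddCommGroup E] [InnerProductSpace ℝ E]
variable {H : Type u} [NormedAddCommGroup H] [InnerProductSpace ℝ H]

/-- The radial retraction onto the closed ball of radius `R > 0`. -/
noncomputable def radialRetraction {V : Type*} [NormedAddCommGroup V] [NormedSpace ℝ V]
    (R : ℝ) (x : V) : V :=
  (R / max R ‖x‖) • x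

section Retraction

variable {V : Type*} [NormedAddCommGroup V] [NormedSpace ℝ V] {R : ℝ}

theorem radialRetraction_eq_self (hR : 0 < R) {x : V} (hx : ‖x‖ ≤ R) :
    radialRetraction R x = x := by
  rw [radialRetraction, max_eq_left hx, div_self hR.ne', one_smul]

theorem norm_radialRetraction_le (hR : 0 < R) (x : V) : ‖radialRetraction R x‖ ≤ R := by
  have h : 0 < max R ‖x‖ := hR.trans_le (le_max_left _ _)
  rw [radialRetraction, norm_smul, Real.norm_of_nonneg (by positivity), div_mul_eq_mul_div,
    div_le_iff₀ h]
  exact mul_le_mul_of_nonneg_left (le_max_right _ _) hR.le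

theorem norm_radialRetraction_sub_le (hR : 0 < R) (x y : V) :
    ‖radialRetraction R x - radialRetraction R y‖ ≤ 2 * ‖x - y‖ := by
  have hx : 0 < max R ‖x‖ := hR.trans_le (le_max_left _ _)
  have hy : 0 < max R ‖y‖ := hR.trans_le (le_max_left _ _)
  have hx1 : R / max R ‖x‖ ≤ 1 := (div_le_one hx).2 (le_max_left _ _)
  have hx0 : 0 ≤ R / max R ‖x‖ := by positivity
  have hsplit : radialRetraction R x - radialRetraction R y
      = (R / max R ‖x‖) • (x - y) + (R / max R ‖x‖ - R / max R ‖y‖) • y := by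
    simp only [radialRetraction]
    module
  have hc : R / max R ‖x‖ - R / max R ‖y‖
      = R / max R ‖x‖ * ((max R ‖y‖ - max R ‖x‖) / max R ‖y‖) := by
    field_simp
  have hm : |max R ‖y‖ - max R ‖x‖| ≤ ‖x - y‖ := by
    refine (abs_max_sub_max_le_max R ‖y‖ R ‖x‖).trans (max_le (by simp) ?_)
    rw [norm_sub_rev x y]
    exact abs_norm_sub_norm_le y x
  have hy1 : |max R ‖y‖ - max R ‖x‖| / max R ‖y‖ * ‖y‖ ≤ ‖x - y‖ := by
    rw [div_mul_eq_mul_div, div_le_iff₀ hy]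
    exact mul_le_mul hm (le_max_right _ _) (norm_nonneg _) (norm_nonneg _)
  rw [hsplit]
  refine (norm_add_le _ _).trans ?_
  rw [norm_smul, norm_smul, hc, Real.norm_of_nonneg hx0, norm_mul, Real.norm_of_nonneg hx0,
    Real.norm_eq_abs, abs_div, abs_of_pos hy, mul_assoc, two_mul]
  exact add_le_add (mul_le_of_le_one_left (norm_nonneg _) hx1)
    ((mul_le_of_le_one_left (by positivity) hx1).trans hy1)

end Retraction

/-- Local form of the Lipschitz hypotheses: `O` is bounded and Lipschitz with constant `K`, while
the feature map and the force are only Lipschitz on balls. -/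
structure LocalLipschitzData (O : E → E) (F : E → H) (a : H → E → E) (K : ℝ) : Prop where
  nonneg : 0 ≤ K
  norm_orth_le : ∀ p, ‖O p‖ ≤ K
  orth : ∀ p p', ‖O p - O p'‖ ≤ K * ‖p - p'‖
  bounded_feature : ∀ r : ℝ, ∃ M : ℝ, ∀ θ, ‖θ‖ ≤ r → ‖F θ‖ ≤ M
  feature : ∀ r : ℝ, ∃ L : ℝ, ∀ θ θ', ‖θ‖ ≤ r → ‖θ'‖ ≤ r → ‖F θ - F θ'‖ ≤ L * ‖θ - θ'‖
  force : ∀ r : ℝ, ∃ L : ℝ, ∀ m m' θ θ', ‖m‖ ≤ r → ‖m'‖ ≤ r → ‖θ‖ ≤ r → ‖θ'‖ ≤ r →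
    ‖a m θ - a m' θ'‖ ≤ L * (‖m - m'‖ + ‖θ - θ'‖)

/-- `(F', a')` agrees with `(F, a)` as far as particles in the ball of radius `R` can tell: the
features agree there, and so do the forces for all means of features of such particles. -/
structure IsTruncation (F : E → H) (a : H → E → E) (R : ℝ) (F' : E → H) (a' : H → E → E) :
    Prop where
  feature : ∀ θ, ‖θ‖ ≤ R → F' θ = F θ
  force : ∃ M : ℝ, 0 ≤ M ∧ (∀ θ, ‖θ‖ ≤ R → ‖F θ‖ ≤ M) ∧
    ∀ m θ, ‖m‖ ≤ M → ‖θ‖ ≤ R → a' m θ = a m θ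

variable {O : E → E} {F F' : E → H} {a a' : H → E → E} {γ K R : ℝ}

/-- Precomposition with radial retractions makes the data globally Lipschitz. -/
theorem LocalLipschitzData.exists_truncation (h : LocalLipschitzData O F a K) (R : ℝ) :
    ∃ F' a' K', LipschitzData O F' a' K' ∧ IsTruncation F a R F' a' := by
  obtain ⟨ρ, hρ⟩ : ∃ ρ : ℝ, ρ = |R| + 1 := ⟨_, rfl⟩
  have hρ0 : 0 < ρ := by rw [hρ]; positivity
  have hRρ : R ≤ ρ := by rw [hρ]; linarith [le_abs_self R]
  obtain ⟨M, hM⟩ := h.bounded_feature ρ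
  obtain ⟨L, hL⟩ := h.feature ρ
  obtain ⟨σ, hσ⟩ : ∃ σ : ℝ, σ = |M| + 1 := ⟨_, rfl⟩
  have hσ0 : 0 < σ := by rw [hσ]; positivity
  have hMσ : M ≤ σ := by rw [hσ]; linarith [le_abs_self M]
  obtain ⟨L', hL'⟩ := h.force (max ρ σ)
  have hK := h.nonneg
  have h1 : K ≤ K + 2 * |L| + 2 * |L'| := by linarith [abs_nonneg L, abs_nonneg L']
  have h2 : |L| * 2 ≤ K + 2 * |L| + 2 * |L'| := by linarith [abs_nonneg L']
  have h3 : |L'| * 2 ≤ K + 2 * |L| + 2 * |L'| := by linarith [abs_nonneg L]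
  refine ⟨fun θ => F (radialRetraction ρ θ),
    fun m θ => a (radialRetraction σ m) (radialRetraction ρ θ), K + 2 * |L| + 2 * |L'|,
    ⟨hK.trans h1, fun p => (h.norm_orth_le p).trans h1, fun p p' => (h.orth p p').trans (by gcongr),
      fun θ θ' => ?_, fun m m' θ θ' => ?_⟩, fun θ hθ => ?_, σ, hσ0.le, fun θ hθ => ?_,
      fun m θ hm hθ => ?_⟩
  · calc _ ≤ L * ‖radialRetraction ρ θ - radialRetraction ρ θ'‖ :=
          hL _ _ (norm_radialRetraction_le hρ0 _) (norm_radialRetraction_le hρ0 _)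
      _ ≤ |L| * (2 * ‖θ - θ'‖) := by
          gcongr
          · exact le_abs_self L
          · exact norm_radialRetraction_sub_le hρ0 _ _
      _ ≤ _ := by
          rw [← mul_assoc]
          gcongr
  · calc _ ≤ L' * (‖radialRetraction σ m - radialRetraction σ m'‖
            + ‖radialRetraction ρ θ - radialRetraction ρ θ'‖) :=
          hL' _ _ _ _ ((norm_radialRetraction_le hσ0 _).trans (le_max_right _ _))
            ((norm_radialRetraction_le hσ0 _).trans (le_max_right _ _))
            ((norm_radialRetraction_le hρ0 _).trans (le_max_left _ _))
            ((norm_radialRetraction_le hρ0 _).trans (le_max_left _ _))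
      _ ≤ |L'| * (2 * ‖m - m'‖ + 2 * ‖θ - θ'‖) := by
          gcongr
          · exact le_abs_self L'
          · exact norm_radialRetraction_sub_le hσ0 _ _
          · exact norm_radialRetraction_sub_le hρ0 _ _
      _ = |L'| * 2 * (‖m - m'‖ + ‖θ - θ'‖) := by ring
      _ ≤ _ := by gcongr
  · simp only [radialRetraction_eq_self hρ0 (hθ.trans hRρ)]
  · exact (hM θ (hθ.trans hRρ)).trans hMσ
  · simp only [radialRetraction_eq_self hρ0 (hθ.trans hRρ), radialRetraction_eq_self hσ0 hm]

end Truncation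

section LocalParticles

variable {E : Type v} [NormedAddCommGroup E] [InnerProductSpace ℝ E]
variable {H : Type u} [NormedAddCommGroup H] [InnerProductSpace ℝ H]
variable {O : E → E} {F F' : E → H} {a a' : H → E → E} {γ K R : ℝ} {N : ℕ}

omit [InnerProductSpace ℝ E] in
theorem IsTruncation.force_empiricalMean_eq (h : IsTruncation F a R F' a') {θ : Fin N → E}
    (hθ : ‖θ‖ ≤ R) (i : Fin N) :
    a' (empiricalMean F' θ) (θ i) = a (empiricalMean F θ) (θ i) := by
  have hi : ∀ j, ‖θ j‖ ≤ R := fun j => (norm_le_pi_norm θ j).trans hθ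
  obtain ⟨M, hM0, hM, ha⟩ := h.force
  have hm : empiricalMean F' θ = empiricalMean F θ := by
    simp only [empiricalMean, h.feature _ (hi _)]
  rw [hm, ha _ _ (norm_empiricalMean_le hM0 fun j => hM _ (hi j)) (hi i)]

theorem IsTruncation.particleField_eq (h : IsTruncation F a R F' a')
    {x : (Fin N → E) × (Fin N → E)} (hx : ‖x.1‖ ≤ R) :
    particleField O F' a' γ x = particleField O F a γ x := by
  simp only [particleField, h.force_empiricalMean_eq hx]

theorem IsTruncation.muonStep_eq (h : IsTruncation F a R F' a') {β η : ℝ}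
    {x : (Fin N → E) × (Fin N → E)} (hx : ‖x.1‖ ≤ R) :
    muonStep O F' a' β η x = muonStep O F a β η x := by
  simp only [muonStep, h.force_empiricalMean_eq hx]

/-- Since `O` is bounded, the parameters move with bounded speed, whatever the force. -/
theorem norm_fst_le_of_hasDerivWithinAt (hO : ∀ p, ‖O p‖ ≤ K) {T : ℝ}
    {y : ℝ → (Fin N → E) × (Fin N → E)}
    (hy : ∀ t ∈ Icc 0 T, HasDerivWithinAt y (particleField O F a γ (y t)) (Icc 0 T) t) :
    ∀ t ∈ Icc 0 T, ‖(y t).1‖ ≤ ‖(y 0).1‖ + K * T := by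
  intro t ht
  have hK : 0 ≤ K := (norm_nonneg _).trans (hO 0)
  have h1 := (convex_Icc 0 T).norm_image_sub_le_of_norm_hasDerivWithin_le
    (f := fun t => (y t).1) (f' := fun t => (particleField O F a γ (y t)).1) (C := K)
    (fun s hs => (hy s hs).fst)
    (fun s _ => (pi_norm_le_iff_of_nonneg hK).2 fun i => by
      simp only [particleField, norm_neg]
      exact hO _)
    (left_mem_Icc.2 (ht.1.trans ht.2)) ht
  rw [sub_zero, Real.norm_of_nonneg ht.1] at h1
  calc ‖(y t).1‖ = ‖(y 0).1 + ((y t).1 - (y 0).1)‖ := by simp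
    _ ≤ _ := (norm_add_le _ _).trans (by
      gcongr
      exact h1.trans (by gcongr; exact ht.2))

theorem norm_fst_muonIterate_le (hO : ∀ p, ‖O p‖ ≤ K) {β η : ℝ} (hη : 0 ≤ η)
    (x₀ : (Fin N → E) × (Fin N → E)) (k : ℕ) :
    ‖(muonIterate O F a β η x₀ k).1‖ ≤ ‖x₀.1‖ + K * (k * η) := by
  have hK : 0 ≤ K := (norm_nonneg _).trans (hO 0)
  induction k with
  | zero => simp [muonIterate]
  | succ k ih =>
    have hstep : muonIterate O F a β η x₀ (k + 1)
        = muonStep O F a β η (muonIterate O F a β η x₀ k) := Function.iterate_succ_apply' _ _ _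
    set x := muonIterate O F a β η x₀ k
    have h1 : ‖(muonStep O F a β η x).1‖ ≤ ‖x.1‖ + η * K := by
      refine (pi_norm_le_iff_of_nonneg (by positivity)).2 fun i => ?_
      simp only [muonStep]
      refine (norm_sub_le _ _).trans (add_le_add (norm_le_pi_norm x.1 i) ?_)
      rw [norm_smul, Real.norm_of_nonneg hη]
      gcongr
      exact hO _
    rw [hstep]
    push_cast
    linarith

theorem IsTruncation.muonIterate_eq (h : IsTruncation F a R F' a') (hO : ∀ p, ‖O p‖ ≤ K)
    {β η : ℝ} (hη : 0 ≤ η) {x₀ : (Fin N → E) × (Fin N → E)} (k : ℕ)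
    (hk : ‖x₀.1‖ + K * (k * η) ≤ R) :
    muonIterate O F' a' β η x₀ k = muonIterate O F a β η x₀ k := by
  have hK : 0 ≤ K := (norm_nonneg _).trans (hO 0)
  induction k with
  | zero => rfl
  | succ k ih =>
    have hk' : ‖x₀.1‖ + K * (k * η) ≤ R := hk.trans' (by
      push_cast
      gcongr
      linarith)
    have hstep : ∀ (F : E → H) (a : H → E → E), muonIterate O F a β η x₀ (k + 1)
        = muonStep O F a β η (muonIterate O F a β η x₀ k) :=
      fun _ _ => Function.iterate_succ_apply' _ _ _
    rw [hstep, hstep, ih hk', h.muonStep_eq ((norm_fst_muonIterate_le hO hη x₀ k).trans hk')]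

/-- Solutions on all the intervals `[0, n]` glue to a solution on `[0, ∞)`. -/
theorem exists_forall_hasDerivWithinAt_Ici {X : Type*} [NormedAddCommGroup X] [NormedSpace ℝ X]
    {V : X → X} {x₀ : X}
    (hex : ∀ n : ℕ, ∃ y : ℝ → X, y 0 = x₀ ∧
      ∀ t ∈ Icc (0 : ℝ) n, HasDerivWithinAt y (V (y t)) (Icc (0 : ℝ) n) t)
    (huniq : ∀ (T : ℝ) (y z : ℝ → X), y 0 = x₀ → z 0 = x₀ →
      (∀ t ∈ Icc 0 T, HasDerivWithinAt y (V (y t)) (Icc 0 T) t) →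
      (∀ t ∈ Icc 0 T, HasDerivWithinAt z (V (z t)) (Icc 0 T) t) → ∀ t ∈ Icc 0 T, y t = z t) :
    ∃ x : ℝ → X, x 0 = x₀ ∧ ∀ t ∈ Ici (0 : ℝ), HasDerivWithinAt x (V (x t)) (Ici 0) t := by
  choose y hy0 hy using hex
  have hceil : ∀ t : ℝ, t ≤ (⌈t⌉₊ + 1 : ℕ) := fun t => by
    push_cast
    linarith [Nat.le_ceil t]
  -- at time `t` the interval `[0, ⌈t⌉ + 1]` is used, so that `t` is not its right end point
  have heq : ∀ n : ℕ, ∀ t ∈ Icc (0 : ℝ) n, y (⌈t⌉₊ + 1) t = y n t := by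
    intro n t ht
    have hsol : ∀ k : ℕ, t ≤ k → ∀ s ∈ Icc 0 t, HasDerivWithinAt (y k) (V (y k s)) (Icc 0 t) s :=
      fun k hk s hs => (hy k s ⟨hs.1, hs.2.trans hk⟩).mono (Icc_subset_Icc_right hk)
    exact huniq t _ _ (hy0 _) (hy0 n) (hsol _ (hceil t)) (hsol n ht.2) t (right_mem_Icc.2 ht.1)
  refine ⟨fun t => y (⌈t⌉₊ + 1) t, hy0 _, fun t ht => ?_⟩
  have htn : t < (⌈t⌉₊ + 1 : ℕ) := by
    push_cast
    linarith [Nat.le_ceil t]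
  refine ((hy (⌈t⌉₊ + 1) t ⟨ht, htn.le⟩).congr (heq _) rfl).mono_of_mem_nhdsWithin ?_
  exact mem_nhdsWithin.2 ⟨Iio _, isOpen_Iio, htn, fun s hs => ⟨hs.2, le_of_lt hs.1⟩⟩

/-- The finite-particle limit for locally Lipschitz data. On `[0, T]`, both the system and the
scheme stay in a fixed ball, where they agree with those of a truncation. -/
theorem LocalLipschitzData.finiteParticleLimit [CompleteSpace E] (h : LocalLipschitzData O F a K)
    (hγ : 0 < γ) : FiniteParticleLimit O F a γ := by
  intro N _ x₀
  have hK := h.nonneg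
  have huniq : ∀ (T : ℝ) (y z : ℝ → (Fin N → E) × (Fin N → E)), y 0 = x₀ → z 0 = x₀ →
      (∀ t ∈ Icc 0 T, HasDerivWithinAt y (particleField O F a γ (y t)) (Icc 0 T) t) →
      (∀ t ∈ Icc 0 T, HasDerivWithinAt z (particleField O F a γ (z t)) (Icc 0 T) t) →
      ∀ t ∈ Icc 0 T, y t = z t := by
    intro T y z hy0 hz0 hy hz t ht
    obtain ⟨F', a', K', h', htr⟩ := h.exists_truncation (‖x₀.1‖ + K * T)
    obtain ⟨x, -, -, hx⟩ := h'.exists_particleSolution hγ x₀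
    have key : ∀ y : ℝ → (Fin N → E) × (Fin N → E), y 0 = x₀ →
        (∀ t ∈ Icc 0 T, HasDerivWithinAt y (particleField O F a γ (y t)) (Icc 0 T) t) →
        y t = x t := fun y hy0 hy => hx T y hy0 (fun s hs => by
      have := norm_fst_le_of_hasDerivWithinAt h.norm_orth_le hy s hs
      rw [hy0] at this
      rw [htr.particleField_eq this]
      exact hy s hs) t ht
    rw [key y hy0 hy, key z hz0 hz]
  have hex : ∀ n : ℕ, ∃ y : ℝ → (Fin N → E) × (Fin N → E), y 0 = x₀ ∧
      ∀ t ∈ Icc (0 : ℝ) n, HasDerivWithinAt y (particleField O F a γ (y t)) (Icc (0 : ℝ) n) t := by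
    intro n
    obtain ⟨F', a', K', h', htr⟩ := h.exists_truncation (‖x₀.1‖ + K * n)
    obtain ⟨x, hx0, hx, -⟩ := h'.exists_particleSolution hγ x₀
    refine ⟨x, hx0, fun t ht => ?_⟩
    have := norm_fst_le_of_hasDerivWithinAt h.norm_orth_le (T := n)
      (fun s _ => (hx s).hasDerivWithinAt) t ht
    rw [hx0] at this
    rw [← htr.particleField_eq this]
    exact (hx t).hasDerivWithinAt
  obtain ⟨x, hx0, hx⟩ := exists_forall_hasDerivWithinAt_Ici hex huniq
  have hxT : ∀ T, ∀ t ∈ Icc 0 T, HasDerivWithinAt x (particleField O F a γ (x t)) (Icc 0 T) t :=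
    fun T t ht => (hx t ht.1).mono Icc_subset_Ici_self
  refine ⟨fun t => (x t).1, fun t => (x t).2, isParticleSolution_iff.2 ⟨hx0, hx⟩,
    fun T θ' P' h' t ht => ?_, fun r hr T hT => ?_⟩
  · obtain ⟨h0, hd⟩ := isParticleSolution_iff.1 h'
    exact Prod.mk.inj (huniq T _ x h0 hx0 hd (hxT T) t ht)
  · subst hx0
    refine convergence_of_eventually_norm_sub_le (x := x) hr ?_
    obtain ⟨F', a', K', h', htr⟩ := h.exists_truncation (‖(x 0).1‖ + K * (T + 1))
    obtain ⟨C, hC⟩ := h'.exists_eventually_norm_sub_le hγ hT.le (x := x) (fun t ht => by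
      rw [htr.particleField_eq (norm_fst_le_of_hasDerivWithinAt h.norm_orth_le (hxT _) t ht)]
      exact hxT _ t ht) hr
    refine ⟨C, ?_⟩
    have hid : Tendsto (fun s : ℝ => s) (𝓝[>] 0) (𝓝 0) := tendsto_id.mono_left nhdsWithin_le_nhds
    filter_upwards [hC, self_mem_nhdsWithin, hid.eventually_le_const one_pos] with s hs hs0 hs1 t ht
    have hs0' : 0 < s := hs0
    have hfl : (⌊t / s⌋₊ : ℝ) * s ≤ t :=
      (le_div_iff₀ hs0').1 (Nat.floor_le (div_nonneg ht.1 hs0'.le))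
    -- the interpolation up to time `T` involves iterates up to time `T + s ≤ T + 1`
    have hit : ∀ k : ℕ, k * s ≤ T + 1 → muonIterate O F' a' (1 - γ * s + r s) s (x 0) k
        = muonIterate O F a (1 - γ * s + r s) s (x 0) k := fun k hk =>
      htr.muonIterate_eq h.norm_orth_le hs0'.le k (by gcongr)
    have h1 := hs t ht
    simp only [linearInterpolation] at h1 ⊢
    rwa [hit _ (by linarith [ht.2]), hit _ (by push_cast; linarith [ht.2])] at h1

end LocalParticles

section LocalMeanField

variable {E : Type v} [NormedAddCommGroup E] [InnerProductSpace ℝ E] [MeasurableSpace E]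
variable {H : Type u} [NormedAddCommGroup H] [InnerProductSpace ℝ H]
variable {O : E → E} {F F' : E → H} {a a' : H → E → E} {γ K R : ℝ} {μ₀ : Measure (E × E)}

omit [MeasurableSpace E] in
/-- For random parameters in the ball of radius `R`, the drift and its truncation agree. -/
theorem IsTruncation.drift_eq (h : IsTruncation F a R F' a') {Ω : Type*} [MeasurableSpace Ω]
    {Pr : Measure Ω} [IsProbabilityMeasure Pr] {Y : Ω → E × E} (hY : ∀ᵐ x ∂Pr, ‖(Y x).1‖ ≤ R)
    {z : E × E} (hz : ‖z.1‖ ≤ R) :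
    drift O a' γ (∫ x, F' (Y x).1 ∂Pr) z = drift O a γ (∫ x, F (Y x).1 ∂Pr) z := by
  obtain ⟨M, hM0, hM, ha⟩ := h.force
  have h1 : ∫ x, F' (Y x).1 ∂Pr = ∫ x, F (Y x).1 ∂Pr := integral_congr_ae <| by
    filter_upwards [hY] with x hx using h.feature _ hx
  have h2 : ‖∫ x, F (Y x).1 ∂Pr‖ ≤ M := by
    refine (norm_integral_le_of_norm_le_const (C := M) ?_).trans (by simp)
    filter_upwards [hY] with x hx using hM _ hx
  simp only [drift, h1, ha _ _ h2 hz]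

theorem IsTruncation.isWeakSolution_iff (h : IsTruncation F a R F' a') {S : Set ℝ}
    {μ : ℝ → Measure (E × E)} (hμ : ∀ t ∈ S, ∀ᵐ z ∂(μ t), ‖z.1‖ ≤ R) :
    IsWeakSolution O F' a' γ μ₀ S μ ↔ IsWeakSolution O F a γ μ₀ S μ := by
  have key : IsContinuousCurve S μ → ∀ (ζ : E × E → ℝ), ∀ t ∈ S,
      ∫ z, fderiv ℝ ζ z (drift O a' γ (∫ y, F' y.1 ∂(μ t)) z) ∂(μ t)
        = ∫ z, fderiv ℝ ζ z (drift O a γ (∫ y, F y.1 ∂(μ t)) z) ∂(μ t) := by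
    intro hc ζ t ht
    have := hc.isProbabilityMeasure t ht
    refine integral_congr_ae ?_
    filter_upwards [hμ t ht] with z hz
    exact congrArg _ (h.drift_eq (Y := fun y => y) (hμ t ht) hz)
  constructor
  · rintro ⟨hc, hi, hw⟩
    refine ⟨hc, hi, fun ζ hζ hζc t ht => ?_⟩
    rw [← key hc ζ t ht]
    exact hw ζ hζ hζc t ht
  · rintro ⟨hc, hi, hw⟩
    refine ⟨hc, hi, fun ζ hζ hζc t ht => ?_⟩
    rw [key hc ζ t ht]
    exact hw ζ hζ hζc t ht

theorem IsTruncation.isCharacteristic_iff (h : IsTruncation F a R F' a') {S : Set ℝ}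
    {Ω : Type w} [MeasurableSpace Ω] {Pr : Measure Ω} [IsProbabilityMeasure Pr] {Y₀ : Ω → E × E}
    {Y : ℝ → Ω → E × E} (hY : ∀ᵐ x ∂Pr, ∀ t ∈ S, ‖(Y t x).1‖ ≤ R) :
    IsCharacteristic O F' a' γ Pr Y₀ S Y ↔ IsCharacteristic O F a γ Pr Y₀ S Y := by
  have key : ∀ t ∈ S, ∀ z : E × E, ‖z.1‖ ≤ R → drift O a' γ (∫ x, F' (Y t x).1 ∂Pr) z
      = drift O a γ (∫ x, F (Y t x).1 ∂Pr) z := fun t ht z hz =>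
    h.drift_eq (by filter_upwards [hY] with x hx using hx t ht) hz
  constructor
  · rintro ⟨hm, hi, hd⟩
    refine ⟨hm, hi, ?_⟩
    filter_upwards [hY, hd] with x hx hdx t ht
    rw [← key t ht _ (hx t ht)]
    exact hdx t ht
  · rintro ⟨hm, hi, hd⟩
    refine ⟨hm, hi, ?_⟩
    filter_upwards [hY, hd] with x hx hdx t ht
    rw [key t ht _ (hx t ht)]
    exact hdx t ht

theorem IsCharacteristic.norm_fst_le {T r : ℝ} {Ω : Type w} [MeasurableSpace Ω] {Pr : Measure Ω}
    {Y₀ : Ω → E × E} {Y : ℝ → Ω → E × E} (hY : IsCharacteristic O F a γ Pr Y₀ (Icc 0 T) Y)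
    (hO : ∀ p, ‖O p‖ ≤ K) (hr : ∀ᵐ x ∂Pr, ‖Y₀ x‖ ≤ r) :
    ∀ᵐ x ∂Pr, ∀ t ∈ Icc 0 T, ‖(Y t x).1‖ ≤ r + K * T := by
  have hK : 0 ≤ K := (norm_nonneg _).trans (hO 0)
  filter_upwards [hY.norm_fst_sub_le hO, hY.init, hr] with x hx h0 hrx t ht
  have h1 := hx 0 (left_mem_Icc.2 (ht.1.trans ht.2)) t ht
  rw [h0, sub_zero, abs_of_nonneg ht.1] at h1
  calc ‖(Y t x).1‖ = ‖(Y₀ x).1 + ((Y t x).1 - (Y₀ x).1)‖ := by simp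
    _ ≤ _ := (norm_add_le _ _).trans (add_le_add ((_root_.norm_fst_le _).trans hrx)
      (h1.trans (by gcongr; exact ht.2)))

variable [FiniteDimensional ℝ E] [BorelSpace E]

/-- Well-posedness of the mean-field equation among solutions that stay bounded, for locally
Lipschitz data: on `[0, T]`, bounded solutions and characteristics are those of a truncation. -/
theorem LocalLipschitzData.meanFieldLocallyWellPosed (h : LocalLipschitzData O F a K)
    (hγ : 0 < γ) : MeanFieldLocallyWellPosed.{u, v, w} O F a γ := by
  rintro μ₀ hp ⟨r, hr⟩ T -
  have hμ : Integrable (fun z => ‖z‖) μ₀ :=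
    Integrable.of_bound continuous_norm.aestronglyMeasurable r (by simpa using hr)
  obtain ⟨F', a', K', h', htr⟩ := h.exists_truncation (r + K * T)
  obtain ⟨u, hu0, hu⟩ := (h'.lipschitzInteraction hγ).exists_meanField_flow hμ
  have huc : Continuous u := continuous_iff_continuousAt.2 fun t => (hu t).continuousAt
  -- the flow itself is a characteristic, on the probability space of initial values
  have hflow : ∀ᵐ z ∂μ₀, ∀ t ∈ Icc 0 T, ‖(displace (u t) z).1‖ ≤ r + K * T :=
    (isCharacteristic_displace (Y₀ := id) hu0 hu measurable_id Measure.map_id _).norm_fst_le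
      h.norm_orth_le hr
  have hball : ∀ t ∈ Icc 0 T, ∀ᵐ z ∂(μ₀.map (displace (u t))), ‖z.1‖ ≤ r + K * T := by
    intro t ht
    refine (ae_map_iff (continuous_displace (u t)).measurable.aemeasurable
      (isClosed_le continuous_fst.norm continuous_const).measurableSet).2 ?_
    filter_upwards [hflow] with z hz using hz t ht
  have hsol := (htr.isWeakSolution_iff hball).1
    (isWeakSolution_map_displace (γ := γ) hμ hu0 hu (Icc 0 T))
  refine ⟨_, hsol, ?_, fun ν hν => ?_, ?_⟩
  · obtain ⟨U, hU⟩ := isCompact_Icc.exists_bound_of_continuousOn (huc.continuousOn (s := Icc 0 T))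
    refine ⟨r + (1 + r) * U, fun t ht => (ae_map_iff
      (continuous_displace (u t)).measurable.aemeasurable
      (isClosed_le continuous_norm continuous_const).measurableSet).2 ?_⟩
    filter_upwards [hr] with z hz
    have h1 := norm_displace_sub_self_le (u t) z
    have h2 := hU t ht
    calc ‖displace (u t) z‖ = ‖z + (displace (u t) z - z)‖ := by simp
      _ ≤ r + (1 + r) * U := (norm_add_le _ _).trans (add_le_add hz (h1.trans (by
          gcongr
          linarith [norm_nonneg z])))
  · rintro ⟨r', hr'⟩ t ht
    obtain ⟨F'', a'', K'', h'', htr''⟩ := h.exists_truncation (max (r + K * T) r')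
    obtain ⟨μ, -, huniq, -⟩ := h''.meanFieldWellPosed.{u, v, 0} hγ μ₀ hp hμ
    have hν' := (htr''.isWeakSolution_iff fun s hs => by
      filter_upwards [hr' s hs] with z hz
      exact ((_root_.norm_fst_le z).trans hz).trans (le_max_right _ _)).2 hν
    have hsol' := (htr''.isWeakSolution_iff fun s hs => by
      filter_upwards [hball s hs] with z hz
      exact hz.trans (le_max_left _ _)).2 hsol
    rw [huniq T ν hν' t ht]
    exact (huniq T _ hsol' t ht).symm
  · intro Ω _ Pr _ Y₀ hY₀ hlaw
    have hr₀ : ∀ᵐ x ∂Pr, ‖Y₀ x‖ ≤ r := by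
      rw [← hlaw] at hr
      exact ae_of_ae_map hY₀.aemeasurable hr
    obtain ⟨Y, hY, hYu, hYl⟩ :=
      isLawOfCharacteristics_Icc.{u, v, w} hμ hu0 hu h.norm_orth_le T Ω Pr Y₀ hY₀ hlaw
    exact ⟨Y, (htr.isCharacteristic_iff (hY.norm_fst_le h.norm_orth_le hr₀)).1 hY,
      fun Y' hY' => hYu Y'
        ((htr.isCharacteristic_iff (hY'.norm_fst_le h.norm_orth_le hr₀)).2 hY'), hYl⟩

end LocalMeanField

/-! ### From smoothness hypotheses to Lipschitz data -/

section Smoothness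

variable {E : Type v} [NormedAddCommGroup E] [InnerProductSpace ℝ E] [CompleteSpace E]
variable {H : Type u} [NormedAddCommGroup H] [InnerProductSpace ℝ H] [CompleteSpace H]
variable {O : E → E} {F : E → H} {R : H → ℝ} {K : ℝ}

theorem norm_adjoint_apply_sub_le (A A' : E →L[ℝ] H) (g g' : H) :
    ‖ContinuousLinearMap.adjoint A g - ContinuousLinearMap.adjoint A' g'‖
      ≤ ‖A - A'‖ * ‖g‖ + ‖A'‖ * ‖g - g'‖ := by
  have h : ContinuousLinearMap.adjoint A g - ContinuousLinearMap.adjoint A' g'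
      = ContinuousLinearMap.adjoint (A - A') g + ContinuousLinearMap.adjoint A' (g - g') := by
    simp only [map_sub, sub_apply]
    abel
  rw [h]
  refine (norm_add_le _ _).trans (add_le_add ?_ ?_)
  · refine (ContinuousLinearMap.le_opNorm _ _).trans_eq ?_
    rw [LinearIsometryEquiv.norm_map]
  · refine (ContinuousLinearMap.le_opNorm _ _).trans_eq ?_
    rw [LinearIsometryEquiv.norm_map]

/-- The joint Lipschitz bound for the force `DF(θ)* ∇R(m)`, from bounds and Lipschitz bounds for its
two factors at the points in question. -/
theorem norm_hilbertForce_sub_le {m m' : H} {θ θ' : E} {M L M' L' : ℝ}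
    (h1 : ‖fderiv ℝ F θ'‖ ≤ M) (h2 : ‖fderiv ℝ F θ - fderiv ℝ F θ'‖ ≤ L * ‖θ - θ'‖)
    (h3 : ‖gradient R m‖ ≤ M') (h4 : ‖gradient R m - gradient R m'‖ ≤ L' * ‖m - m'‖) :
    ‖hilbertForce F R m θ - hilbertForce F R m' θ'‖
      ≤ (|L| * M' + M * |L'|) * (‖m - m'‖ + ‖θ - θ'‖) := by
  have hM : 0 ≤ M := (norm_nonneg _).trans h1
  have hM' : 0 ≤ M' := (norm_nonneg _).trans h3
  have h2' : ‖fderiv ℝ F θ - fderiv ℝ F θ'‖ ≤ |L| * ‖θ - θ'‖ :=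
    h2.trans (mul_le_mul_of_nonneg_right (le_abs_self L) (norm_nonneg _))
  have h4' : ‖gradient R m - gradient R m'‖ ≤ |L'| * ‖m - m'‖ :=
    h4.trans (mul_le_mul_of_nonneg_right (le_abs_self L') (norm_nonneg _))
  calc _ ≤ |L| * ‖θ - θ'‖ * M' + M * (|L'| * ‖m - m'‖) :=
        (norm_adjoint_apply_sub_le _ _ _ _).trans (by gcongr)
    _ ≤ _ := by
        have h5 : 0 ≤ |L| * M' * ‖m - m'‖ := by positivity
        have h6 : 0 ≤ M * |L'| * ‖θ - θ'‖ := by positivity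
        linarith

theorem GlobalSmoothness.exists_lipschitzData (h : GlobalSmoothness F R) {C : ℝ}
    (hO : ∀ p, ‖O p‖ ≤ C) (hO' : ∀ p p', ‖O p - O p'‖ ≤ K * ‖p - p'‖) :
    ∃ K', LipschitzData O F (hilbertForce F R) K' := by
  obtain ⟨L, hL⟩ := h.lipschitz_F
  obtain ⟨M₁, hM₁⟩ := h.bounded_DF
  obtain ⟨L₁, hL₁⟩ := h.lipschitz_DF
  obtain ⟨M₂, hM₂⟩ := h.bounded_grad_R
  obtain ⟨L₂, hL₂⟩ := h.lipschitz_grad_R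
  have h0 := le_abs_self (|L₁| * M₂ + M₁ * |L₂|)
  have h1 := le_abs_self C
  have h2 := le_abs_self K
  have h3 := le_abs_self L
  have h4 := abs_nonneg (|L₁| * M₂ + M₁ * |L₂|)
  have h5 := abs_nonneg C
  have h6 := abs_nonneg K
  have h7 := abs_nonneg L
  refine ⟨|C| + |K| + |L| + |(|L₁| * M₂ + M₁ * |L₂|)|, by positivity,
    fun p => (hO p).trans (by linarith), fun p p' => (hO' p p').trans ?_,
    fun θ θ' => (hL θ θ').trans ?_, fun m m' θ θ' => (norm_hilbertForce_sub_le (hM₁ _) (hL₁ _ _)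
      (hM₂ _) (hL₂ _ _)).trans ?_⟩ <;>
    exact mul_le_mul_of_nonneg_right (by linarith) (by positivity)

theorem LocalizedSmoothness.exists_localLipschitzData (h : LocalizedSmoothness F R) {C : ℝ}
    (hO : ∀ p, ‖O p‖ ≤ C) (hO' : ∀ p p', ‖O p - O p'‖ ≤ K * ‖p - p'‖) :
    ∃ K', LocalLipschitzData O F (hilbertForce F R) K' := by
  refine ⟨|C| + |K|, by positivity, fun p => (hO p).trans ?_, fun p p' => (hO' p p').trans ?_,
    h.bounded_F, h.lipschitz_F, fun r => ?_⟩
  · linarith [le_abs_self C, abs_nonneg K]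
  · gcongr
    linarith [le_abs_self K, abs_nonneg C]
  · obtain ⟨M₁, hM₁⟩ := h.bounded_DF r
    obtain ⟨L₁, hL₁⟩ := h.lipschitz_DF r
    obtain ⟨M₂, hM₂⟩ := h.bounded_grad_R r
    obtain ⟨L₂, hL₂⟩ := h.lipschitz_grad_R r
    exact ⟨_, fun m m' θ θ' hm hm' hθ hθ' => norm_hilbertForce_sub_le (hM₁ _ hθ') (hL₁ _ _ hθ hθ')
      (hM₂ _ hm) (hL₂ _ _ hm hm')⟩

theorem fderiv_eq_toDual_gradient (F : E → ℝ) (θ : E) :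
    fderiv ℝ F θ = InnerProductSpace.toDual ℝ E (gradient F θ) := by
  rw [gradient, LinearIsometryEquiv.apply_symm_apply]

/-- The force for scalar data is the force for Hilbert-valued data with values in `ℝ`. -/
theorem scalarForce_eq_hilbertForce (F : E → ℝ) (R : ℝ → ℝ) :
    scalarForce F R = hilbertForce F R := by
  funext s θ
  refine ext_inner_right ℝ fun x => ?_
  rw [scalarForce, hilbertForce, ContinuousLinearMap.adjoint_inner_left, gradient_eq_deriv',
    fderiv_eq_toDual_gradient, InnerProductSpace.toDual_apply_apply, real_inner_smul_left]
  simp [mul_comm]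

/-- The mean value inequality gives the Lipschitz bound for `F` from the bound for its gradient. -/
theorem BasicSmoothness.globalSmoothness {F : E → ℝ} {R : ℝ → ℝ} (h : BasicSmoothness F R) :
    GlobalSmoothness F R := by
  have hd : Differentiable ℝ F := h.contDiff.differentiable one_ne_zero
  obtain ⟨M, hM⟩ := h.bounded_grad
  obtain ⟨L, hL⟩ := h.lipschitz_grad
  obtain ⟨M', hM'⟩ := h.bounded_deriv
  obtain ⟨L', hL'⟩ := h.lipschitz_deriv
  have hM₁ : ∀ θ, ‖fderiv ℝ F θ‖ ≤ M := fun θ => by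
    rw [fderiv_eq_toDual_gradient, LinearIsometryEquiv.norm_map]
    exact hM θ
  refine ⟨hd, ⟨M, fun x y => ?_⟩, ⟨M, hM₁⟩, ⟨L, fun x y => ?_⟩, h.differentiable,
    ⟨M', fun s => ?_⟩, ⟨L', fun s t => ?_⟩⟩
  · exact convex_univ.norm_image_sub_le_of_norm_fderiv_le (fun z _ => hd z) (fun z _ => hM₁ z)
      (mem_univ y) (mem_univ x)
  · rw [fderiv_eq_toDual_gradient, fderiv_eq_toDual_gradient, ← map_sub,
      LinearIsometryEquiv.norm_map]
    exact hL x y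
  · rw [gradient_eq_deriv']
    exact hM' s
  · rw [gradient_eq_deriv', gradient_eq_deriv']
    exact hL' s t

end Smoothness
end Muon

theorem mainTheorem1 (ε γ : ℝ) (hε : 0 < ε) (hγ : 0 < γ) :
    -- a single matrix space and scalar features
    (∀ (p q : ℕ) (F : Muon.MatrixSpace p q → ℝ) (R : ℝ → ℝ),
      (Muon.BasicSmoothness F R →
        Muon.FiniteParticleLimit (Muon.orth ε) F (Muon.scalarForce F R) γ ∧
        Muon.MeanFieldWellPosed.{0, 0, w} (Muon.orth ε) F (Muon.scalarForce F R) γ) ∧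
      (Muon.LocalizedSmoothness F R →
        Muon.FiniteParticleLimit (Muon.orth ε) F (Muon.scalarForce F R) γ ∧
        Muon.MeanFieldLocallyWellPosed.{0, 0, w} (Muon.orth ε) F (Muon.scalarForce F R) γ)) ∧
    -- a finite product of matrix spaces and Hilbert-valued features
    (∀ (B : ℕ) (m n : Fin B → ℕ) (H : Type u) [NormedAddCommGroup H] [InnerProductSpace ℝ H]
        [CompleteSpace H] (F : Muon.ProductSpace m n → H) (R : H → ℝ),
      (Muon.GlobalSmoothness F R →
        Muon.FiniteParticleLimit (Muon.orthProduct ε) F (Muon.hilbertForce F R) γ ∧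
        Muon.MeanFieldWellPosed.{u, 0, w} (Muon.orthProduct ε) F (Muon.hilbertForce F R) γ) ∧
      (Muon.LocalizedSmoothness F R →
        Muon.FiniteParticleLimit (Muon.orthProduct ε) F (Muon.hilbertForce F R) γ ∧
        Muon.MeanFieldLocallyWellPosed.{u, 0, w} (Muon.orthProduct ε) F
          (Muon.hilbertForce F R) γ)) := by
  constructor
  · intro p q F R
    have hb := Muon.norm_orth_le (m := p) (n := q) hε
    have hl := Muon.norm_orth_sub_le (m := p) (n := q) hε
    rw [Muon.scalarForce_eq_hilbertForce]
    constructor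
    · intro h
      obtain ⟨K, hK⟩ := h.globalSmoothness.exists_lipschitzData hb hl
      exact ⟨hK.finiteParticleLimit hγ, hK.meanFieldWellPosed hγ⟩
    · intro h
      obtain ⟨K, hK⟩ := h.exists_localLipschitzData hb hl
      exact ⟨hK.finiteParticleLimit hγ, hK.meanFieldLocallyWellPosed hγ⟩
  · intro B m n H _ _ _ F R
    have hb := Muon.norm_orthProduct_le (m := m) (n := n) hε
    have hl := Muon.norm_orthProduct_sub_le (m := m) (n := n) hε
    constructor
    · intro h
      obtain ⟨K, hK⟩ := h.exists_lipschitzData hb hl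
      exact ⟨hK.finiteParticleLimit hγ, hK.meanFieldWellPosed hγ⟩
    · intro h
      obtain ⟨K, hK⟩ := h.exists_localLipschitzData hb hl
      exact ⟨hK.finiteParticleLimit hγ, hK.meanFieldLocallyWellPosed hγ⟩
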